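/- Let $n\ge 4$ and let $\Sigma\subset\{0,1\}^{n\times n}$ be an automaton with $n$ states, i.e. a set of $0/1$ matrices (letters) with exactly one $1$ in each row; $L_{ij}=1$ means that the letter $L$ maps state $i$ to state $j$, and words of length $t$ are products of $t$ letters. Suppose that $\Sigma$ is strongly connected (for all states $i,j$ some word maps $i$ to $j$) and synchronizing (some word maps all states to one single state). Let the triple rendezvous time $T_{3,\Sigma}$ be the smallest $t$ such that some word of length at most $t$ has a column with at least three non-zero entries, i.e. maps three distinct states to one state. Then such a $t$ exists, and $$T_{3,\Sigma}\le \frac{n\left(\sqrt{5n^2+4n-12}-n+6\right)}{8}.$$ The right-hand side divided by $n^2$ tends to $(\sqrt5-1)/8=1/6.47\ldots$ as $n\to\infty$; in particular, there is an $N$ such that $T_{3,\Sigma}<n^2/6.4$ for every $n\ge N$ and every strongly connected synchronizing automaton $\Sigma$ with $n$ states. -/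

import Mathlib

open scoped Matrix
open Filter Topology

/-- A (deterministic, finite state, complete) automaton with `n` states, given as its set of
letters: every letter is an `n × n` matrix with entries in `{0, 1}` such that `L eᵀ = eᵀ`,
where `e` is the all-ones vector. The entry `L i j = 1` means that the letter maps state `i`
to state `j`. -/
def IsAutomaton {n : ℕ} (S : Set (Matrix (Fin n) (Fin n) ℕ)) : Prop :=
  ∀ L ∈ S, (∀ i j, L i j = 0 ∨ L i j = 1) ∧ L *ᵥ (1 : Fin n → ℕ) = 1

/-- The products of length `t` of letters of the automaton, i.e. the words of length `t`. -/
def wordsOfLength {n : ℕ} (S : Set (Matrix (Fin n) (Fin n) ℕ)) (t : ℕ) :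
    Set (Matrix (Fin n) (Fin n) ℕ) :=
  {W | ∃ l : List (Matrix (Fin n) (Fin n) ℕ), l.length = t ∧ (∀ L ∈ l, L ∈ S) ∧ l.prod = W}

/-- The products of length at most `t` (including the empty product, the identity matrix). -/
def wordsUpTo {n : ℕ} (S : Set (Matrix (Fin n) (Fin n) ℕ)) (t : ℕ) :
    Set (Matrix (Fin n) (Fin n) ℕ) :=
  {W | ∃ s ≤ t, W ∈ wordsOfLength S s}

/-- The automaton is synchronizing: some word `W` equals `eᵀ eᵢ`, i.e. maps every state to the
same state `i`. -/
def IsSynchronizing {n : ℕ} (S : Set (Matrix (Fin n) (Fin n) ℕ)) : Prop :=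
  ∃ i : Fin n, ∃ t : ℕ,
    Matrix.vecMulVec (1 : Fin n → ℕ) (Pi.single i 1) ∈ wordsOfLength S t

/-- The automaton is strongly connected: every state can be mapped to every state by a word. -/
def IsStronglyConnected {n : ℕ} (S : Set (Matrix (Fin n) (Fin n) ℕ)) : Prop :=
  ∀ i j : Fin n, ∃ t : ℕ, ∃ W ∈ wordsOfLength S t, W i j = 1

/-- The set `A(t)` of vectors reachable at `t`: the columns of the words of length at most `t`. -/
def reachableVectors {n : ℕ} (S : Set (Matrix (Fin n) (Fin n) ℕ)) (t : ℕ) : Set (Fin n → ℕ) :=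
  {v | ∃ W ∈ wordsUpTo S t, ∃ j : Fin n, v = fun i => W i j}

/-- The weight of a vector: the number of its non-zero entries. -/
noncomputable def weight {n : ℕ} (v : Fin n → ℕ) : ℕ :=
  {i | v i ≠ 0}.ncard

/-- The integers `t` such that `A(t)` contains a column of weight at least three. -/
def tripleTimes {n : ℕ} (S : Set (Matrix (Fin n) (Fin n) ℕ)) : Set ℕ :=
  {t | ∃ v ∈ reachableVectors S t, 3 ≤ weight v}

/-- The triple rendezvous time `T₃`: the smallest `t` such that `A(t)` contains a column of
weight at least three. (Meaningful when `tripleTimes S` is nonempty.) -/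
noncomputable def tripleRendezvousTime {n : ℕ} (S : Set (Matrix (Fin n) (Fin n) ℕ)) : ℕ :=
  sInf (tripleTimes S)

/-- The bound `n (√(5n² + 4n − 12) − n + 6) / 8`. -/
noncomputable def tripleBound (n : ℕ) : ℝ :=
  (n : ℝ) * (Real.sqrt (5 * (n : ℝ) ^ 2 + 4 * (n : ℝ) - 12) - (n : ℝ) + 6) / 8

/-! Suppose that no word of length less than `T` merges three states. Join two states at time `t` if
a word of length at most `t` merges them; the edges of this graph `mergeGraph S t` are counted in
two ways.

Lower bound: if `q` has two preimages under a letter `a`, then no short word merges `q` with another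
state in the image of `a`, since this would merge three states. So some pair is still unmerged, and
synchronization forces a new edge in every step before `T` (`live_numEdges_add_le`).

Upper bound: if `x` has two preimages under a word `f`, all early neighbours of `x` are missed by
`f`, so the degree of `x` is at most `defect f` (`deg_le_defect`). By strong connectivity, every
state is such an `x` for a short word, with one more letter allowed for each further state
(`exists_greedy`).

It remains to bound the defects of short words, which is done by linear programming. Consider
weights in `[0, 1]` on the states with sum at most one on each edge. Their maximal total is `(n +
deficiency) / 2`, and pushing an optimal weighting along a word of length `j` and defect `δ` yields
`2 δ + deficiency ≤ n` at time `j` (`two_mul_defect_add_deficiency`). While the deficiency is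
constant, the dimension of the face of optimal weightings drops in each step (`optDim_lt`), for
otherwise its affine hull would be invariant under all letters and would contain a weighting
concentrated in one state. As the dimension is bounded in terms of the deficiency (`optDim_bound`),
adding up the stages gives `T ≤ j + stageSum (2 * δ) n`, roughly `j + n ^ 2 / 4 - δ ^ 2`
(`le_stageSum_of_word`). Early words therefore have small defect.

Together these give the inequality `lpCap_count`. It contradicts a larger `T` for `n ≥ 28` by an
estimate (`lpCap_large`) and for smaller `n` by evaluation (`lpCap_small`), except when `n < 14` and
all letters have defect at most one. There, two different doubled states are excluded by counting
(`two_dups_false`). If there is a single doubled state `q`, then either `q` is isolated, which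
improves the defect bounds (`isolated_false`), or all letters that are not bijective miss the same
state `z`, the only possible neighbour of `q`. In the latter case the action of the bijective
letters on `q` and `z` yields more states of small degree, or a pair that is never merged and can be
added to the edge count (`SameMiss.isFamily_sup`). Four and five states require tracing individual
edges. -/

set_option linter.unusedSectionVars false

/-! ### Words as maps, merge graphs and dead sets of pairs -/

section Automaton

variable {V : Type*}

/-- `IsWord S t f`: the map `f` is a composition of `t` letters of `S`. -/
inductive IsWord (S : Set (V → V)) : ℕ → (V → V) → Prop
  | nil : IsWord S 0 id
  | cons {t : ℕ} {f g : V → V} : f ∈ S → IsWord S t g → IsWord S (t + 1) (g ∘ f)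

theorem IsWord.append {S : Set (V → V)} {s t : ℕ} {f g : V → V} (hf : IsWord S s f)
    (hg : IsWord S t g) : IsWord S (t + s) (g ∘ f) := by
  induction hf with
  | nil => simpa using hg
  | @cons s f h hL _ ih => exact IsWord.cons (g := g ∘ h) hL ih

theorem IsWord.letter {S : Set (V → V)} {f : V → V} (hf : f ∈ S) : IsWord S 1 f :=
  IsWord.cons (g := id) hf IsWord.nil

theorem IsWord.snoc {S : Set (V → V)} {t : ℕ} {f g : V → V} (hf : IsWord S t f) (hg : g ∈ S) :
    IsWord S (t + 1) (g ∘ f) := by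
  have := hf.append (IsWord.letter hg)
  rwa [Nat.add_comm] at this

/-- No word of length less than `T` maps three distinct states to one state. -/
def TripleFree (S : Set (V → V)) (T : ℕ) : Prop :=
  ∀ t < T, ∀ f, IsWord S t f → ∀ x y z, f x = f y → f y = f z → x = y ∨ y = z ∨ x = z

theorem TripleFree.mono {S : Set (V → V)} {T T' : ℕ} (h : TripleFree S T) (hT : T' ≤ T) :
    TripleFree S T' := fun t ht => h t (ht.trans_le hT)

/-- Every state is mapped to every state by some word. -/
def StronglyConnected (S : Set (V → V)) : Prop :=
  ∀ x y, ∃ t f, IsWord S t f ∧ f x = y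

/-- Some word maps all states to one state. -/
def Synchronizing (S : Set (V → V)) : Prop :=
  ∃ x t f, IsWord S t f ∧ ∀ y, f y = x

/-- The graph of the pairs of states that are merged by a word of length at most `t`. -/
def mergeGraph (S : Set (V → V)) (t : ℕ) : SimpleGraph V where
  Adj x y := x ≠ y ∧ ∃ s ≤ t, ∃ f, IsWord S s f ∧ f x = f y
  symm := ⟨fun _ _ ⟨h, s, hs, f, hf, e⟩ => ⟨h.symm, s, hs, f, hf, e.symm⟩⟩
  loopless := ⟨fun _ h => h.1 rfl⟩

theorem mergeGraph_mono {S : Set (V → V)} {s t : ℕ} (h : s ≤ t) :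
    mergeGraph S s ≤ mergeGraph S t :=
  fun _ _ ⟨hxy, r, hr, f, hf, e⟩ => ⟨hxy, r, hr.trans h, f, hf, e⟩

theorem mergeGraph_zero_adj {S : Set (V → V)} {x y : V} : ¬ (mergeGraph S 0).Adj x y := by
  rintro ⟨h, s, hs, f, hf, e⟩
  obtain rfl : s = 0 := by omega
  cases hf
  exact h e

theorem mergeGraph_succ_adj {S : Set (V → V)} {t : ℕ} {x y : V} :
    (mergeGraph S (t + 1)).Adj x y ↔
      x ≠ y ∧ ∃ L ∈ S, L x = L y ∨ (mergeGraph S t).Adj (L x) (L y) := by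
  constructor
  · rintro ⟨h, s, hs, f, hf, e⟩
    refine ⟨h, ?_⟩
    cases hf with
    | nil => exact absurd e h
    | @cons s L g hL hg =>
      refine ⟨L, hL, ?_⟩
      by_cases hxy : L x = L y
      · exact Or.inl hxy
      · exact Or.inr ⟨hxy, s, by omega, g, hg, e⟩
  · rintro ⟨h, L, hL, e | ⟨_, s, hs, f, hf, e⟩⟩
    · exact ⟨h, 1, by omega, L, IsWord.letter hL, e⟩
    · exact ⟨h, s + 1, by omega, f ∘ L, IsWord.cons hL hf, e⟩

theorem mergeGraph_adj_of_letter {S : Set (V → V)} {t : ℕ} {x y : V} {L : V → V} (hL : L ∈ S)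
    (h : (mergeGraph S t).Adj (L x) (L y)) : (mergeGraph S (t + 1)).Adj x y :=
  mergeGraph_succ_adj.2 ⟨fun e => h.1 (congrArg L e), L, hL, Or.inr h⟩

theorem mergeGraph_adj_of_eq {S : Set (V → V)} {t : ℕ} {x y : V} {L : V → V} (hL : L ∈ S)
    (hxy : x ≠ y) (h : L x = L y) : (mergeGraph S (t + 1)).Adj x y :=
  mergeGraph_succ_adj.2 ⟨hxy, L, hL, Or.inl h⟩

/-- A set of pairs is dead if its preimages under letters lie in it. -/
def IsDead (S : Set (V → V)) (D : SimpleGraph V) : Prop :=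
  ∀ L ∈ S, ∀ x y, x ≠ y → D.Adj (L x) (L y) → D.Adj x y

theorem isDead_bot (S : Set (V → V)) : IsDead S ⊥ := fun _ _ _ _ _ h => h.elim

/-- A letter sends a pair outside a dead set to one state or to another pair outside it, so the live
part of a merge graph determines the live part of the next one. Once a step adds nothing, no later
step does. -/
theorem live_stable {S : Set (V → V)} {D : SimpleGraph V} (hD : IsDead S D) {t : ℕ}
    (h : mergeGraph S (t + 1) \ D ≤ mergeGraph S t \ D) (s : ℕ) :
    mergeGraph S s \ D ≤ mergeGraph S t \ D := by
  induction s with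
  | zero => rintro x y ⟨h0, _⟩; exact (mergeGraph_zero_adj h0).elim
  | succ s ih =>
    rintro x y ⟨hs, hxy⟩
    obtain ⟨hne, L, hL, e | e⟩ := mergeGraph_succ_adj.1 hs
    · exact h ⟨mergeGraph_adj_of_eq hL hne e, hxy⟩
    · have hLD : ¬ D.Adj (L x) (L y) := fun hd => hxy (hD L hL x y hne hd)
      have := ih (show (mergeGraph S s \ D).Adj (L x) (L y) from ⟨e, hLD⟩)
      exact h ⟨mergeGraph_adj_of_letter hL this.1, hxy⟩

/-- Synchronization merges every pair eventually, so the live part cannot stop growing while a live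
pair is unmerged. -/
theorem live_lt_succ {S : Set (V → V)} (hsync : Synchronizing S) {D : SimpleGraph V}
    (hD : IsDead S D) {t : ℕ} {x y : V} (hxy : x ≠ y) (hDxy : ¬ D.Adj x y)
    (hG : ¬ (mergeGraph S t).Adj x y) : mergeGraph S t \ D < mergeGraph S (t + 1) \ D := by
  refine lt_of_le_not_ge (sdiff_le_sdiff_right (mergeGraph_mono (Nat.le_succ t))) fun h => ?_
  obtain ⟨w, s, f, hf, hw⟩ := hsync
  have := live_stable hD h s (show (mergeGraph S s \ D).Adj x y from
    ⟨⟨hxy, s, le_rfl, f, hf, by rw [hw, hw]⟩, hDxy⟩)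
  exact hG this.1

/-- If a word has two preimages of `x`, the neighbours of `x` are missed by the word. -/
theorem not_adj_of_word {S : Set (V → V)} {T t l : ℕ} (hT : TripleFree S T) {f : V → V}
    (hf : IsWord S l f) {u u' w : V} (hu : u ≠ u') (he : f u = f u') (hl : t + l < T) :
    ¬ (mergeGraph S t).Adj (f u) (f w) := by
  rintro ⟨hne, s, hs, g, hg, e⟩
  have h := hT (s + l) (by omega) (g ∘ f) (hf.append hg) u u' w (by simp [he])
    (by simp [← he, e])
  rcases h with h | h | h
  · exact hu h
  · exact hne (by rw [he, h])
  · exact hne (by rw [h])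

end Automaton

/-! ### Fractional stable sets, their maximum and the dimension of the optimal face -/

section FractionalStable

variable {V : Type*} [Fintype V]

/-- Fractional stable sets of a graph. -/
def fracStable (G : SimpleGraph V) : Set (V → ℝ) :=
  {y | (∀ x, 0 ≤ y x ∧ y x ≤ 1) ∧ ∀ x x', G.Adj x x' → y x + y x' ≤ 1}

open scoped Classical in
/-- The vertices adjacent to an element of `A`. -/
noncomputable def nbrs (G : SimpleGraph V) (A : Finset V) : Finset V :=
  Finset.univ.filter fun x => ∃ a ∈ A, G.Adj a x

/-- The deficiency of a graph: the maximum of `|A| - |N(A)|`. -/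
noncomputable def deficiency (G : SimpleGraph V) : ℕ :=
  (Finset.univ : Finset (Finset V)).sup fun A => A.card - (nbrs G A).card

/-- The fractional stable sets of maximum total weight. -/
def optFace (G : SimpleGraph V) : Set (V → ℝ) :=
  {y | y ∈ fracStable G ∧ 2 * ∑ x, y x = Fintype.card V + deficiency G}

theorem mem_nbrs {G : SimpleGraph V} {A : Finset V} {x : V} :
    x ∈ nbrs G A ↔ ∃ a ∈ A, G.Adj a x := by simp [nbrs]

theorem card_le_nbrs_add_deficiency (G : SimpleGraph V) (A : Finset V) :
    A.card ≤ (nbrs G A).card + deficiency G := by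
  have := Finset.le_sup (f := fun A : Finset V => A.card - (nbrs G A).card) (Finset.mem_univ A)
  unfold deficiency
  omega

theorem exists_card_eq_nbrs_add_deficiency (G : SimpleGraph V) :
    ∃ A : Finset V, A.card = (nbrs G A).card + deficiency G := by
  classical
  obtain ⟨A, -, hA⟩ := Finset.exists_mem_eq_sup (Finset.univ : Finset (Finset V))
    ⟨∅, Finset.mem_univ _⟩ fun A => A.card - (nbrs G A).card
  by_cases h : (nbrs G A).card ≤ A.card
  · exact ⟨A, by unfold deficiency; omega⟩
  · refine ⟨∅, ?_⟩
    have : nbrs G ∅ = ∅ := by ext; simp [mem_nbrs]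
    rw [this]
    unfold deficiency
    simp only [Finset.card_empty]
    omega

theorem deficiency_anti {G H : SimpleGraph V} (h : G ≤ H) : deficiency H ≤ deficiency G := by
  obtain ⟨A, hA⟩ := exists_card_eq_nbrs_add_deficiency H
  have h1 := card_le_nbrs_add_deficiency G A
  have h2 : (nbrs G A).card ≤ (nbrs H A).card := by
    refine Finset.card_le_card fun x hx => ?_
    obtain ⟨a, ha, hax⟩ := mem_nbrs.1 hx
    exact mem_nbrs.2 ⟨a, ha, h hax⟩
  omega

theorem deficiency_le_card (G : SimpleGraph V) : deficiency G ≤ Fintype.card V := by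
  obtain ⟨A, hA⟩ := exists_card_eq_nbrs_add_deficiency G
  have := Finset.card_le_univ A
  omega

theorem deficiency_pos_of_isolated {G : SimpleGraph V} {q : V} (h : ∀ x, ¬ G.Adj q x) :
    1 ≤ deficiency G := by
  have h1 := card_le_nbrs_add_deficiency G {q}
  have : nbrs G {q} = ∅ := by ext x; simp [mem_nbrs, h x]
  simp [this] at h1
  exact h1

theorem optFace_nonempty (G : SimpleGraph V) : (optFace G).Nonempty := by
  classical
  obtain ⟨A, hA⟩ := exists_card_eq_nbrs_add_deficiency G
  -- The average of the indicators of `A` and of the complement of `nbrs G A`, where `A` attains the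
  -- deficiency.
  refine ⟨fun x => ((if x ∈ A then 1 else 0) + (if x ∈ nbrs G A then 0 else 1)) / 2,
    ⟨fun x => ?_, fun x x' hx => ?_⟩, ?_⟩
  · dsimp only
    split_ifs <;> norm_num
  · have h1 : x ∈ A → x' ∈ nbrs G A := fun h => mem_nbrs.2 ⟨x, h, hx⟩
    have h2 : x' ∈ A → x ∈ nbrs G A := fun h => mem_nbrs.2 ⟨x', h, hx.symm⟩
    dsimp only
    split_ifs <;> first | tauto | norm_num
  · have e1 : ∑ x, (if x ∈ A then (1 : ℝ) else 0) = A.card := by simp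
    have e2 : ∑ x, (if x ∈ nbrs G A then (0 : ℝ) else 1)
        = Fintype.card V - (nbrs G A).card := by
      have : ∀ x, (if x ∈ nbrs G A then (0 : ℝ) else 1)
          = 1 - (if x ∈ nbrs G A then (1 : ℝ) else 0) := by
        intro x; split_ifs <;> norm_num
      simp only [this, Finset.sum_sub_distrib]
      simp
    have hA' : (A.card : ℝ) = (nbrs G A).card + deficiency G := by exact_mod_cast hA
    rw [← Finset.sum_div, Finset.sum_add_distrib, e1, e2, hA']
    ring

/-- Hall's theorem for the bipartite double cover of `G`, with `deficiency G` dummy partners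
available to every vertex. As this is a matching of the double cover, `σ` need not be an involution.
-/
theorem exists_partial_matching (G : SimpleGraph V) :
    ∃ (D : Finset V) (σ : V → V), Set.InjOn σ D ∧ (∀ i ∈ D, G.Adj i (σ i)) ∧
      Fintype.card V ≤ D.card + deficiency G := by
  classical
  let f : V → Finset (V ⊕ Fin (deficiency G)) := fun x =>
    (nbrs G {x}).map ⟨Sum.inl, Sum.inl_injective⟩ ∪
      Finset.univ.map ⟨Sum.inr, Sum.inr_injective⟩
  have hall := (Finset.all_card_le_biUnion_card_iff_exists_injective f).1 fun A => by
    have hsub : (nbrs G A).disjSum (Finset.univ : Finset (Fin (deficiency G))) ⊆ A.biUnion f ∨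
        A = ∅ := by
      rcases A.eq_empty_or_nonempty with h | ⟨a0, ha0⟩
      · exact Or.inr h
      left
      intro z hz
      rcases Finset.mem_disjSum.1 hz with ⟨x, hx, rfl⟩ | ⟨i, hi, rfl⟩
      · obtain ⟨a, ha, hax⟩ := mem_nbrs.1 hx
        exact Finset.mem_biUnion.2 ⟨a, ha, by simp [f, mem_nbrs, hax]⟩
      · exact Finset.mem_biUnion.2 ⟨a0, ha0, by simp [f]⟩
    rcases hsub with h | rfl
    · have := Finset.card_le_card h
      rw [Finset.card_disjSum, Finset.card_univ, Fintype.card_fin] at this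
      exact (card_le_nbrs_add_deficiency G A).trans this
    · simp
  obtain ⟨g, hg, hgf⟩ := hall
  refine ⟨Finset.univ.filter fun x => (g x).isLeft, fun x => (g x).elim id fun _ => x, ?_, ?_, ?_⟩
  · intro x hx y hy h
    simp only [Finset.coe_filter, Finset.mem_univ, true_and, Set.mem_ofPred_eq] at hx hy
    obtain ⟨a, ha⟩ := Sum.isLeft_iff.1 hx
    obtain ⟨b, hb⟩ := Sum.isLeft_iff.1 hy
    simp only [ha, hb, Sum.elim_inl, id] at h
    exact hg (by rw [ha, hb, h])
  · intro x hx
    obtain ⟨a, ha⟩ := Sum.isLeft_iff.1 (Finset.mem_filter.1 hx).2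
    have := hgf x
    simp only [ha, Sum.elim_inl, id]
    rw [ha] at this
    simpa [f, mem_nbrs] using this
  · have h1 : (Finset.univ.filter fun x => ¬ (g x).isLeft).card ≤ deficiency G := by
      have : (Finset.univ.filter fun x => ¬ (g x).isLeft).image g ⊆
          (Finset.univ : Finset (Fin (deficiency G))).map ⟨Sum.inr, Sum.inr_injective⟩ := by
        intro z hz
        obtain ⟨x, hx, rfl⟩ := Finset.mem_image.1 hz
        have := (Finset.mem_filter.1 hx).2
        cases h : g x with
        | inl a => simp [h] at this
        | inr i => simp
      have := Finset.card_le_card this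
      rw [Finset.card_image_of_injective _ hg] at this
      simpa using this
    have h2 := Finset.card_filter_add_card_filter_not
      (s := (Finset.univ : Finset V)) (p := fun x => (g x).isLeft = true)
    rw [Finset.card_univ] at h2
    omega

/-- Every weight is counted once as a source and once as a target of `σ`. For a fractional stable
set and a partial matching the three sums are slacks, hence nonnegative: this is the dual
certificate for the maximum. -/
theorem two_mul_sum_eq {D : Finset V} {σ : V → V} [DecidableEq V] (hσ : Set.InjOn σ D)
    (y : V → ℝ) :
    2 * ∑ x, y x = (2 * Fintype.card V - D.card) - (∑ i ∈ D, (1 - (y i + y (σ i)))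
      + ∑ i ∈ Dᶜ, (1 - y i) + ∑ j ∈ (D.image σ)ᶜ, (1 - y j)) := by
  have h1 : ∑ x, y x = ∑ i ∈ D, y i + ∑ i ∈ Dᶜ, y i := (Finset.sum_add_sum_compl D y).symm
  have h2 : ∑ x, y x = ∑ i ∈ D, y (σ i) + ∑ i ∈ (D.image σ)ᶜ, y i := by
    rw [← Finset.sum_image hσ]; exact (Finset.sum_add_sum_compl _ y).symm
  have hc := Finset.card_image_of_injOn hσ
  simp only [Finset.sum_sub_distrib, Finset.sum_add_distrib, Finset.sum_const, nsmul_eq_mul,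
    mul_one, Finset.card_compl, hc]
  rw [Nat.cast_sub (Finset.card_le_univ D)]
  linarith

/-- Complementary slackness: the dual value `2 * card V - D.card` is attained on the optimal face,
so each slack in `two_mul_sum_eq` vanishes there. -/
theorem exists_tight_matching [DecidableEq V] (G : SimpleGraph V) :
    ∃ (D : Finset V) (σ : V → V), Set.InjOn σ D ∧ (∀ i ∈ D, G.Adj i (σ i)) ∧
      D.card + deficiency G = Fintype.card V ∧ ∀ y ∈ optFace G,
        (∀ i ∈ D, y i + y (σ i) = 1) ∧ (∀ i ∉ D, y i = 1) ∧ ∀ j ∉ D.image σ, y j = 1 := by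
  obtain ⟨D, σ, hσ, hadj, hD⟩ := exists_partial_matching G
  have hD' : (Fintype.card V : ℝ) ≤ D.card + deficiency G := by exact_mod_cast hD
  have key : ∀ y ∈ optFace G, (∀ i ∈ D, y i + y (σ i) = 1) ∧ (∀ i ∉ D, y i = 1) ∧
      (∀ j ∉ D.image σ, y j = 1) ∧ (D.card + deficiency G : ℝ) = Fintype.card V := by
    rintro y ⟨hy, hs⟩
    have p1 : ∀ i ∈ D, 0 ≤ 1 - (y i + y (σ i)) := fun i hi => by
      linarith [hy.2 _ _ (hadj i hi)]
    have p2 : ∀ i, 0 ≤ 1 - y i := fun i => by linarith [(hy.1 i).2]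
    have h1 := Finset.sum_nonneg p1
    have h2 := Finset.sum_nonneg fun i (_ : i ∈ Dᶜ) => p2 i
    have h3 := Finset.sum_nonneg fun i (_ : i ∈ (D.image σ)ᶜ) => p2 i
    have e := two_mul_sum_eq hσ y
    have z1 := (Finset.sum_eq_zero_iff_of_nonneg p1).1 (by linarith)
    have z2 := (Finset.sum_eq_zero_iff_of_nonneg fun i (_ : i ∈ Dᶜ) => p2 i).1 (by linarith)
    have z3 := (Finset.sum_eq_zero_iff_of_nonneg
      fun i (_ : i ∈ (D.image σ)ᶜ) => p2 i).1 (by linarith)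
    refine ⟨fun i hi => by linarith [z1 i hi], fun i hi => ?_, fun j hj => ?_, by linarith⟩
    · linarith [z2 i (Finset.mem_compl.2 hi)]
    · linarith [z3 j (Finset.mem_compl.2 hj)]
  obtain ⟨y0, hy0⟩ := optFace_nonempty G
  refine ⟨D, σ, hσ, hadj, by exact_mod_cast (key y0 hy0).2.2.2, fun y hy => ?_⟩
  obtain ⟨a, b, c, -⟩ := key y hy
  exact ⟨a, b, c⟩

/-- A subspace of `V → ℝ` is determined by coordinates that can be separated on it. -/
theorem exists_separated_coordinates (W : Submodule ℝ (V → ℝ)) :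
    ∃ I : Finset V, Module.finrank ℝ W ≤ I.card ∧
      ∀ i ∈ I, ∃ w ∈ W, w i ≠ 0 ∧ ∀ j ∈ I, j ≠ i → w j = 0 := by
  classical
  let P : Finset V → Prop := fun I => ∀ w ∈ W, (∀ i ∈ I, w i = 0) → w = 0
  have hP : P Finset.univ := fun w _ h => funext fun i => h i (Finset.mem_univ i)
  -- A set of coordinates that determines the vectors of `W`, of minimal size; minimality means that
  -- dropping `i` loses a vector, which separates `i` from the rest.
  obtain ⟨I, hI, hmin⟩ := Finset.exists_min_image (Finset.univ.filter P) Finset.card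
    ⟨_, Finset.mem_filter.2 ⟨Finset.mem_univ _, hP⟩⟩
  have hPI := (Finset.mem_filter.1 hI).2
  refine ⟨I, ?_, fun i hi => ?_⟩
  · let φ : W →ₗ[ℝ] (I → ℝ) := (LinearMap.funLeft ℝ ℝ (Subtype.val : I → V)).comp W.subtype
    have hφ : Function.Injective φ := by
      rw [← LinearMap.ker_eq_bot, LinearMap.ker_eq_bot']
      intro w hw
      exact Subtype.ext (hPI w w.2 fun i hi => congrFun hw ⟨i, hi⟩)
    have := LinearMap.finrank_le_finrank_of_injective hφ
    simpa using this
  · by_contra! hcon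
    have : P (I.erase i) := by
      intro w hw hz
      refine hPI w hw fun j hj => ?_
      by_cases hji : j = i
      · subst hji
        by_contra hne
        obtain ⟨k, hk, hkj, hk0⟩ := hcon w hw hne
        exact hk0 (hz k (Finset.mem_erase.2 ⟨hkj, hk⟩))
      · exact hz j (Finset.mem_erase.2 ⟨hji, hj⟩)
    have h1 := hmin _ (Finset.mem_filter.2 ⟨Finset.mem_univ _, this⟩)
    have := Finset.card_erase_lt_of_mem hi
    omega

/-- The dimension of the optimal face. -/
noncomputable def optDim (G : SimpleGraph V) : ℕ :=
  Module.finrank ℝ (vectorSpan ℝ (optFace G))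

/-- Directions of the face change sign along `σ` and vanish outside the domain and the range of `σ`.
Separating coordinates `I` and their images `σ I` are thus disjoint subsets of `D`, and `D` has
`card V - deficiency G` elements. The parity exclusion comes from `D` having a single further
element `x`, which no tight matching can accommodate. -/
theorem optDim_bound (G : SimpleGraph V) :
    2 * optDim G + deficiency G ≤ Fintype.card V ∧
      2 * optDim G + deficiency G + 1 ≠ Fintype.card V := by
  classical
  obtain ⟨D, σ, hσ, hadj, hD, htight⟩ := exists_tight_matching G
  obtain ⟨y0, hy0⟩ := optFace_nonempty G
  obtain ⟨I, hI, hsep⟩ := exists_separated_coordinates (vectorSpan ℝ (optFace G))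
  have hW : ∀ w ∈ vectorSpan ℝ (optFace G), (∀ i ∈ D, w i + w (σ i) = 0) ∧
      (∀ i ∉ D, w i = 0) ∧ ∀ j ∉ D.image σ, w j = 0 := by
    intro w hw
    refine Submodule.span_induction (p := fun w _ => (∀ i ∈ D, w i + w (σ i) = 0) ∧
      (∀ i ∉ D, w i = 0) ∧ ∀ j ∉ D.image σ, w j = 0) ?_ ?_ ?_ ?_ hw
    · rintro _ ⟨y, hy, y', hy', rfl⟩
      obtain ⟨a, b, c⟩ := htight y hy
      obtain ⟨a', b', c'⟩ := htight y' hy'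
      refine ⟨fun i hi => ?_, fun i hi => ?_, fun i hi => ?_⟩
      · have := a i hi; have := a' i hi; simp; linarith
      · simp [b i hi, b' i hi]
      · simp [c i hi, c' i hi]
    · simp
    · rintro u v - - ⟨a, b, c⟩ ⟨a', b', c'⟩
      refine ⟨fun i hi => ?_, fun i hi => ?_, fun i hi => ?_⟩
      · have := a i hi; have := a' i hi; simp; linarith
      · simp [b i hi, b' i hi]
      · simp [c i hi, c' i hi]
    · rintro r u - ⟨a, b, c⟩
      refine ⟨fun i hi => ?_, fun i hi => ?_, fun i hi => ?_⟩
      · have := a i hi; simp [← mul_add, this]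
      · simp [b i hi]
      · simp [c i hi]
  have mem_D : ∀ w ∈ vectorSpan ℝ (optFace G), ∀ i, w i ≠ 0 → i ∈ D := fun w hw i hi => by
    by_contra h; exact hi ((hW w hw).2.1 i h)
  have neg : ∀ w ∈ vectorSpan ℝ (optFace G), ∀ i, w i ≠ 0 → w (σ i) = - w i :=
    fun w hw i hi => by linarith [(hW w hw).1 i (mem_D w hw i hi)]
  have hID : ∀ i ∈ I, i ∈ D := fun i hi => by
    obtain ⟨w, hw, h, -⟩ := hsep i hi; exact mem_D w hw i h
  have hσI : ∀ i ∈ I, σ i ∉ I := fun i hi h => by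
    obtain ⟨w, hw, h0, h1⟩ := hsep i hi
    have := h1 _ h (hadj i (hID i hi)).ne'
    rw [neg w hw i h0] at this
    exact h0 (neg_eq_zero.1 this)
  have hσD : ∀ i ∈ I, σ i ∈ D := fun i hi => by
    obtain ⟨w, hw, h0, -⟩ := hsep i hi
    exact mem_D w hw _ (by rw [neg w hw i h0]; exact neg_ne_zero.2 h0)
  have hdisj : Disjoint I (I.image σ) := Finset.disjoint_right.2 fun j hj => by
    obtain ⟨i, hi, rfl⟩ := Finset.mem_image.1 hj
    exact hσI i hi
  have hsub : I ∪ I.image σ ⊆ D := by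
    intro j hj
    rcases Finset.mem_union.1 hj with h | h
    · exact hID j h
    · obtain ⟨i, hi, rfl⟩ := Finset.mem_image.1 h
      exact hσD i hi
  have hcard : (I ∪ I.image σ).card = 2 * I.card := by
    rw [Finset.card_union_of_disjoint hdisj,
      Finset.card_image_of_injOn (hσ.mono fun i hi => hID i hi)]
    ring
  have hle := Finset.card_le_card hsub
  rw [hcard] at hle
  have hI' : optDim G ≤ I.card := hI
  refine ⟨by omega, fun hodd => ?_⟩
  have hIc : optDim G = I.card := by omega
  obtain ⟨x, hx⟩ : ∃ x, D \ (I ∪ I.image σ) = {x} := by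
    rw [← Finset.card_eq_one, Finset.card_sdiff_of_subset hsub, hcard]; omega
  have hxD : x ∈ D ∧ x ∉ I ∪ I.image σ := by
    rw [← Finset.mem_sdiff, hx]; simp
  have hxI : x ∉ I := fun h => hxD.2 (Finset.mem_union_left _ h)
  have hxσ : ∀ i ∈ I, σ i ≠ x := fun i hi h =>
    hxD.2 (Finset.mem_union_right _ (Finset.mem_image.2 ⟨i, hi, h⟩))
  have cases_D : ∀ j ∈ D, j = x ∨ j ∈ I ∨ ∃ i ∈ I, σ i = j := fun j hj => by
    by_cases h : j ∈ I ∪ I.image σ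
    · rcases Finset.mem_union.1 h with h | h
      · exact Or.inr (Or.inl h)
      · exact Or.inr (Or.inr (Finset.mem_image.1 h))
    · have : j ∈ D \ (I ∪ I.image σ) := Finset.mem_sdiff.2 ⟨hj, h⟩
      rw [hx] at this
      exact Or.inl (Finset.mem_singleton.1 this)
  -- the value of `σ (σ i)`
  have sq : ∀ i ∈ I, σ (σ i) = i ∨ σ (σ i) = x := fun i hi => by
    obtain ⟨w, hw, h0, h1⟩ := hsep i hi
    have e1 := neg w hw i h0
    have n1 : w (σ i) ≠ 0 := by rw [e1]; exact neg_ne_zero.2 h0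
    have e2 := neg w hw _ n1
    rw [e1, neg_neg] at e2
    have n2 : w (σ (σ i)) ≠ 0 := by rw [e2]; exact h0
    rcases cases_D _ (mem_D w hw _ n2) with h | h | ⟨j, hj, h⟩
    · exact Or.inr h
    · by_contra! hc
      exact n2 (h1 _ h hc.1)
    · exfalso
      have := hσ (hID j hj) (hσD i hi) h
      exact hσI i hi (this ▸ hj)
  by_cases hx0 : ∀ w ∈ vectorSpan ℝ (optFace G), w x = 0
  -- Here `σ` swaps `I` with its image, so `σ x` is outside `D` and `x` is outside the range. Both
  -- then have weight one, although the matched pair has total weight one.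
  · have sq' : ∀ i ∈ I, σ (σ i) = i := fun i hi => (sq i hi).resolve_right fun h => by
      obtain ⟨w, hw, h0, -⟩ := hsep i hi
      have e1 := neg w hw i h0
      have n1 : w (σ i) ≠ 0 := by rw [e1]; exact neg_ne_zero.2 h0
      have e2 := neg w hw _ n1
      rw [h, hx0 w hw, e1, neg_neg] at e2
      exact h0 e2.symm
    have h1 : σ x ∉ D := fun h => by
      rcases cases_D _ h with h | h | ⟨i, hi, h⟩
      · exact (hadj x hxD.1).ne' h
      · have := hσ (hσD _ h) hxD.1 (sq' _ h)
        exact hxσ _ h this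
      · exact hxI (hσ (hID i hi) hxD.1 h ▸ hi)
    have h2 : x ∉ D.image σ := fun h => by
      obtain ⟨j, hj, hjx⟩ := Finset.mem_image.1 h
      rcases cases_D j hj with rfl | h | ⟨i, hi, rfl⟩
      · exact (hadj _ hxD.1).ne' hjx
      · exact hxσ j h hjx
      · exact hxI (by rw [← hjx, sq' i hi]; exact hi)
    obtain ⟨a, b, c⟩ := htight y0 hy0
    have := a x hxD.1
    rw [b _ h1, c _ h2] at this
    norm_num at this
  -- Here `x = σ (σ i)` for some `i ∈ I`, and `σ x ∈ I`. Following the signs of the vector that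
  -- separates `i` from `i` through `x` to `σ x` makes its coordinate at `i` vanish.
  · push Not at hx0
    obtain ⟨w, hw, hwx⟩ := hx0
    have e1 := neg w hw x hwx
    have h1 : σ x ∈ I := by
      rcases cases_D _ (mem_D w hw (σ x) (by rw [e1]; exact neg_ne_zero.2 hwx)) with
        h | h | ⟨i, hi, h⟩
      · exact absurd h (hadj x hxD.1).ne'
      · exact h
      · exact absurd (hσ (hID i hi) hxD.1 h ▸ hi) hxI
    have h2 : x ∈ D.image σ := by
      by_contra h; exact hwx ((hW w hw).2.2 x h)
    obtain ⟨j, hj, hjx⟩ := Finset.mem_image.1 h2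
    rcases cases_D j hj with rfl | h | ⟨i, hi, rfl⟩
    · exact (hadj _ hxD.1).ne' hjx
    · exact hxσ j h hjx
    · obtain ⟨w', hw', h0, h3⟩ := hsep i hi
      have f1 := neg w' hw' i h0
      have f2 := (hW w' hw').1 _ hj
      have f3 := (hW w' hw').1 _ hxD.1
      rw [hjx] at f2
      by_cases hix : σ x = i
      · rw [hix] at f3
        apply h0; linarith
      · rw [h3 _ h1 hix] at f3
        apply h0; linarith

end FractionalStable

/-! ### Pushing weights along words and counting the steps at each value of the deficiency -/

section Stages

variable {V : Type*} [Fintype V] [DecidableEq V]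

/-- The number of states missed by a map. -/
def defect (f : V → V) : ℕ := Fintype.card V - (Finset.univ.image f).card

theorem card_image_add_defect (f : V → V) :
    (Finset.univ.image f).card + defect f = Fintype.card V := by
  have := Finset.card_le_univ (Finset.univ.image f)
  unfold defect
  omega

/-- The push-forward of weights along a map. -/
def push (f : V → V) : (V → ℝ) →ₗ[ℝ] (V → ℝ) where
  toFun y j := ∑ i ∈ Finset.univ.filter (fun i => f i = j), y i
  map_add' y y' := by ext j; simp [Finset.sum_add_distrib]
  map_smul' r y := by ext j; simp [Finset.mul_sum]

theorem push_apply (f : V → V) (y : V → ℝ) (j : V) :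
    push f y j = ∑ i ∈ Finset.univ.filter (fun i => f i = j), y i := rfl

theorem push_comp (f g : V → V) (y : V → ℝ) : push (g ∘ f) y = push g (push f y) := by
  ext j
  simp only [push_apply, Finset.sum_filter, Function.comp]
  have : ∀ x, (if g x = j then ∑ i, (if f i = x then y i else 0) else 0)
      = ∑ i, if f i = x then (if g x = j then y i else 0) else 0 := by
    intro x; split_ifs <;> simp
  simp only [this]
  rw [Finset.sum_comm]
  simp

theorem push_id (y : V → ℝ) : push id y = y := by
  ext j; simp [push_apply, Finset.sum_filter]

theorem sum_push (f : V → V) (y : V → ℝ) : ∑ j, push f y j = ∑ i, y i := by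
  simp only [push_apply]
  exact Finset.sum_fiberwise _ _ _

theorem fiber_cases {f : V → V}
    (hf : ∀ x y z, f x = f y → f y = f z → x = y ∨ y = z ∨ x = z) (j : V) :
    Finset.univ.filter (fun i => f i = j) = ∅ ∨
      (∃ u, f u = j ∧ Finset.univ.filter (fun i => f i = j) = {u}) ∨
      ∃ u u', u ≠ u' ∧ f u = j ∧ f u' = j ∧
        Finset.univ.filter (fun i => f i = j) = {u, u'} := by
  by_cases h0 : ∃ u, f u = j
  · obtain ⟨u, hu⟩ := h0
    right
    by_cases h1 : ∃ u', u ≠ u' ∧ f u' = j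
    · obtain ⟨u', hne, hu'⟩ := h1
      refine Or.inr ⟨u, u', hne, hu, hu', ?_⟩
      ext z
      simp only [Finset.mem_filter, Finset.mem_univ, true_and, Finset.mem_insert,
        Finset.mem_singleton]
      constructor
      · intro hz
        rcases hf u u' z (by rw [hu, hu']) (by rw [hu', hz]) with h | h | h
        · exact absurd h hne
        · exact Or.inr h.symm
        · exact Or.inl h.symm
      · rintro (rfl | rfl) <;> assumption
    · push Not at h1
      refine Or.inl ⟨u, hu, ?_⟩
      ext z
      simp only [Finset.mem_filter, Finset.mem_univ, true_and, Finset.mem_singleton]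
      constructor
      · intro hz
        by_contra h
        exact h1 z (Ne.symm h) hz
      · rintro rfl; exact hu
  · left
    ext z
    simpa using fun h => h0 ⟨z, h⟩

/-- A nonempty fibre of a triple-free word is a vertex or an edge of the merge graph. -/
theorem push_le_one {S : Set (V → V)} {T l : ℕ} (hT : TripleFree S T) {f : V → V}
    (hf : IsWord S l f) (hl : l < T) {y : V → ℝ} (hy : y ∈ fracStable (mergeGraph S l)) (j : V) :
    0 ≤ push f y j ∧ push f y j ≤ 1 := by
  refine ⟨Finset.sum_nonneg fun i _ => (hy.1 i).1, ?_⟩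
  rw [push_apply]
  rcases fiber_cases (hT l hl f hf) j with h | ⟨u, -, h⟩ | ⟨u, u', hne, hu, hu', h⟩
  · rw [h]; simp
  · rw [h]; simpa using (hy.1 u).2
  · rw [h, Finset.sum_pair hne]
    exact hy.2 u u' ⟨hne, l, le_rfl, f, hf, hu.trans hu'.symm⟩

/-- Of two states adjacent at time `t`, none can be doubled by `L` while the other lies in the
image. So an edge constraint either lifts to an edge at time `t + 1` or involves one empty fibre. -/
theorem push_mem_fracStable {S : Set (V → V)} {T t : ℕ} (hT : TripleFree S T) {L : V → V}
    (hL : L ∈ S) (ht : t + 1 < T) {y : V → ℝ} (hy : y ∈ fracStable (mergeGraph S (t + 1))) :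
    push L y ∈ fracStable (mergeGraph S t) := by
  have hw := IsWord.letter hL
  have hy1 : y ∈ fracStable (mergeGraph S 1) :=
    ⟨hy.1, fun x x' h => hy.2 x x' (mergeGraph_mono (by omega) h)⟩
  have hle := push_le_one hT hw (by omega) hy1
  refine ⟨hle, fun j j' hj => ?_⟩
  have hf := hT 1 (by omega) L hw
  have sub : ∀ {u v w : V}, u ≠ v → L u = L v → ¬ (mergeGraph S t).Adj (L u) (L w) :=
    fun h1 h2 => not_adj_of_word hT hw h1 h2 ht
  have zero : ∀ j : V, Finset.univ.filter (fun i => L i = j) = ∅ → push L y j = 0 := fun j h => by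
    rw [push_apply, h]; simp
  rcases fiber_cases hf j with h | ⟨u, hu, h⟩ | ⟨u, u', hne, hu, hu', h⟩
  · rw [zero j h]; linarith [(hle j').2]
  · rcases fiber_cases hf j' with h' | ⟨v, hv, h'⟩ | ⟨v, v', hne, hv, hv', h'⟩
    · rw [zero j' h']; linarith [(hle j).2]
    · rw [push_apply, push_apply, h, h']
      simp only [Finset.sum_singleton]
      exact hy.2 u v (mergeGraph_adj_of_letter hL (by rwa [hu, hv]))
    · exact absurd (by rw [hv, hu]; exact hj.symm) (sub (w := u) hne (hv.trans hv'.symm))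
  · rcases fiber_cases hf j' with h' | ⟨v, hv, h'⟩ | ⟨v, v', hne', hv, hv', h'⟩
    · rw [zero j' h']; linarith [(hle j).2]
    · exact absurd (by rw [hv, hu]; exact hj) (sub (w := v) hne (hu.trans hu'.symm))
    · exact absurd (by rw [hv, hu]; exact hj) (sub (w := v) hne (hu.trans hu'.symm))

theorem eq_zero_of_mem_vectorSpan {P : Set (V → ℝ)} (φ : (V → ℝ) →ₗ[ℝ] ℝ) {c : ℝ}
    (h : ∀ y ∈ P, φ y = c) {w : V → ℝ} (hw : w ∈ vectorSpan ℝ P) : φ w = 0 := by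
  have : vectorSpan ℝ P ≤ LinearMap.ker φ := by
    refine Submodule.span_le.2 ?_
    rintro _ ⟨y, hy, y', hy', rfl⟩
    simp [h y hy, h y' hy']
  exact this hw

theorem optFace_subset {G H : SimpleGraph V} (h : G ≤ H) (hd : deficiency G = deficiency H) :
    optFace H ⊆ optFace G :=
  fun _ hy => ⟨⟨hy.1.1, fun x x' hx => hy.1.2 x x' (h hx)⟩, by rw [hd]; exact hy.2⟩

/-- For equal deficiencies the later face lies in the earlier one, and letters push the later face
into the earlier. If the dimensions agreed, the common affine hull would be invariant under all
words. A synchronizing word would then put a vector supported at one state `x` into it; the tight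
equations force all other states to be matched to `x`, which injectivity of `σ` forbids for three or
more states. -/
theorem optDim_lt {S : Set (V → V)} {T t : ℕ} (hn : 3 ≤ Fintype.card V) (hT : TripleFree S T)
    (hsync : Synchronizing S) (ht : t + 1 < T)
    (hd : deficiency (mergeGraph S t) = deficiency (mergeGraph S (t + 1))) :
    optDim (mergeGraph S (t + 1)) < optDim (mergeGraph S t) := by
  have hsub := optFace_subset (mergeGraph_mono (S := S) (Nat.le_succ t)) hd
  have hspan := vectorSpan_mono ℝ hsub
  by_contra hlt
  have heq : vectorSpan ℝ (optFace (mergeGraph S (t + 1))) =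
      vectorSpan ℝ (optFace (mergeGraph S t)) :=
    Submodule.eq_of_le_of_finrank_le hspan (not_lt.1 hlt)
  have hpush : ∀ L ∈ S, ∀ y ∈ optFace (mergeGraph S (t + 1)),
      push L y ∈ optFace (mergeGraph S t) := fun L hL y hy =>
    ⟨push_mem_fracStable hT hL ht hy.1, by rw [sum_push, hd]; exact hy.2⟩
  set W := vectorSpan ℝ (optFace (mergeGraph S t)) with hWdef
  have hW : ∀ L ∈ S, ∀ w ∈ W, push L w ∈ W := by
    intro L hL w hw
    rw [← heq] at hw
    have : vectorSpan ℝ (optFace (mergeGraph S (t + 1))) ≤ W.comap (push L) := by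
      refine Submodule.span_le.2 ?_
      rintro _ ⟨y, hy, y', hy', rfl⟩
      simp only [Submodule.comap_coe, Set.mem_preimage, vsub_eq_sub, map_sub]
      exact vsub_mem_vectorSpan ℝ (hpush L hL y hy) (hpush L hL y' hy')
    exact this hw
  obtain ⟨y0, hy0⟩ := optFace_nonempty (mergeGraph S (t + 1))
  have hword : ∀ s f, IsWord S s f → ∀ y, y - y0 ∈ W → push f y - y0 ∈ W := by
    intro s f hf
    induction hf with
    | nil => intro y hy; rwa [push_id]
    | @cons s L g hL _ ih =>
      intro y hy
      rw [push_comp]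
      apply ih
      have h1 := hW L hL _ hy
      have h2 := vsub_mem_vectorSpan ℝ (hpush L hL y0 hy0) (hsub hy0)
      have := W.add_mem h1 h2
      simpa using this
  obtain ⟨x, s, f, hf, hx⟩ := hsync
  have hz := hword s f hf y0 (by simp)
  have hz0 : ∀ i, i ≠ x → push f y0 i = 0 := by
    intro i hi
    rw [push_apply]
    refine Finset.sum_eq_zero fun k hk => ?_
    rw [Finset.mem_filter, hx] at hk
    exact absurd hk.2.symm hi
  obtain ⟨D, σ, hσ, hadj, -, htight⟩ := exists_tight_matching (mergeGraph S t)
  have key : ∀ i, i ≠ x → i ∈ D ∧ σ i = x := by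
    intro i hi
    have hiD : i ∈ D := by
      by_contra h
      have h1 := eq_zero_of_mem_vectorSpan (LinearMap.proj i : (V → ℝ) →ₗ[ℝ] ℝ) (c := 1)
        (fun y hy => (htight y hy).2.1 i h) hz
      have h2 := (htight y0 (hsub hy0)).2.1 i h
      simp [hz0 i hi, h2] at h1
    refine ⟨hiD, ?_⟩
    by_contra h
    have h1 := eq_zero_of_mem_vectorSpan ((LinearMap.proj i : (V → ℝ) →ₗ[ℝ] ℝ) +
      (LinearMap.proj (σ i) : (V → ℝ) →ₗ[ℝ] ℝ)) (c := 1)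
      (fun y hy => (htight y hy).1 i hiD) hz
    have h2 := (htight y0 (hsub hy0)).1 i hiD
    have h3 : (push f y0 i - y0 i) + (push f y0 (σ i) - y0 (σ i)) = 0 := h1
    rw [hz0 i hi, hz0 _ h] at h3
    linarith
  have hcard : 1 < ((Finset.univ : Finset V).erase x).card := by
    rw [Finset.card_erase_of_mem (Finset.mem_univ x), Finset.card_univ]; omega
  obtain ⟨i, hi, k, hk, hik⟩ := Finset.one_lt_card.1 hcard
  have h1 := key i (Finset.ne_of_mem_erase hi)
  have h2 := key k (Finset.ne_of_mem_erase hk)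
  exact hik (hσ h1.1 h2.1 (h1.2.trans h2.2.symm))

/-- The sum of the maximal numbers of steps spent at the matching numbers from `a` to `b`. -/
def stageSum (a b : ℕ) : ℕ :=
  ∑ s ∈ Finset.Icc a b, if s % 2 = 0 then s / 2 + 1 else (s - 1) / 2

/-- The number `s = card V - deficiency` never decreases, and while it is constant the dimension
drops in each step. By `optDim_bound` a stage lasts at most `s / 2 + 1` steps for even `s` and `(s -
1) / 2` for odd `s`. The term `optDim` on the left is the credit remaining in the current stage,
which makes the induction work. -/
theorem stage_count {S : Set (V → V)} {T j s₀ : ℕ} (hn : 3 ≤ Fintype.card V)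
    (hT : TripleFree S T) (hsync : Synchronizing S)
    (hs₀ : s₀ + deficiency (mergeGraph S j) ≤ Fintype.card V) (t : ℕ) (hjt : j ≤ t) :
    t < T → t + 1 + optDim (mergeGraph S t) ≤
      j + stageSum s₀ (Fintype.card V - deficiency (mergeGraph S t)) := by
  have step : ∀ a b, a ≤ b → ∀ c < b,
      stageSum a c + (if b % 2 = 0 then b / 2 + 1 else (b - 1) / 2) ≤ stageSum a b := by
    intro a b hab c hcb
    unfold stageSum
    have : Finset.Icc a c ⊆ (Finset.Icc a b).erase b := fun x hx => by
      rw [Finset.mem_Icc] at hx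
      rw [Finset.mem_erase, Finset.mem_Icc]
      omega
    have h := Finset.sum_le_sum_of_subset (f := fun s => if s % 2 = 0 then s / 2 + 1
      else (s - 1) / 2) this
    have h2 := Finset.sum_erase_add (Finset.Icc a b) (fun s => if s % 2 = 0 then s / 2 + 1
      else (s - 1) / 2) (Finset.mem_Icc.2 ⟨hab, le_rfl⟩)
    omega
  have dim : ∀ t, optDim (mergeGraph S t) + 1 ≤
      (if (Fintype.card V - deficiency (mergeGraph S t)) % 2 = 0
        then (Fintype.card V - deficiency (mergeGraph S t)) / 2 + 1
        else (Fintype.card V - deficiency (mergeGraph S t) - 1) / 2) := by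
    intro t
    have := optDim_bound (mergeGraph S t)
    split_ifs <;> omega
  induction t, hjt using Nat.le_induction with
  | base =>
    intro _
    have h1 := dim j
    have h2 : (if (Fintype.card V - deficiency (mergeGraph S j)) % 2 = 0
        then (Fintype.card V - deficiency (mergeGraph S j)) / 2 + 1
        else (Fintype.card V - deficiency (mergeGraph S j) - 1) / 2) ≤
        stageSum s₀ (Fintype.card V - deficiency (mergeGraph S j)) := by
      unfold stageSum
      exact Finset.single_le_sum (f := fun s => if s % 2 = 0 then s / 2 + 1 else (s - 1) / 2)
        (fun _ _ => Nat.zero_le _) (Finset.mem_Icc.2 ⟨by omega, le_rfl⟩)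
    omega
  | succ t hjt ih =>
    intro ht
    have ih := ih (by omega)
    have hmono := deficiency_anti (mergeGraph_mono (S := S) (show t ≤ t + 1 by omega))
    rcases hmono.lt_or_eq with h | h
    · have h0 := deficiency_anti (mergeGraph_mono (S := S) hjt)
      have h1 := dim (t + 1)
      have h2 := deficiency_le_card (mergeGraph S t)
      have h3 := step s₀ (Fintype.card V - deficiency (mergeGraph S (t + 1))) (by omega)
        (Fintype.card V - deficiency (mergeGraph S t)) (by omega)
      omega
    · have h1 := optDim_lt hn hT hsync ht h.symm
      rw [h]
      omega

/-- An optimal weighting, pushed along `f`, has weight at most one on each state of the image and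
zero elsewhere, while its total is preserved. -/
theorem two_mul_defect_add_deficiency {S : Set (V → V)} {T j : ℕ} (hT : TripleFree S T)
    {f : V → V} (hf : IsWord S j f) (hj : j < T) :
    2 * defect f + deficiency (mergeGraph S j) ≤ Fintype.card V := by
  obtain ⟨y, hy, hs⟩ := optFace_nonempty (mergeGraph S j)
  have h1 : ∑ i, y i ≤ (Finset.univ.image f).card := by
    rw [← sum_push f, ← Finset.sum_subset (Finset.subset_univ (Finset.univ.image f))]
    · have := Finset.sum_le_card_nsmul (Finset.univ.image f) (push f y) 1
        fun i _ => (push_le_one hT hf hj hy i).2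
      simpa using this
    · intro x _ hx
      rw [push_apply]
      refine Finset.sum_eq_zero fun i hi => ?_
      rw [Finset.mem_filter] at hi
      exact absurd (Finset.mem_image.2 ⟨i, Finset.mem_univ i, hi.2⟩) hx
  have h2 := card_image_add_defect f
  have h3 : (Fintype.card V : ℝ) + deficiency (mergeGraph S j)
      ≤ 2 * (Finset.univ.image f).card := by linarith
  have h4 : Fintype.card V + deficiency (mergeGraph S j) ≤ 2 * (Finset.univ.image f).card := by
    exact_mod_cast h3
  omega

theorem stageSum_mono {a b c : ℕ} (h : b ≤ c) : stageSum a b ≤ stageSum a c :=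
  Finset.sum_le_sum_of_subset (Finset.Icc_subset_Icc le_rfl h)

theorem le_stageSum_of_word {S : Set (V → V)} {T j : ℕ} (hn : 3 ≤ Fintype.card V)
    (hT : TripleFree S T) (hsync : Synchronizing S) {f : V → V} (hf : IsWord S j f) :
    T ≤ j + stageSum (2 * defect f) (Fintype.card V) := by
  by_cases hj : j < T
  · have h := stage_count hn hT hsync (two_mul_defect_add_deficiency hT hf hj) (T - 1)
      (by omega) (by omega)
    have := stageSum_mono (a := 2 * defect f) (Nat.sub_le (Fintype.card V)
      (deficiency (mergeGraph S (T - 1))))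
    omega
  · omega

/-- An isolated state makes the deficiency positive, so the last stage, for the value `card V`, has
not been entered. -/
theorem le_stageSum_of_isolated {S : Set (V → V)} {T j t : ℕ} (hn : 3 ≤ Fintype.card V)
    (hT : TripleFree S T) (hsync : Synchronizing S) {f : V → V} (hf : IsWord S j f) (ht : t < T)
    {q : V} (hq : ∀ x, ¬ (mergeGraph S t).Adj q x) :
    t + 1 ≤ j + stageSum (2 * defect f) (Fintype.card V - 1) := by
  by_cases hj : j ≤ t
  · have h := stage_count hn hT hsync (two_mul_defect_add_deficiency hT hf (by omega)) t
      (by omega) ht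
    have h1 := deficiency_pos_of_isolated hq
    have := stageSum_mono (a := 2 * defect f) (Nat.sub_le_sub_left h1 (Fintype.card V))
    omega
  · omega

end Stages

/-! ### Edge and degree counts -/

section Counting

variable {V : Type*} [Fintype V] [DecidableEq V]

/-- The number of edges of a graph. -/
noncomputable def numEdges (G : SimpleGraph V) : ℕ := G.edgeSet.ncard

/-- The degree of a vertex. -/
noncomputable def deg (G : SimpleGraph V) (x : V) : ℕ := (G.neighborSet x).ncard

theorem numEdges_lt {G H : SimpleGraph V} (h : G < H) : numEdges G < numEdges H :=
  Set.ncard_lt_ncard (SimpleGraph.edgeSet_ssubset_edgeSet.2 h) (Set.toFinite _)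

theorem deg_mono {G H : SimpleGraph V} (h : G ≤ H) (x : V) : deg G x ≤ deg H x :=
  Set.ncard_le_ncard (fun _ hy => h hy) (Set.toFinite _)

theorem deg_eq_degree (G : SimpleGraph V) (x : V) [Fintype (G.neighborSet x)] :
    deg G x = G.degree x := by
  rw [deg, Set.ncard_eq_toFinset_card', Set.toFinset_card, SimpleGraph.card_neighborSet_eq_degree]

theorem sum_deg (G : SimpleGraph V) : ∑ x, deg G x = 2 * numEdges G := by
  classical
  have := G.sum_degrees_eq_twice_card_edges
  rw [numEdges, ← SimpleGraph.coe_edgeFinset, Set.ncard_coe_finset, ← this]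
  refine Finset.sum_congr rfl fun x _ => ?_
  rw [deg_eq_degree]

theorem deg_le_card {G : SimpleGraph V} {x : V} {A : Finset V} (h : ∀ y, G.Adj x y → y ∈ A) :
    deg G x ≤ A.card := by
  rw [← Set.ncard_coe_finset]
  exact Set.ncard_le_ncard (fun y hy => h y hy) (Set.toFinite _)

theorem numEdges_le (G : SimpleGraph V) (A : Finset V) :
    numEdges G ≤ ∑ x ∈ A, deg G x + (Fintype.card V - A.card).choose 2 := by
  classical
  have hsub : G.edgeFinset ⊆
      A.biUnion (fun x => G.incidenceFinset x) ∪ Aᶜ.offDiag.image (Sym2.mk : V → V → Sym2 V).uncurry := by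
    intro e he
    induction e with
    | h x y =>
      rw [SimpleGraph.mem_edgeFinset, SimpleGraph.mem_edgeSet] at he
      rw [Finset.mem_union]
      by_cases hx : x ∈ A
      · left
        exact Finset.mem_biUnion.2 ⟨x, hx, by simpa [SimpleGraph.mk'_mem_incidenceSet_iff]⟩
      by_cases hy : y ∈ A
      · left
        exact Finset.mem_biUnion.2 ⟨y, hy, by simpa [SimpleGraph.mk'_mem_incidenceSet_iff]⟩
      · right
        refine Finset.mem_image.2 ⟨(x, y), ?_, rfl⟩
        simp [hx, hy, he.ne]
  have h1 := Finset.card_le_card hsub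
  have h2 := Finset.card_union_le (A.biUnion (fun x => G.incidenceFinset x))
    (Aᶜ.offDiag.image (Sym2.mk : V → V → Sym2 V).uncurry)
  have h3 : (A.biUnion (fun x => G.incidenceFinset x)).card ≤ ∑ x ∈ A, deg G x := by
    refine Finset.card_biUnion_le.trans (Finset.sum_le_sum fun x _ => ?_)
    rw [SimpleGraph.card_incidenceFinset_eq_degree, deg_eq_degree]
  have h4 : (Aᶜ.offDiag.image (Sym2.mk : V → V → Sym2 V).uncurry).card =
      (Fintype.card V - A.card).choose 2 := by
    rw [← Finset.card_compl]
    exact Sym2.card_image_offDiag _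
  rw [numEdges, ← SimpleGraph.coe_edgeFinset, Set.ncard_coe_finset]
  omega

end Counting

/-! ### Degrees of doubled states, growth of the merge graphs, greedy enumeration of states -/

section Growth

variable {V : Type*} [Fintype V] [DecidableEq V]

theorem defect_comp_le (f g : V → V) : defect (g ∘ f) ≤ defect f + defect g := by
  have h1 := card_image_add_defect f
  have h2 := card_image_add_defect g
  have h3 := card_image_add_defect (g ∘ f)
  have h4 : (Finset.univ.image g) ⊆
      Finset.univ.image (g ∘ f) ∪ (Finset.univ.image f)ᶜ.image g := by
    intro y hy
    obtain ⟨x, -, rfl⟩ := Finset.mem_image.1 hy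
    by_cases hx : x ∈ Finset.univ.image f
    · obtain ⟨z, -, rfl⟩ := Finset.mem_image.1 hx
      exact Finset.mem_union_left _ (Finset.mem_image.2 ⟨z, Finset.mem_univ z, rfl⟩)
    · exact Finset.mem_union_right _ (Finset.mem_image.2 ⟨x, Finset.mem_compl.2 hx, rfl⟩)
  have h5 := (Finset.card_le_card h4).trans (Finset.card_union_le _ _)
  have h6 := Finset.card_image_le (s := (Finset.univ.image f)ᶜ) (f := g)
  rw [Finset.card_compl] at h6
  omega

theorem defect_id : defect (id : V → V) = 0 := by
  simp [defect, Finset.card_univ]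

theorem defect_word_le {S : Set (V → V)} {r : ℕ} (hr : ∀ L ∈ S, defect L ≤ r) {t : ℕ} {f : V → V}
    (hf : IsWord S t f) : defect f ≤ t * r := by
  induction hf with
  | nil => simp [defect_id]
  | @cons t L g hL _ ih =>
    have := defect_comp_le L g
    have := hr L hL
    rw [Nat.add_mul]
    omega

theorem defect_eq_zero_iff {f : V → V} : defect f = 0 ↔ Function.Bijective f := by
  have := card_image_add_defect f
  rw [← Finite.surjective_iff_bijective]
  constructor
  · intro h
    have : Finset.univ.image f = Finset.univ :=
      (Finset.card_eq_iff_eq_univ _).1 (by omega)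
    intro y
    obtain ⟨x, -, hx⟩ := Finset.mem_image.1 (this ▸ Finset.mem_univ y)
    exact ⟨x, hx⟩
  · intro h
    rw [Finset.image_univ_of_surjective h, Finset.card_univ] at this
    omega

theorem exists_dup {f : V → V} (h : ¬ Function.Bijective f) : ∃ u u', u ≠ u' ∧ f u = f u' := by
  rw [← Finite.injective_iff_bijective] at h
  unfold Function.Injective at h
  push Not at h
  obtain ⟨u, u', e, hne⟩ := h
  exact ⟨u, u', hne, e⟩

/-- The states with two preimages under `f`. -/
def dups (f : V → V) : Finset V :=
  Finset.univ.filter fun x => ∃ u u', u ≠ u' ∧ f u = x ∧ f u' = x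

theorem mem_dups {f : V → V} {x : V} : x ∈ dups f ↔ ∃ u u', u ≠ u' ∧ f u = x ∧ f u' = x := by
  simp [dups]

theorem not_adj_of_mem_dups {S : Set (V → V)} {T t l : ℕ} (hT : TripleFree S T) {f : V → V}
    (hf : IsWord S l f) {x : V} (hx : x ∈ dups f) (hl : t + l < T) (w : V) :
    ¬ (mergeGraph S t).Adj x (f w) := by
  obtain ⟨u, u', hne, rfl, hu'⟩ := mem_dups.1 hx
  exact not_adj_of_word hT hf hne hu'.symm hl

/-- All neighbours of a doubled state are among the states missed by `f`. -/
theorem deg_le_defect {S : Set (V → V)} {T t l : ℕ} (hT : TripleFree S T) {f : V → V}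
    (hf : IsWord S l f) {x : V} (hx : x ∈ dups f) (hl : t + l < T) :
    deg (mergeGraph S t) x ≤ defect f := by
  have h : deg (mergeGraph S t) x ≤ (Finset.univ.image f)ᶜ.card := by
    refine deg_le_card fun y hy => Finset.mem_compl.2 fun hyf => ?_
    obtain ⟨w, -, rfl⟩ := Finset.mem_image.1 hyf
    exact not_adj_of_mem_dups hT hf hx hl w hy
  rwa [Finset.card_compl] at h

theorem dups_comp {f g : V → V} {x : V} (hx : x ∈ dups f) : g x ∈ dups (g ∘ f) := by
  obtain ⟨u, u', hne, h1, h2⟩ := mem_dups.1 hx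
  exact mem_dups.2 ⟨u, u', hne, by simp [h1], by simp [h2]⟩

/-- In a triple-free word every state has at most two preimages. -/
theorem card_dups {f : V → V}
    (hf : ∀ x y z, f x = f y → f y = f z → x = y ∨ y = z ∨ x = z) :
    (dups f).card = defect f := by
  have h1 : Fintype.card V = ∑ j ∈ Finset.univ.image f,
      (Finset.univ.filter fun i => f i = j).card := by
    rw [← Finset.card_univ]
    exact Finset.card_eq_sum_card_image f _
  have h2 : ∀ j ∈ Finset.univ.image f, (Finset.univ.filter fun i => f i = j).card =
      1 + if j ∈ dups f then 1 else 0 := by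
    intro j hj
    obtain ⟨k, -, hk⟩ := Finset.mem_image.1 hj
    rcases fiber_cases hf j with h | ⟨u, hu, h⟩ | ⟨u, u', hne, hu, hu', h⟩
    · have : k ∈ Finset.univ.filter (fun i => f i = j) := by simp [hk]
      rw [h] at this
      simp at this
    · rw [h, if_neg]
      · simp
      · intro hd
        obtain ⟨v, v', hne, hv, hv'⟩ := mem_dups.1 hd
        have e1 : v ∈ Finset.univ.filter (fun i => f i = j) := by simp [hv]
        have e2 : v' ∈ Finset.univ.filter (fun i => f i = j) := by simp [hv']
        rw [h, Finset.mem_singleton] at e1 e2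
        exact hne (e1.trans e2.symm)
    · rw [h, if_pos (mem_dups.2 ⟨u, u', hne, hu, hu'⟩), Finset.card_pair hne]
  rw [Finset.sum_congr rfl h2, Finset.sum_add_distrib] at h1
  have h3 : dups f ⊆ Finset.univ.image f := fun j hj => by
    obtain ⟨u, -, -, hu, -⟩ := mem_dups.1 hj
    exact Finset.mem_image.2 ⟨u, Finset.mem_univ u, hu⟩
  have h4 : ∑ j ∈ Finset.univ.image f, (if j ∈ dups f then 1 else 0) = (dups f).card := by
    rw [Finset.sum_ite_mem, Finset.inter_eq_right.2 h3]
    simp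
  have := card_image_add_defect f
  simp only [Finset.sum_const, smul_eq_mul, mul_one] at h1
  omega

theorem exists_mem_image_ne {S : Set (V → V)} {T : ℕ} (hn : 3 ≤ Fintype.card V)
    (hT : TripleFree S T) {l : ℕ} (hl : l < T) {f : V → V} (hf : IsWord S l f) (q : V) :
    ∃ w, f w ≠ q := by
  by_contra! h
  obtain ⟨x, y, z, hxy, hxz, hyz⟩ := Fintype.two_lt_card_iff.1 hn
  rcases hT l hl f hf x y z (by rw [h, h]) (by rw [h, h]) with h | h | h
  · exact hxy h
  · exact hyz h
  · exact hxz h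

/-- The state `q` is not adjacent to the other states in the image of `a`, and pairs containing `q`
are live; so an unmerged live pair is available at every time before the last. -/
theorem live_numEdges_add_le {S : Set (V → V)} {T : ℕ} (hn : 3 ≤ Fintype.card V)
    (hT : TripleFree S T) (hsync : Synchronizing S) {a : V → V} (ha : a ∈ S) {q : V}
    (hq : q ∈ dups a) {D : SimpleGraph V} (hD : IsDead S D) (hqD : ∀ x, ¬ D.Adj q x)
    (t₀ t : ℕ) (ht : t₀ + t < T) :
    numEdges (mergeGraph S t₀ \ D) + t ≤ numEdges (mergeGraph S (t₀ + t) \ D) := by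
  induction t with
  | zero => simp
  | succ t ih =>
    have := ih (by omega)
    have hw := IsWord.letter ha
    obtain ⟨w, hw'⟩ := exists_mem_image_ne hn hT (by omega) hw q
    have h := numEdges_lt (live_lt_succ hsync hD (t := t₀ + t) hw'.symm (hqD _)
      (not_adj_of_mem_dups hT hw hq (by omega) w))
    rw [Nat.add_assoc] at h
    omega

theorem live_numEdges_ge {S : Set (V → V)} {T : ℕ} (hn : 3 ≤ Fintype.card V)
    (hT : TripleFree S T) (hsync : Synchronizing S) {a : V → V} (ha : a ∈ S) {q : V}
    (hq : q ∈ dups a) {D : SimpleGraph V} (hD : IsDead S D) (hqD : ∀ x, ¬ D.Adj q x)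
    {t : ℕ} (ht : t < T) : t ≤ numEdges (mergeGraph S t \ D) := by
  have := live_numEdges_add_le hn hT hsync ha hq hD hqD 0 t (by omega)
  rw [Nat.zero_add] at this
  omega

theorem defect_le_numEdges {S : Set (V → V)} {a : V → V} (ha : a ∈ S) :
    defect a ≤ numEdges (mergeGraph S 1) := by
  classical
  by_cases hV : Nonempty V
  swap
  · rw [not_nonempty_iff] at hV
    simp [defect]
  -- One representative for each fibre of `a`. Joining every other state to its representative gives
  -- `defect a` different edges.
  let h : V → V := fun x => Function.invFun a (a x)
  have hah : ∀ x, a (h x) = a x := fun x => Function.invFun_eq ⟨x, rfl⟩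
  have hh : ∀ x, h (h x) = h x := fun x => congrArg (Function.invFun a) (hah x)
  have h1 : (Finset.univ.filter fun x => h x ≠ x).card ≤ numEdges (mergeGraph S 1) := by
    rw [numEdges, ← Set.ncard_coe_finset]
    refine Set.ncard_le_ncard_of_injOn (fun x => s(x, h x)) ?_ ?_ (Set.toFinite _)
    · intro x hx
      have hx' : h x ≠ x := by simpa using hx
      exact mergeGraph_adj_of_eq (t := 0) ha hx'.symm (hah x).symm
    · intro x hx y hy e
      have hx' : h x ≠ x := by simpa using hx
      rcases Sym2.eq_iff.1 e with ⟨e1, -⟩ | ⟨e1, e2⟩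
      · exact e1
      · exact absurd (by rw [e1, hh]) hx'
  have h2 : Finset.univ.filter (fun x => h x = x) ⊆ (Finset.univ.image a).image
      (Function.invFun a) := fun x hx => by
    have hx' : h x = x := by simpa using hx
    exact Finset.mem_image.2 ⟨a x, Finset.mem_image.2 ⟨x, Finset.mem_univ x, rfl⟩, hx'⟩
  have h3 := (Finset.card_le_card h2).trans Finset.card_image_le
  have h4 := Finset.card_filter_add_card_filter_not
    (s := (Finset.univ : Finset V)) (p := fun x => h x = x)
  rw [Finset.card_univ] at h4
  have h5 := card_image_add_defect a
  simp only [ne_eq] at h1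
  omega

theorem numEdges_ge {S : Set (V → V)} {T : ℕ} (hn : 3 ≤ Fintype.card V)
    (hT : TripleFree S T) (hsync : Synchronizing S) {a : V → V} (ha : a ∈ S)
    (hdef : 0 < defect a) {t : ℕ} (ht1 : 1 ≤ t) (ht : t < T) :
    t + defect a ≤ numEdges (mergeGraph S t) + 1 := by
  obtain ⟨u, u', hne, e⟩ := exists_dup (f := a) fun h => by
    rw [← defect_eq_zero_iff] at h; omega
  have := live_numEdges_add_le hn hT hsync ha (q := a u)
    (mem_dups.2 ⟨u, u', hne, rfl, e.symm⟩) (isDead_bot S) (fun _ h => h) 1 (t - 1) (by omega)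
  rw [sdiff_bot, sdiff_bot, show 1 + (t - 1) = t by omega] at this
  have := defect_le_numEdges ha
  omega

/-- The states reached from `A` by words of length at most `k`. -/
def reach (S : Set (V → V)) (A : Finset V) (k : ℕ) : Set V :=
  {x | ∃ s ≤ k, ∃ f, IsWord S s f ∧ ∃ a ∈ A, f a = x}

theorem subset_reach {S : Set (V → V)} {A : Finset V} {x : V} (hx : x ∈ A) (k : ℕ) :
    x ∈ reach S A k := ⟨0, Nat.zero_le k, id, IsWord.nil, x, hx, rfl⟩

theorem reach_mono {S : Set (V → V)} {A : Finset V} {k l : ℕ} (h : k ≤ l) :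
    reach S A k ⊆ reach S A l := fun _ ⟨s, hs, hf⟩ => ⟨s, hs.trans h, hf⟩

theorem reach_succ {S : Set (V → V)} {A : Finset V} {k : ℕ} {x : V} (hx : x ∈ reach S A k)
    {L : V → V} (hL : L ∈ S) : L x ∈ reach S A (k + 1) := by
  obtain ⟨s, hs, f, hf, a, ha, rfl⟩ := hx
  exact ⟨s + 1, by omega, L ∘ f, hf.snoc hL, a, ha, rfl⟩

theorem exists_exit {S : Set (V → V)} (hsc : StronglyConnected S) {B : Finset V}
    (hB : B.Nonempty) (hlt : B.card < Fintype.card V) : ∃ x ∈ B, ∃ L ∈ S, L x ∉ B := by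
  by_contra! h
  obtain ⟨b, hb⟩ := hB
  obtain ⟨y, hy⟩ : ∃ y, y ∉ B := by
    by_contra! hall
    rw [Finset.eq_univ_iff_forall.2 hall, Finset.card_univ] at hlt
    exact lt_irrefl _ hlt
  obtain ⟨t, f, hf, rfl⟩ := hsc b y
  have : ∀ t f, IsWord S t f → ∀ x ∈ B, f x ∈ B := by
    intro t f hf
    induction hf with
    | nil => intro x hx; exact hx
    | cons hL _ ih => intro x hx; exact ih _ (h x hx _ hL)
  exact hy (this t f hf b hb)

/-- A proper nonempty subset can be left by a single letter. The state added in step `i` is thus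
reached from `A` by at most `i` letters and contributes at most `c i`. -/
theorem exists_greedy {S : Set (V → V)} (hsc : StronglyConnected S) {A : Finset V}
    (hA : A.Nonempty) {d : V → ℕ} {m : ℕ} (hm : A.card + m ≤ Fintype.card V) {c : ℕ → ℕ}
    (hc : ∀ k, 1 ≤ k → k ≤ m → ∀ x ∈ reach S A k, d x ≤ c k) :
    ∃ B, A ⊆ B ∧ B.card = A.card + m ∧ (∀ x ∈ B, x ∈ reach S A m) ∧
      ∑ x ∈ B, d x ≤ ∑ x ∈ A, d x + ∑ i ∈ Finset.range m, c (i + 1) := by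
  induction m with
  | zero => exact ⟨A, subset_rfl, by simp, fun x hx => subset_reach hx 0, by simp⟩
  | succ m ih =>
    obtain ⟨B, hAB, hcard, hreach, hsum⟩ := ih (by omega) fun k h1 h2 => hc k h1 (by omega)
    obtain ⟨x, hx, L, hL, hLx⟩ := exists_exit hsc (hA.mono hAB) (by omega)
    have h1 := reach_succ (hreach x hx) hL
    refine ⟨insert (L x) B, hAB.trans (Finset.subset_insert _ _), ?_, ?_, ?_⟩
    · rw [Finset.card_insert_of_notMem hLx, hcard]; ring
    · intro y hy
      rcases Finset.mem_insert.1 hy with rfl | hy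
      · exact h1
      · exact reach_mono (Nat.le_succ m) (hreach y hy)
    · rw [Finset.sum_insert hLx, Finset.sum_range_succ]
      have := hc (m + 1) (by omega) le_rfl _ h1
      omega

end Growth

/-! ### Bounds for the defects of short words and the main counting inequality -/

/-- The maximal defect that a word of length at most `j` can have if there are no triples before
time `T` and letters have defect at most `r`. -/
def lpCap (n T r j : ℕ) : ℕ :=
  Nat.findGreatest (fun δ => δ ≤ j * r ∧ T ≤ j + stageSum (2 * δ) n) n

section Caps

variable {V : Type*} [Fintype V] [DecidableEq V]

theorem defect_le_lpCap {S : Set (V → V)} {T r : ℕ} (hn : 3 ≤ Fintype.card V)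
    (hT : TripleFree S T) (hsync : Synchronizing S) (hr : ∀ L ∈ S, defect L ≤ r) {s j : ℕ}
    (hs : s ≤ j) {f : V → V} (hf : IsWord S s f) :
    defect f ≤ lpCap (Fintype.card V) T r j := by
  refine Nat.le_findGreatest (Nat.sub_le _ _) ⟨?_, ?_⟩
  · exact (defect_word_le hr hf).trans (Nat.mul_le_mul_right r hs)
  · have := le_stageSum_of_word hn hT hsync hf
    omega

theorem mem_dups_of_reach {S : Set (V → V)} {A : Finset V} {a : V → V} (ha : a ∈ S)
    (hA : A ⊆ dups a) {k : ℕ} {x : V} (hx : x ∈ reach S A k) :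
    ∃ s ≤ k + 1, ∃ f, IsWord S s f ∧ x ∈ dups f := by
  obtain ⟨s, hs, f, hf, y, hy, rfl⟩ := hx
  exact ⟨s + 1, by omega, f ∘ a, IsWord.cons ha hf, dups_comp (hA hy)⟩

theorem deg_le_lpCap {S : Set (V → V)} {T r : ℕ} (hn : 3 ≤ Fintype.card V)
    (hT : TripleFree S T) (hsync : Synchronizing S) (hr : ∀ L ∈ S, defect L ≤ r) {s j t : ℕ}
    (hs : s ≤ j) (ht : t + j < T) {f : V → V} (hf : IsWord S s f) {x : V} (hx : x ∈ dups f) :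
    deg (mergeGraph S t) x ≤ lpCap (Fintype.card V) T r j :=
  (deg_le_defect hT hf hx (by omega)).trans (defect_le_lpCap hn hT hsync hr hs hf)

/-- The degree sum at time `t` is estimated along the greedy enumeration that starts with the
`defect a` doubled states of `a`; the `k`-th further state is doubled by a word of length at most `k
+ 1`. On the other side, there are `defect a` edges at time one and a new one in each later step. -/
theorem lpCap_count {S : Set (V → V)} {T t : ℕ} (hn : 3 ≤ Fintype.card V)
    (hT : TripleFree S T) (hsc : StronglyConnected S) (hsync : Synchronizing S) {a : V → V}
    (ha : a ∈ S) (hr : ∀ L ∈ S, defect L ≤ defect a) (hpos : 0 < defect a) (ht : 1 ≤ t)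
    (htT : t + (Fintype.card V - defect a + 1) < T) :
    2 * (t + defect a) ≤ 2 + (defect a * lpCap (Fintype.card V) T (defect a) 1 +
      ∑ i ∈ Finset.range (Fintype.card V - defect a),
        lpCap (Fintype.card V) T (defect a) (i + 2)) := by
  have hw := IsWord.letter ha
  have hc := card_dups (hT 1 (by omega) a hw)
  have hle := card_image_add_defect a
  obtain ⟨B, hAB, hB, -, hsum⟩ := exists_greedy hsc (A := dups a)
    (d := deg (mergeGraph S t)) (m := Fintype.card V - defect a)
    (c := fun k => lpCap (Fintype.card V) T (defect a) (k + 1))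
    (Finset.card_pos.1 (by omega)) (by omega) fun k h1 h2 x hx => by
      obtain ⟨s, hs, f, hf, hxf⟩ := mem_dups_of_reach ha subset_rfl hx
      exact deg_le_lpCap hn hT hsync hr hs (by omega) hf hxf
  have hBu : B = Finset.univ := (Finset.card_eq_iff_eq_univ B).1 (by omega)
  rw [hBu, sum_deg] at hsum
  have h1 : ∑ x ∈ dups a, deg (mergeGraph S t) x ≤
      (dups a).card * lpCap (Fintype.card V) T (defect a) 1 := by
    rw [← smul_eq_mul]
    exact Finset.sum_le_card_nsmul _ _ _ fun x hx =>
      deg_le_lpCap hn hT hsync hr le_rfl (by omega) hw hx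
  have h2 := numEdges_ge hn hT hsync ha hpos ht (by omega)
  simp only [Nat.add_assoc, Nat.reduceAdd] at hsum
  rw [hc] at h1
  omega

end Caps

/-! ### Numerical contradictions to the counting inequality -/

/-- The integer parts of the bound. -/
def floorTable (n : ℕ) : ℕ :=
  [0, 0, 0, 0, 5, 7, 10, 13, 16, 19, 23, 27, 32, 36, 42, 47, 52, 58, 65, 71, 78, 85, 93, 101, 109,
    117, 126, 135].getD n 0

/-- This contradicts `lpCap_count` for `T = floorTable n + 1` at the last admissible time. The bound
`n / 2` on `r` is `two_mul_defect_le`; defect one with fewer than 14 states is left to the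
structural analysis. -/
theorem lpCap_small : ∀ n ∈ Finset.Ico 4 28, ∀ r ∈ Finset.Icc (if n < 14 then 2 else 1) (n / 2),
    n - r + 1 < floorTable n ∧
    2 + (r * lpCap n (floorTable n + 1) r 1 +
      ∑ i ∈ Finset.range (n - r), lpCap n (floorTable n + 1) r (i + 2)) <
      2 * ((floorTable n - (n - r + 1)) + r) := by
  decide +kernel

theorem four_mul_stageSum (δ k : ℕ) :
    4 * stageSum (2 * δ) (2 * δ + k) + 4 * δ ^ 2 =
      (2 * δ + k + 1) ^ 2 + if k % 2 = 0 then 3 else 0 := by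
  induction k with
  | zero =>
    simp only [stageSum, Nat.add_zero, Finset.Icc_self, Finset.sum_singleton]
    rw [if_pos (Nat.mul_mod_right 2 δ), if_pos True.intro, Nat.mul_div_cancel_left δ (by norm_num)]
    ring
  | succ k ih =>
    have hs : stageSum (2 * δ) (2 * δ + (k + 1)) = stageSum (2 * δ) (2 * δ + k) +
        if (2 * δ + (k + 1)) % 2 = 0 then (2 * δ + (k + 1)) / 2 + 1
        else (2 * δ + (k + 1) - 1) / 2 := by
      unfold stageSum
      rw [← Nat.add_assoc, Finset.sum_Icc_succ_top (by omega)]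
    rw [hs]
    rcases Nat.mod_two_eq_zero_or_one k with h | h
    · rw [if_pos h] at ih
      rw [if_neg (by omega), if_neg (by omega)]
      obtain ⟨m, rfl⟩ : ∃ m, k = 2 * m := ⟨k / 2, by omega⟩
      have : (2 * δ + (2 * m + 1) - 1) / 2 = δ + m := by omega
      rw [this]
      nlinarith
    · rw [if_neg (by omega)] at ih
      rw [if_pos (by omega), if_pos (by omega)]
      obtain ⟨m, rfl⟩ : ∃ m, k = 2 * m + 1 := ⟨k / 2, by omega⟩
      have : (2 * δ + (2 * m + 1 + 1)) / 2 = δ + m + 1 := by omega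
      rw [this]
      nlinarith

theorem stageSum_le {δ n : ℕ} (h : stageSum (2 * δ) n ≠ 0) :
    4 * stageSum (2 * δ) n + 4 * δ ^ 2 ≤ (n + 1) ^ 2 + 3 := by
  by_cases hn : 2 * δ ≤ n
  · obtain ⟨k, rfl⟩ := Nat.exists_eq_add_of_le hn
    have := four_mul_stageSum δ k
    split_ifs at this <;> omega
  · exact absurd (by unfold stageSum; rw [Finset.Icc_eq_empty (by omega)]; rfl) h

theorem lpCap_le_mul (n T r j : ℕ) : lpCap n T r j ≤ j * r := by
  by_cases h : lpCap n T r j = 0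
  · omega
  · exact (Nat.findGreatest_of_ne_zero rfl h).1

/-- Linearization of the quadratic restriction on the defect `ρ` from `stageSum_le`, by `u * ρ ≤ ρ ^
2 + u ^ 2 / 4`. The equation for `u` is chosen such that `n * (u + 3) / 4` is the bound to be
proved. -/
theorem mul_lpCap_le {n T j : ℕ} {u : ℝ} (hun : u ^ 2 + u * n = n ^ 2 + n - 3)
    (hT : n * (u + 3) / 4 < T) (hj : j < T) (hY : 0 ≤ u ^ 2 / 2 + j - n / 2 + 7 / 4) (r : ℕ) :
    u * lpCap n T r j ≤ u ^ 2 / 2 + j - n / 2 + 7 / 4 := by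
  by_cases h : lpCap n T r j = 0
  · simpa [h] using hY
  · obtain ⟨-, h2⟩ := Nat.findGreatest_of_ne_zero rfl h
    change T ≤ j + stageSum (2 * lpCap n T r j) n at h2
    have h3 := stageSum_le (δ := lpCap n T r j) (n := n) (by omega)
    generalize lpCap n T r j = ρ at *
    have h4 : (4 : ℝ) * T + 4 * ρ ^ 2 ≤ 4 * j + (n + 1) ^ 2 + 3 := by
      have : 4 * T + 4 * ρ ^ 2 ≤ 4 * j + (n + 1) ^ 2 + 3 := by omega
      exact_mod_cast this
    nlinarith [sq_nonneg (u / 2 - ρ)]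

theorem sum_mul_lpCap_le {n T r : ℕ} {u : ℝ} (hun : u ^ 2 + u * n = n ^ 2 + n - 3)
    (hT : n * (u + 3) / 4 < T)
    (hY : 0 ≤ u ^ 2 / 2 - n / 2 + 7 / 4) (c m : ℕ) (hm : m + c ≤ T) :
    u * ∑ i ∈ Finset.range m, (lpCap n T r (i + c) : ℝ) ≤
      m * (u ^ 2 / 2 - n / 2 + 7 / 4 + c) + m * (m - 1) / 2 := by
  induction m with
  | zero => simp
  | succ m ih =>
    have ih := ih (by omega)
    have := mul_lpCap_le hun hT (j := m + c) (by omega) (by have : (0 : ℝ) ≤ (m + c : ℕ) := Nat.cast_nonneg _; linarith) r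
    rw [Finset.sum_range_succ, mul_add]
    push_cast at this ⊢
    nlinarith

/-- Multiplied by `u`, the caps are summed by their linear estimates. This is too generous for very
short words when `r` is one or two, where the first terms are replaced by the trivial estimate `j *
r`. -/
theorem lpCap_large {n r t T : ℕ} (hn : 28 ≤ n) (hr : 1 ≤ r) (hrn : r + 3 ≤ n) {u : ℝ}
    (hu : 0 < u) (hun : u ^ 2 + u * n = n ^ 2 + n - 3) (hT : n * (u + 3) / 4 < T)
    (htT : t + (n - r + 1) + 1 = T) :
    2 + (r * lpCap n T r 1 + ∑ i ∈ Finset.range (n - r), lpCap n T r (i + 2)) < 2 * (t + r) := by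
  have hn' : (28 : ℝ) ≤ n := by exact_mod_cast hn
  have hr' : (1 : ℝ) ≤ r := by exact_mod_cast hr
  -- The ratio `u / n` is close to `(√5 - 1) / 2`, about 0.618.
  have hun1 : 0.6 * n ≤ u := by nlinarith
  have htT' : (t : ℝ) + n - r + 2 = T := by
    have : t + n + 2 = T + r := by omega
    have : (t : ℝ) + n + 2 = T + r := by exact_mod_cast this
    linarith
  have hF : u * n / 2 + 12 * u + 9 * n / 4 ≤ 2 * u ^ 2 - 2 * n + 11 := by
    have h1 : 0 ≤ (u - 0.6 * n) * (2 * u - n / 2 - 12) :=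
      mul_nonneg (by linarith) (by linarith)
    have h2 : 0 ≤ (2 * (u - 0.6 * n)) * (0.6 * n) := mul_nonneg (by linarith) (by linarith)
    nlinarith
  have hF' : u * n / 2 + 3 * u + 9 * n / 4 ≤ 3 * (u ^ 2 / 2 - n / 2 + 11 / 4) := by
    have h1 : 0 ≤ (u - 0.6 * n) * (3 / 2 * u - n / 2 - 3) :=
      mul_nonneg (by linarith) (by linarith)
    have h2 : 0 ≤ (3 / 2 * (u - 0.6 * n)) * (0.6 * n) := mul_nonneg (by linarith) (by linarith)
    nlinarith
  have hY0 : 0 ≤ u ^ 2 / 2 - n / 2 + 7 / 4 := by nlinarith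
  have hTn : n + 5 < T := by
    have : ((n + 5 : ℕ) : ℝ) < T := by push_cast; nlinarith
    exact_mod_cast this
  by_contra! hcon
  have hcon' : 2 * ((t : ℝ) + r) ≤ 2 + (r * lpCap n T r 1 +
      ∑ i ∈ Finset.range (n - r), (lpCap n T r (i + 2) : ℝ)) := by exact_mod_cast hcon
  have hcon1 : 2 * u * (T - n + 2 * r - 3) ≤ u * (r * lpCap n T r 1) +
      u * ∑ i ∈ Finset.range (n - r), (lpCap n T r (i + 2) : ℝ) := by
    rw [← mul_add]
    have := mul_le_mul_of_nonneg_left (show 2 * ((T : ℝ) - n + 2 * r - 3) ≤ r * lpCap n T r 1 +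
      ∑ i ∈ Finset.range (n - r), (lpCap n T r (i + 2) : ℝ) by linarith) hu.le
    linarith
  have hcon2 : u * (n * (u + 3) / 2 - 2 * n + 4 * r - 6) < 2 * u * (T - n + 2 * r - 3) := by
    have := mul_lt_mul_of_pos_left hT hu
    linarith
  have cap (j : ℕ) : (lpCap n T r j : ℝ) ≤ j * r := by exact_mod_cast lpCap_le_mul n T r j
  have c1 := mul_le_mul_of_nonneg_left (cap 1) hu.le
  have c2 := mul_le_mul_of_nonneg_left (cap 2) hu.le
  have c3 := mul_le_mul_of_nonneg_left (cap 3) hu.le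
  have c4 := mul_le_mul_of_nonneg_left (cap 4) hu.le
  push_cast at c1 c2 c3 c4
  have hm : (((n - 4 : ℕ)) : ℝ) = n - 4 := by rw [Nat.cast_sub (by omega)]; norm_num
  rcases (show r = 1 ∨ r = 2 ∨ 3 ≤ r by omega) with rfl | rfl | h3
  · have hs := sum_mul_lpCap_le hun hT hY0 (r := 1) 5 (n - 4) (by omega)
    rw [show n - 1 = n - 4 + 1 + 1 + 1 by omega, Finset.sum_range_succ', Finset.sum_range_succ',
      Finset.sum_range_succ'] at hcon1
    simp only [Nat.add_assoc, Nat.reduceAdd] at hcon1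
    rw [hm] at hs
    push_cast at *
    linarith
  · have hs := sum_mul_lpCap_le hun hT hY0 (r := 2) 4 (n - 4) (by omega)
    rw [show n - 2 = n - 4 + 1 + 1 by omega, Finset.sum_range_succ',
      Finset.sum_range_succ'] at hcon1
    simp only [Nat.add_assoc, Nat.reduceAdd] at hcon1
    rw [hm] at hs
    push_cast at *
    linarith
  · have h3' : (3 : ℝ) ≤ r := by exact_mod_cast h3
    have hrn' : (r : ℝ) + 3 ≤ n := by exact_mod_cast hrn
    have hs := sum_mul_lpCap_le hun hT hY0 (r := r) 2 (n - r) (by omega)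
    rw [Nat.cast_sub (by omega)] at hs
    push_cast at hs
    have hs' : u * ∑ i ∈ Finset.range (n - r), (lpCap n T r (i + 2) : ℝ) ≤
        n * u ^ 2 / 2 + 9 * n / 4 - r * (u ^ 2 / 2 - n / 2 + 11 / 4) := by
      have : 0 ≤ ((r : ℝ) - 1) * (n - r / 2) := mul_nonneg (by linarith) (by linarith)
      linarith
    -- The cap for single letters is bounded by the smaller of its linear estimate and `r`.
    by_cases hX : u ^ 2 / 2 - n / 2 + 11 / 4 ≤ u * r
    · have := mul_le_mul_of_nonneg_left
        (mul_lpCap_le hun hT (j := 1) (by omega) (by push_cast; linarith) r)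
        (Nat.cast_nonneg (α := ℝ) r)
      push_cast at this
      linarith
    · have h5 : 0 ≤ ((r : ℝ) - 3) * (u ^ 2 / 2 - n / 2 + 11 / 4 - u * r + u) :=
        mul_nonneg (by linarith) (by linarith)
      have h6 := mul_le_mul_of_nonneg_left c1 (Nat.cast_nonneg (α := ℝ) r)
      linarith

/-! ### Graph families with the properties of merge graphs, allowing for `e` additional edges -/

section Family

variable {V : Type*} [Fintype V] [DecidableEq V]

/-- The properties of the merge graphs that are used for counting edges, for automata in which
every letter `L` that is not bijective misses exactly the state `ζ L`. -/
structure IsFamily (S : Set (V → V)) (T e : ℕ) (ζ : (V → V) → V) (F : ℕ → SimpleGraph V) : Prop where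
  mono : ∀ t, F t ≤ F (t + 1)
  cap : ∀ {t l : ℕ} {f : V → V} {x : V}, IsWord S l f → t + l < T → x ∈ dups f →
    ∀ y, ¬ (F t).Adj x (f y)
  perm : ∀ {t : ℕ} {L : V → V} {x y : V}, L ∈ S → Function.Bijective L →
    (F t).Adj (L x) (L y) → (F (t + 1)).Adj x y
  nonperm : ∀ {t : ℕ} {L : V → V} {x y : V}, L ∈ S → ¬ Function.Bijective L →
    (F t).Adj (L x) y → y = ζ L ∨ ∃ u, L u = y ∧ (F (t + 1)).Adj x u
  growth : ∀ {t : ℕ}, t < T → t + e ≤ numEdges (F t)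

variable {S : Set (V → V)} {T e : ℕ} {q : V} {ζ : (V → V) → V} {F : ℕ → SimpleGraph V}

theorem IsFamily.mono_le (hF : IsFamily S T e ζ F) {s t : ℕ} (h : s ≤ t) : F s ≤ F t :=
  monotone_nat_of_le_succ hF.mono h

theorem IsFamily.deg_le_defect (hF : IsFamily S T e ζ F) {t l : ℕ} {f : V → V}
    (hf : IsWord S l f) {x : V} (hx : x ∈ dups f) (hl : t + l < T) : deg (F t) x ≤ defect f := by
  have h : deg (F t) x ≤ (Finset.univ.image f)ᶜ.card := by
    refine deg_le_card fun y hy => Finset.mem_compl.2 fun hyf => ?_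
    obtain ⟨w, -, rfl⟩ := Finset.mem_image.1 hyf
    exact hF.cap hf hl hx w hy
  rwa [Finset.card_compl] at h

theorem IsFamily.deg_perm (hF : IsFamily S T e ζ F) {t : ℕ} {L : V → V} (hL : L ∈ S)
    (hb : Function.Bijective L) (x : V) : deg (F t) (L x) ≤ deg (F (t + 1)) x := by
  have : (F t).neighborSet (L x) ⊆ L '' (F (t + 1)).neighborSet x := fun y hy => by
    obtain ⟨u, rfl⟩ := hb.2 y
    exact ⟨u, hF.perm hL hb hy, rfl⟩
  exact (Set.ncard_le_ncard this (Set.toFinite _)).trans (Set.ncard_image_le (Set.toFinite _))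

/-- Every neighbour of `L x` lifts to a neighbour of `x` one step later, with the missed state `ζ L`
as the only possible exception. -/
theorem IsFamily.deg_letter (hF : IsFamily S T e ζ F) {t : ℕ} {L : V → V} (hL : L ∈ S) (x : V) :
    deg (F t) (L x) ≤ deg (F (t + 1)) x + 1 := by
  by_cases hb : Function.Bijective L
  · exact (hF.deg_perm hL hb x).trans (Nat.le_succ _)
  have : (F t).neighborSet (L x) ⊆ insert (ζ L) (L '' (F (t + 1)).neighborSet x) := fun y hy => by
    rcases hF.nonperm hL hb hy with h | ⟨u, rfl, hu⟩
    · rw [h]; exact Set.mem_insert _ _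
    · exact Set.mem_insert_of_mem _ ⟨u, hu, rfl⟩
  refine (Set.ncard_le_ncard this (Set.toFinite _)).trans ((Set.ncard_insert_le _ _).trans ?_)
  exact Nat.succ_le_succ (Set.ncard_image_le (Set.toFinite _))

theorem IsFamily.edge_count (hF : IsFamily S T e ζ F) {t : ℕ} (ht : t < T) (A : Finset V) :
    t + e ≤ ∑ x ∈ A, deg (F t) x + (Fintype.card V - A.card).choose 2 :=
  (hF.growth ht).trans (numEdges_le _ A)

theorem reach_reach {A B : Finset V} {k l : ℕ} (h : ∀ x ∈ A, x ∈ reach S B k) {x : V}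
    (hx : x ∈ reach S A l) : x ∈ reach S B (k + l) := by
  obtain ⟨s, hs, f, hf, y, hy, rfl⟩ := hx
  obtain ⟨s', hs', g, hg, b, hb, rfl⟩ := h y hy
  exact ⟨s + s', by omega, f ∘ g, hg.append hf, b, hb, rfl⟩

/-- The count of `lpCap_count`, started from a set `A` on which better degree bounds are known. The
caps `c` are left open because both `lpCap` and `isoCap` are used. -/
theorem IsFamily.sum_count (hF : IsFamily S T e ζ F) (hsc : StronglyConnected S)
    {a : V → V} (ha : a ∈ S) (hq : q ∈ dups a) {A : Finset V} {m : ℕ} (hm : A.card = m + 1)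
    (hA : ∀ x ∈ A, x ∈ reach S {q} m) {c : ℕ → ℕ}
    (hc : ∀ j, ∀ s ≤ j, ∀ f, IsWord S s f → defect f ≤ c j) {t : ℕ}
    (ht : t + Fintype.card V < T) :
    2 * (t + e) ≤ ∑ x ∈ A, deg (F t) x +
      ∑ i ∈ Finset.range (Fintype.card V - (m + 1)), c (m + 2 + i) := by
  have hle := Finset.card_le_univ A
  obtain ⟨B, hAB, hB, -, hsum⟩ := exists_greedy hsc (A := A)
    (d := deg (F t)) (m := Fintype.card V - (m + 1))
    (c := fun k => c (m + 1 + k))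
    (Finset.card_pos.1 (by omega)) (by omega) fun k h1 h2 x hx => by
      obtain ⟨s, hs, f, hf, hxf⟩ := mem_dups_of_reach ha (Finset.singleton_subset_iff.2 hq)
        (reach_reach hA hx)
      exact (hF.deg_le_defect hf hxf (by omega)).trans (hc _ s (by omega) f hf)
  have hBu : B = Finset.univ := (Finset.card_eq_iff_eq_univ B).1 (by omega)
  rw [hBu, sum_deg] at hsum
  have h2 := hF.growth (t := t) (by omega)
  have h3 : ∀ i, m + 1 + (i + 1) = m + 2 + i := fun i => by omega
  simp only [h3] at hsum
  omega

end Family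

/-! ### Improved defect bounds in the presence of an isolated state -/

/-- The maximal defect of a word of length at most `j` when every letter has defect at most one
and some state is isolated at time `t`. -/
def isoCap (n t j : ℕ) : ℕ :=
  Nat.findGreatest (fun δ => δ ≤ j ∧ t + 1 ≤ j + stageSum (2 * δ) (n - 1)) n

section IsoCap

variable {V : Type*} [Fintype V] [DecidableEq V] {S : Set (V → V)} {T : ℕ} {q : V}

theorem defect_le_isoCap (hn : 3 ≤ Fintype.card V)
    (hT : TripleFree S T) (hsync : Synchronizing S) (hr : ∀ L ∈ S, defect L ≤ 1)
    {τ : ℕ} (hτ : τ < T) (hq : ∀ x, ¬ (mergeGraph S τ).Adj q x) (j s : ℕ)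
    (hs : s ≤ j) (f : V → V) (hf : IsWord S s f) :
    defect f ≤ isoCap (Fintype.card V) τ j := by
  refine Nat.le_findGreatest (Nat.sub_le _ _) ⟨?_, ?_⟩
  · have := defect_word_le hr hf
    omega
  · have := le_stageSum_of_isolated hn hT hsync hf hτ hq
    omega

end IsoCap

/-! ### Letters of defect at most one with a common doubled state; the common missed state; dead
pairs -/

section SameDup

variable {V : Type*} [Fintype V] [DecidableEq V]

theorem exists_missing {f : V → V} (h : defect f = 1) : ∃ z, ∀ y, (∃ w, f w = y) ↔ y ≠ z := by
  have := card_image_add_defect f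
  have hc : (Finset.univ.image f)ᶜ.card = 1 := by rw [Finset.card_compl]; omega
  obtain ⟨z, hz⟩ := Finset.card_eq_one.1 hc
  refine ⟨z, fun y => ?_⟩
  have := Finset.ext_iff.1 hz y
  simp only [Finset.mem_compl, Finset.mem_image, Finset.mem_univ, true_and,
    Finset.mem_singleton] at this
  rw [← not_iff_not, this, not_not]

/-- All letters are bijective or of defect one, and there is a letter that is not bijective;
all letters that are not bijective have the same state `q` with two preimages. -/
structure SameDup (S : Set (V → V)) (q : V) : Prop where
  defect_le : ∀ L ∈ S, defect L ≤ 1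
  mem_dups : ∀ L ∈ S, ¬ Function.Bijective L → q ∈ dups L
  exists_nonperm : ∃ a ∈ S, ¬ Function.Bijective a

variable {S : Set (V → V)} {T : ℕ} {q z : V}

theorem SameDup.defect_eq (h : SameDup S q) {L : V → V} (hL : L ∈ S)
    (hb : ¬ Function.Bijective L) : defect L = 1 := by
  have h1 := h.defect_le L hL
  rw [← defect_eq_zero_iff] at hb
  omega

/-- A neighbour of `q` at time `T - 2` is missed by every letter that is not bijective, and each
such letter misses only one state. -/
theorem SameDup.isolated_or (h : SameDup S q) (hT : TripleFree S T) (h2 : 2 ≤ T) :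
    (∀ x, ¬ (mergeGraph S (T - 2)).Adj q x) ∨
      ∃ z, (mergeGraph S (T - 2)).Adj q z ∧
        ∀ a ∈ S, ¬ Function.Bijective a → ∀ y, (∃ w, a w = y) ↔ y ≠ z := by
  by_cases hiso : ∀ x, ¬ (mergeGraph S (T - 2)).Adj q x
  · exact Or.inl hiso
  push Not at hiso
  obtain ⟨z, hz⟩ := hiso
  refine Or.inr ⟨z, hz, fun a ha hb => ?_⟩
  obtain ⟨z', hz'⟩ := exists_missing (h.defect_eq ha hb)
  have : z = z' := by
    by_contra hne
    obtain ⟨w, rfl⟩ := (hz' z).2 hne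
    exact not_adj_of_mem_dups hT (IsWord.letter ha) (h.mem_dups a ha hb) (by omega) w hz
  rwa [this]

/-- The situation in which all letters that are not bijective miss the same state `z` and have
the same state `q` with two preimages. -/
structure SameMiss (S : Set (V → V)) (T : ℕ) (q z : V) : Prop extends SameDup S q where
  three_le : 3 ≤ Fintype.card V
  tripleFree : TripleFree S T
  stronglyConnected : StronglyConnected S
  synchronizing : Synchronizing S
  missing : ∀ a ∈ S, ¬ Function.Bijective a → ∀ y, (∃ w, a w = y) ↔ y ≠ z
  ne : q ≠ z

/-- By strong connectivity some letter maps another state to `z`. It has to be bijective, as the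
other letters miss `z`, and so it cannot fix `z`. -/
theorem SameMiss.exists_moves (h : SameMiss S T q z) :
    ∃ π ∈ S, Function.Bijective π ∧ π z ≠ z := by
  have hc : (Finset.univ.erase z).card < Fintype.card V := by
    rw [← Finset.card_univ]
    exact Finset.card_erase_lt_of_mem (Finset.mem_univ z)
  obtain ⟨x, hx, L, hL, hLx⟩ := exists_exit h.stronglyConnected
    ⟨q, Finset.mem_erase.2 ⟨h.ne, Finset.mem_univ q⟩⟩ hc
  have hLz : L x = z := by simpa using hLx
  have hb : Function.Bijective L := by
    by_contra hb
    exact (h.missing L hL hb z).1 ⟨x, hLz⟩ rfl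
  refine ⟨L, hL, hb, fun e => ?_⟩
  exact (Finset.mem_erase.1 hx).1 (hb.1 (hLz.trans e.symm))

theorem mergeGraph_isFamily (h : SameDup S q) (hn : 3 ≤ Fintype.card V) (hT : TripleFree S T)
    (hsync : Synchronizing S) {ζ : (V → V) → V}
    (hζ : ∀ a ∈ S, ¬ Function.Bijective a → ∀ y, (∃ w, a w = y) ↔ y ≠ ζ a) :
    IsFamily S T 0 ζ (mergeGraph S) where
  mono t := mergeGraph_mono (Nat.le_succ t)
  cap hf hl hx y := not_adj_of_mem_dups hT hf hx hl y
  perm hL _ := mergeGraph_adj_of_letter hL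
  nonperm {t L x y} hL hb hxy := by
    by_cases hy : y = ζ L
    · exact Or.inl hy
    obtain ⟨u, rfl⟩ := (hζ L hL hb y).2 hy
    exact Or.inr ⟨u, rfl, mergeGraph_adj_of_letter hL hxy⟩
  growth {t} ht := by
    obtain ⟨a, ha, hb⟩ := h.exists_nonperm
    have := live_numEdges_ge hn hT hsync ha (h.mem_dups a ha hb)
      (isDead_bot S) (fun _ h => h) ht
    rwa [sdiff_bot] at this

theorem SameMiss.isFamily (h : SameMiss S T q z) :
    IsFamily S T 0 (fun _ => z) (mergeGraph S) :=
  mergeGraph_isFamily h.toSameDup h.three_le h.tripleFree h.synchronizing h.missing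

theorem SameDup.exists_isFamily (h : SameDup S q) (hn : 3 ≤ Fintype.card V)
    (hT : TripleFree S T) (hsync : Synchronizing S) :
    ∃ ζ, IsFamily S T 0 ζ (mergeGraph S) := by
  have : ∀ a : V → V, ∃ z, a ∈ S → ¬ Function.Bijective a → ∀ y, (∃ w, a w = y) ↔ y ≠ z := by
    intro a
    by_cases ha : a ∈ S ∧ ¬ Function.Bijective a
    · obtain ⟨z, hz⟩ := exists_missing (h.defect_eq ha.1 ha.2)
      exact ⟨z, fun _ _ => hz⟩
    · exact ⟨q, fun h1 h2 => absurd ⟨h1, h2⟩ ha⟩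
  choose ζ hζ using this
  exact ⟨ζ, mergeGraph_isFamily h hn hT hsync hζ⟩

/-- The edge between two states. -/
def singleEdge (z w : V) : SimpleGraph V := SimpleGraph.fromEdgeSet {s(z, w)}

theorem singleEdge_adj {z w x y : V} : (singleEdge z w).Adj x y ↔ s(x, y) = s(z, w) ∧ x ≠ y := by
  simp [singleEdge]

/-- Bijective letters pull the pair back to itself, and the other letters never reach `z`. -/
theorem SameMiss.isDead_singleEdge (h : SameMiss S T q z) {w : V}
    (hperm : ∀ L ∈ S, Function.Bijective L → s(L z, L w) = s(z, w)) :
    IsDead S (singleEdge z w) := by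
  intro L hL x y hxy hadj
  rw [singleEdge_adj] at hadj ⊢
  refine ⟨?_, hxy⟩
  by_cases hb : Function.Bijective L
  · rw [← hperm L hL hb] at hadj
    rcases Sym2.eq_iff.1 hadj.1 with ⟨h1, h2⟩ | ⟨h1, h2⟩
    · rw [hb.1 h1, hb.1 h2]
    · rw [hb.1 h1, hb.1 h2, Sym2.eq_swap]
  · exfalso
    rcases Sym2.eq_iff.1 hadj.1 with ⟨h1, h2⟩ | ⟨h1, h2⟩
    · exact (h.missing L hL hb z).1 ⟨x, h1⟩ rfl
    · exact (h.missing L hL hb z).1 ⟨y, h2⟩ rfl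

theorem IsDead.word {D : SimpleGraph V} (hD : IsDead S D) {l : ℕ} {f : V → V} (hf : IsWord S l f)
    {x y : V} (hxy : D.Adj (f x) (f y)) : D.Adj x y := by
  induction hf generalizing x y with
  | nil => exact hxy
  | @cons t L g hL _ ih => exact hD L hL x y (fun e => hxy.ne (by rw [e])) (ih hxy)

/-- If the bijective letters preserve the pair `{z, w}`, then this pair may be added to the merge
graphs, which improves the growth by one. -/
theorem SameMiss.isFamily_sup (h : SameMiss S T q z) {w : V} (hzw : z ≠ w) (hqw : q ≠ w)
    (hperm : ∀ L ∈ S, Function.Bijective L → s(L z, L w) = s(z, w)) :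
    IsFamily S T 1 (fun _ => z) (fun t => mergeGraph S t ⊔ singleEdge z w) where
  mono t := sup_le_sup_right (mergeGraph_mono (Nat.le_succ t)) _
  cap {t l f x} hf hl hx y := by
    rintro (hadj | hadj)
    · exact not_adj_of_mem_dups h.tripleFree hf hx hl y hadj
    · obtain ⟨u, u', hne, hu, hu'⟩ := mem_dups.1 hx
      -- The dead edge would pull back along `f` to both `s(u, y)` and `s(u', y)`, but there is only
      -- one dead edge.
      have hD := h.isDead_singleEdge hperm
      have h1 := hD.word hf (x := u) (y := y) (by rwa [hu])
      have h2 := hD.word hf (x := u') (y := y) (by rwa [hu'])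
      rw [singleEdge_adj] at h1 h2
      have h3 := h1.1.trans h2.1.symm
      rcases Sym2.eq_iff.1 h3 with ⟨h4, -⟩ | ⟨h4, h5⟩
      · exact hne h4
      · exact h1.2 h4
  perm {t L x y} hL _ := by
    rintro (hadj | hadj)
    · exact Or.inl (mergeGraph_adj_of_letter hL hadj)
    · exact Or.inr (h.isDead_singleEdge hperm L hL x y (fun e => hadj.ne (by rw [e])) hadj)
  nonperm {t L x y} hL hb := by
    rintro (hadj | hadj)
    · rcases h.isFamily.nonperm hL hb hadj with h1 | ⟨u, h1, h2⟩
      · exact Or.inl h1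
      · exact Or.inr ⟨u, h1, Or.inl h2⟩
    · rw [singleEdge_adj] at hadj
      rcases Sym2.eq_iff.1 hadj.1 with ⟨h1, h2⟩ | ⟨h1, h2⟩
      · exact absurd rfl ((h.missing L hL hb z).1 ⟨x, h1⟩)
      · exact Or.inl h2
  growth {t} ht := by
    obtain ⟨a, ha, hb⟩ := h.exists_nonperm
    have hq : ∀ x, ¬ (singleEdge z w).Adj q x := by
      intro x hx
      rw [singleEdge_adj] at hx
      rcases Sym2.eq_iff.1 hx.1 with ⟨h1, h2⟩ | ⟨h1, h2⟩
      · exact h.ne h1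
      · exact hqw h1
    have h1 := live_numEdges_ge h.three_le h.tripleFree h.synchronizing ha (h.mem_dups a ha hb)
      (h.isDead_singleEdge hperm) hq ht
    -- The live edges alone number at least `t`; the dead edge is not among them and gives the extra
    -- one.
    have h2 : mergeGraph S t \ singleEdge z w < mergeGraph S t ⊔ singleEdge z w := by
      refine lt_of_le_not_ge (sdiff_le.trans le_sup_left) fun hle => ?_
      have := hle (show (mergeGraph S t ⊔ singleEdge z w).Adj z w from
        Or.inr (singleEdge_adj.2 ⟨rfl, hzw⟩))
      exact this.2 (singleEdge_adj.2 ⟨rfl, hzw⟩)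
    have := numEdges_lt h2
    omega

end SameDup

/-! ### Exclusion of an isolated doubled state and of two different doubled states -/

section Isolated

variable {V : Type*} [Fintype V] [DecidableEq V] {S : Set (V → V)} {T e : ℕ} {q : V}
  {ζ : (V → V) → V} {F : ℕ → SimpleGraph V}

theorem deg_le_one_of {G : SimpleGraph V} {x c : V} (h : ∀ y, G.Adj x y → y = c) :
    deg G x ≤ 1 := by
  have := deg_le_card (A := {c}) fun y hy => Finset.mem_singleton.2 (h y hy)
  simpa using this

theorem deg_eq_zero_of {G : SimpleGraph V} {x : V} (h : ∀ y, ¬ G.Adj x y) : deg G x = 0 := by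
  have := deg_le_card (A := ∅) fun y hy => absurd hy (h y)
  simpa using this

theorem not_adj_of_deg_eq_zero {G : SimpleGraph V} {x : V} (h : deg G x = 0) (y : V) :
    ¬ G.Adj x y := by
  intro hy
  have := (Set.ncard_eq_zero (Set.toFinite _)).1 h
  exact (Set.ext_iff.1 this y).1 hy

theorem letter_reach {A : Finset V} {k : ℕ} (hA : ∀ x ∈ A, x ∈ reach S {q} k) {x : V}
    (hx : x ∈ A) {L : V → V} (hL : L ∈ S) : ∀ y ∈ insert (L x) A, y ∈ reach S {q} (k + 1) := by
  intro y hy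
  rcases Finset.mem_insert.1 hy with rfl | hy
  · exact reach_succ (hA x hx) hL
  · exact reach_mono (Nat.le_succ k) (hA y hy)

theorem IsFamily.deg_mono (hF : IsFamily S T e ζ F) {s t : ℕ} (h : s ≤ t) (x : V) :
    deg (F s) x ≤ deg (F t) x := _root_.deg_mono (hF.mono_le h) x

/-- For six states isolation is needed one step later than for the others: at time `floorTable 6 -
2` both sides would equal 8. -/
theorem isoCap_small : ∀ n ∈ Finset.Ico 6 14,
    1 + ∑ i ∈ Finset.range (n - 2), isoCap n (floorTable n - (if n = 6 then 1 else 2)) (3 + i) <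
      2 * (floorTable n - n) := by
  decide +kernel

/-- Isolation of `q` replaces `lpCap` by the smaller `isoCap`. In addition `q` has degree zero, and
the first state reached from `q` has degree at most one by `IsFamily.deg_letter`. -/
theorem isolated_false (h : SameDup S q) (hn : 6 ≤ Fintype.card V) (hn' : Fintype.card V < 14)
    (hT : TripleFree S (floorTable (Fintype.card V) + 1)) (hsc : StronglyConnected S)
    (hsync : Synchronizing S)
    (hq : ∀ x, ¬ (mergeGraph S (floorTable (Fintype.card V) -
      (if Fintype.card V = 6 then 1 else 2))).Adj q x) : False := by
  obtain ⟨a, ha, hb⟩ := h.exists_nonperm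
  obtain ⟨ζ, hF⟩ := h.exists_isFamily (by omega) hT hsync
  have hcap := defect_le_isoCap (by omega) hT hsync h.defect_le (by split_ifs <;> omega) hq
  have hnum := isoCap_small _ (Finset.mem_Ico.2 ⟨hn, hn'⟩)
  have hlt : Fintype.card V + 2 < floorTable (Fintype.card V) := by
    have : ∀ n ∈ Finset.Ico 6 14, n + 2 < floorTable n := by decide
    exact this _ (Finset.mem_Ico.2 ⟨hn, hn'⟩)
  obtain ⟨x, hx, L, hL, hLx⟩ := exists_exit hsc (B := {q}) ⟨q, Finset.mem_singleton_self q⟩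
    (by simp; omega)
  have hA := letter_reach (S := S) (q := q) (k := 0) (fun x hx => subset_reach hx 0) hx hL
  rw [Finset.mem_singleton.1 hx] at hA hLx
  have := hF.sum_count hsc ha (h.mem_dups a ha hb) (m := 1)
    (by rw [Finset.card_insert_of_notMem hLx]; rfl) hA hcap
    (t := floorTable (Fintype.card V) - Fintype.card V) (by omega)
  rw [Finset.sum_insert hLx, Finset.sum_singleton] at this
  have h0 := deg_eq_zero_of hq
  have h1 := hF.deg_mono (s := floorTable (Fintype.card V) - Fintype.card V + 1)
    (t := floorTable (Fintype.card V) - (if Fintype.card V = 6 then 1 else 2))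
    (by split_ifs <;> omega) q
  have h2 := hF.deg_letter (t := floorTable (Fintype.card V) - Fintype.card V) hL q
  have h3 := hF.deg_mono (Nat.le_succ (floorTable (Fintype.card V) - Fintype.card V)) q
  rw [Nat.succ_eq_add_one] at h3
  simp only [Nat.reduceAdd] at this
  omega

theorem isolated_false_small (h : SameDup S q) (hn : Fintype.card V = 4 ∨ Fintype.card V = 5)
    (hT : TripleFree S (floorTable (Fintype.card V) + 1)) (hsc : StronglyConnected S)
    (hsync : Synchronizing S)
    (hq : ∀ x, ¬ (mergeGraph S (floorTable (Fintype.card V) - 1)).Adj q x) : False := by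
  obtain ⟨a, ha, hb⟩ := h.exists_nonperm
  obtain ⟨ζ, hF⟩ := h.exists_isFamily (by omega) hT hsync
  have h0 := deg_eq_zero_of hq
  rcases hn with hn | hn
  · rw [hn] at hT hF h0
    have := hF.edge_count (t := 4) (by decide) {q}
    rw [Finset.sum_singleton, hn, Finset.card_singleton] at this
    change deg (mergeGraph S 4) q = 0 at h0
    simp [h0] at this
  · rw [hn] at hT hF h0
    change deg (mergeGraph S 6) q = 0 at h0
    obtain ⟨x, hx, L, hL, hLx⟩ := exists_exit hsc (B := {q}) ⟨q, Finset.mem_singleton_self q⟩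
      (by simp; omega)
    rw [Finset.mem_singleton.1 hx] at hLx
    have := hF.edge_count (t := 5) (by decide) {L q, q}
    rw [Finset.sum_insert hLx, Finset.sum_singleton, hn, Finset.card_insert_of_notMem hLx] at this
    have h1 := hF.deg_letter (t := 5) hL q
    have h2 := hF.deg_mono (show 5 ≤ 6 by omega) q
    simp only [Nat.reduceAdd] at h1
    simp at this
    omega

theorem two_dups_small : ∀ n ∈ Finset.Ico 7 14,
    2 + ∑ i ∈ Finset.range (n - 2), lpCap n (floorTable n + 1) 1 (i + 2) <
      2 * (floorTable n + 1 - n) := by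
  decide +kernel

/-- Both `p` and `q` have degree at most one, and an enumeration starting with two states reaches
all others one letter earlier. Below seven states it suffices that at most `2 + (n - 2).choose 2`
edges are possible. -/
theorem two_dups_false (hn : 4 ≤ Fintype.card V) (hn' : Fintype.card V < 14)
    (hT : TripleFree S (floorTable (Fintype.card V) + 1)) (hsc : StronglyConnected S)
    (hsync : Synchronizing S) (hr : ∀ L ∈ S, defect L ≤ 1) {a b : V → V} (ha : a ∈ S)
    (hb : b ∈ S) {p q : V} (hp : p ∈ dups a) (hq : q ∈ dups b) (hpq : p ≠ q) : False := by
  have hcap := fun (j s : ℕ) (hs : s ≤ j) (f : V → V) (hf : IsWord S s f) =>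
    defect_le_lpCap (by omega) hT hsync hr hs hf
  have hgrow : ∀ t < floorTable (Fintype.card V) + 1, t ≤ numEdges (mergeGraph S t) := by
    intro t ht
    have := live_numEdges_ge (by omega) hT hsync ha hp (isDead_bot S) (fun _ h => h) ht
    rwa [sdiff_bot] at this
  have hlt : Fintype.card V < floorTable (Fintype.card V) := by
    have : ∀ n ∈ Finset.Ico 4 14, n < floorTable n := by decide
    exact this _ (Finset.mem_Ico.2 ⟨hn, hn'⟩)
  have hone : ∀ t < floorTable (Fintype.card V), ∀ x ∈ ({p, q} : Finset V),
      deg (mergeGraph S t) x ≤ 1 := by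
    intro t ht x hx
    rcases Finset.mem_insert.1 hx with rfl | hx
    · exact (deg_le_defect hT (IsWord.letter ha) hp (by omega)).trans (hr a ha)
    · rw [Finset.mem_singleton.1 hx]
      exact (deg_le_defect hT (IsWord.letter hb) hq (by omega)).trans (hr b hb)
  by_cases h7 : 7 ≤ Fintype.card V
  · have hnum := two_dups_small _ (Finset.mem_Ico.2 ⟨h7, hn'⟩)
    obtain ⟨B, hAB, hB, -, hsum⟩ := exists_greedy hsc (A := {p, q})
      (d := deg (mergeGraph S (floorTable (Fintype.card V) + 1 - Fintype.card V)))
      (m := Fintype.card V - 2)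
      (c := fun k => lpCap (Fintype.card V) (floorTable (Fintype.card V) + 1) 1 (k + 1))
      ⟨p, by simp⟩ (by rw [Finset.card_pair hpq]; omega) fun k h1 h2 x hx => by
        obtain ⟨s, hs, f, hf, y, hy, rfl⟩ := hx
        rcases Finset.mem_insert.1 hy with rfl | hy
        · exact (deg_le_defect hT (IsWord.cons ha hf) (dups_comp hp) (by omega)).trans
            (hcap _ (s + 1) (by omega) _ (IsWord.cons ha hf))
        · rw [Finset.mem_singleton] at hy
          subst hy
          exact (deg_le_defect hT (IsWord.cons hb hf) (dups_comp hq) (by omega)).trans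
            (hcap _ (s + 1) (by omega) _ (IsWord.cons hb hf))
    have hBu : B = Finset.univ := (Finset.card_eq_iff_eq_univ B).1 (by
      rw [hB, Finset.card_pair hpq]; omega)
    rw [hBu, sum_deg, Finset.sum_pair hpq] at hsum
    have h1 := hone (floorTable (Fintype.card V) + 1 - Fintype.card V) (by omega) p (by simp)
    have h2 := hone (floorTable (Fintype.card V) + 1 - Fintype.card V) (by omega) q (by simp)
    have h3 := hgrow (floorTable (Fintype.card V) + 1 - Fintype.card V) (by omega)
    simp only [Nat.add_assoc, Nat.reduceAdd] at hsum hnum h1 h2 h3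
    omega
  · have h1 := hone (floorTable (Fintype.card V) - 1) (by omega) p (by simp)
    have h2 := hone (floorTable (Fintype.card V) - 1) (by omega) q (by simp)
    have h3 := hgrow (floorTable (Fintype.card V) - 1) (by omega)
    have h4 := numEdges_le (mergeGraph S (floorTable (Fintype.card V) - 1)) {p, q}
    rw [Finset.sum_pair hpq, Finset.card_pair hpq] at h4
    have h5 : ∀ n ∈ Finset.Ico 4 7, 2 + (n - 2).choose 2 < floorTable n - 1 := by decide
    have := h5 _ (Finset.mem_Ico.2 ⟨hn, by omega⟩)
    omega

end Isolated

/-! ### Bijective letters that move `q`, and orbits of `q` with at least three states -/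

theorem lpCap_nine_le : ∀ j ∈ Finset.range 9, lpCap 9 20 1 (j + 1) ≤ 3 := by decide +kernel

theorem lpCap_sum_ten :
    5 + ∑ i ∈ Finset.range (10 - (3 + 1)), lpCap 10 24 1 (3 + 2 + i) < 2 * (13 + 0) := by
  decide +kernel

theorem lpCap_sum_eleven :
    5 + ∑ i ∈ Finset.range (11 - (3 + 1)), lpCap 11 28 1 (3 + 2 + i) < 2 * (16 + 0) := by
  decide +kernel

theorem lpCap_sum_twelve :
    4 + ∑ i ∈ Finset.range (12 - (2 + 1)), lpCap 12 33 1 (2 + 2 + i) < 2 * (20 + 0) := by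
  decide +kernel

theorem lpCap_sum_thirteen :
    4 + ∑ i ∈ Finset.range (13 - (2 + 1)), lpCap 13 37 1 (2 + 2 + i) < 2 * (23 + 0) := by
  decide +kernel

section SameMiss

variable {V : Type*} [Fintype V] [DecidableEq V] {S : Set (V → V)} {T e : ℕ} {q z : V}
  {F : ℕ → SimpleGraph V}

theorem SameMiss.adj_q (h : SameMiss S T q z) (hF : IsFamily S T e (fun _ => z) F) {t : ℕ}
    (ht : t + 1 < T) {y : V} (hy : (F t).Adj q y) : y = z := by
  obtain ⟨a, ha, hb⟩ := h.exists_nonperm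
  by_contra hne
  obtain ⟨w, rfl⟩ := (h.missing a ha hb y).2 hne
  exact hF.cap (IsWord.letter ha) ht (h.mem_dups a ha hb) w hy

theorem SameMiss.deg_q (h : SameMiss S T q z) (hF : IsFamily S T e (fun _ => z) F) {t : ℕ}
    (ht : t + 1 < T) : deg (F t) q ≤ 1 :=
  deg_le_one_of fun _ hy => h.adj_q hF ht hy

theorem IsFamily.adj_perm {ζ : (V → V) → V} (hF : IsFamily S T e ζ F) {π : V → V} (hπ : π ∈ S)
    (hb : Function.Bijective π) {t : ℕ} {x y : V} (h : (F t).Adj (π x) y) :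
    ∃ u, π u = y ∧ (F (t + 1)).Adj x u := by
  obtain ⟨u, rfl⟩ := hb.2 y
  exact ⟨u, rfl, hF.perm hπ hb h⟩

theorem SameMiss.deg_reach (h : SameMiss S T q z) (hF : IsFamily S T e (fun _ => z) F)
    {t k : ℕ} (ht : t + (k + 1) < T) {x : V} (hx : x ∈ reach S {q} k) :
    deg (F t) x ≤ lpCap (Fintype.card V) T 1 (k + 1) := by
  obtain ⟨a, ha, hb⟩ := h.exists_nonperm
  obtain ⟨s, hs, f, hf, hxf⟩ := mem_dups_of_reach ha
    (Finset.singleton_subset_iff.2 (h.mem_dups a ha hb)) hx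
  exact (hF.deg_le_defect hf hxf (by omega)).trans
    (defect_le_lpCap h.three_le h.tripleFree h.synchronizing h.defect_le hs hf)

theorem SameMiss.sum_false (h : SameMiss S T q z) (hF : IsFamily S T e (fun _ => z) F)
    {A : Finset V} {m s t : ℕ} (hm : A.card = m + 1) (hA : ∀ x ∈ A, x ∈ reach S {q} m)
    (ht : t + Fintype.card V < T) (hs : ∑ x ∈ A, deg (F t) x ≤ s)
    (hnum : s + ∑ i ∈ Finset.range (Fintype.card V - (m + 1)),
      lpCap (Fintype.card V) T 1 (m + 2 + i) < 2 * (t + e)) : False := by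
  obtain ⟨a, ha, hb⟩ := h.exists_nonperm
  have := hF.sum_count h.stronglyConnected ha (h.mem_dups a ha hb) hm hA
    (fun j s hs f hf => defect_le_lpCap h.three_le h.tripleFree h.synchronizing h.defect_le hs hf)
    ht
  omega

theorem SameMiss.edge_false (_h : SameMiss S T q z) (hF : IsFamily S T e (fun _ => z) F)
    {A : Finset V} {m s t : ℕ} (hm : A.card = m) (ht : t < T) (hs : ∑ x ∈ A, deg (F t) x ≤ s)
    (hnum : s + (Fintype.card V - m).choose 2 < t + e) : False := by
  have := hF.edge_count ht A
  rw [hm] at this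
  omega

/-- The situation in which a bijective letter moves `q`. -/
structure MovesDup (S : Set (V → V)) (T : ℕ) (q z : V) (π : V → V) : Prop
    extends SameMiss S T q z where
  mem : π ∈ S
  bij : Function.Bijective π
  moves : π q ≠ q

variable {π : V → V}

theorem MovesDup.deg_image (h : MovesDup S T q z π) (hF : IsFamily S T e (fun _ => z) F) {t : ℕ}
    (ht : t + 2 < T) : deg (F t) (π q) ≤ 1 :=
  (hF.deg_perm h.mem h.bij q).trans (h.deg_q hF (by omega))

theorem MovesDup.deg_pair (h : MovesDup S T q z π) (hF : IsFamily S T e (fun _ => z) F) {t : ℕ}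
    (ht : t + 2 < T) {x : V} (hx : x ∈ ({π q, q} : Finset V)) : deg (F t) x ≤ 1 := by
  rcases Finset.mem_insert.1 hx with rfl | hx
  · exact h.deg_image hF ht
  · rw [Finset.mem_singleton.1 hx]
    exact h.deg_q hF (by omega)

theorem MovesDup.card_pair (h : MovesDup S T q z π) : ({π q, q} : Finset V).card = 2 :=
  Finset.card_pair h.moves

theorem MovesDup.sum_pair (h : MovesDup S T q z π) (hF : IsFamily S T e (fun _ => z) F) {t : ℕ}
    (ht : t + 2 < T) : ∑ x ∈ ({π q, q} : Finset V), deg (F t) x ≤ 2 := by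
  have := Finset.sum_le_card_nsmul _ _ 1 fun x hx => h.deg_pair hF ht hx
  rwa [h.card_pair] at this

theorem MovesDup.reach_pair (h : MovesDup S T q z π) :
    ∀ x ∈ ({π q, q} : Finset V), x ∈ reach S {q} 1 :=
  letter_reach (A := {q}) (k := 0) (fun _ hx => subset_reach hx 0) (Finset.mem_singleton_self q)
    h.mem

/-- Extending a set by a letter image. -/
theorem exists_insert (hsc : StronglyConnected S) {A : Finset V} {m : ℕ} (hm : A.card = m + 1)
    (hlt : m + 1 < Fintype.card V) (hA : ∀ x ∈ A, x ∈ reach S {q} m) :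
    ∃ x ∈ A, ∃ L ∈ S, L x ∉ A ∧ (insert (L x) A).card = m + 1 + 1 ∧
      ∀ y ∈ insert (L x) A, y ∈ reach S {q} (m + 1) := by
  obtain ⟨x, hx, L, hL, hLx⟩ := exists_exit hsc (B := A) (Finset.card_pos.1 (by omega)) (by omega)
  exact ⟨x, hx, L, hL, hLx, by rw [Finset.card_insert_of_notMem hLx, hm],
    letter_reach hA hx hL⟩

/-- The degrees of `q`, `π q` and the next state reached are at most one, one and two. -/
theorem MovesDup.false_of_large (h : MovesDup S T q z π)
    (hnT : Fintype.card V = 12 ∧ T = 33 ∨ Fintype.card V = 13 ∧ T = 37) : False := by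
  have hF := h.isFamily
  obtain ⟨x, hx, L, hL, hLx, hc, hr⟩ := exists_insert h.stronglyConnected h.card_pair (by omega)
    h.reach_pair
  have key : ∀ t, t + 3 < T → ∑ y ∈ insert (L x) {π q, q}, deg (mergeGraph S t) y ≤ 4 := by
    intro t ht
    rw [Finset.sum_insert hLx]
    have h1 := h.sum_pair hF (t := t) (by omega)
    have h2 := hF.deg_letter (t := t) hL x
    have h3 := h.deg_pair hF (t := t + 1) (by omega) hx
    omega
  rcases hnT with ⟨hn, rfl⟩ | ⟨hn, rfl⟩
  · exact h.sum_false hF (t := 20) hc hr (by omega) (key _ (by omega))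
      (by rw [hn]; exact lpCap_sum_twelve)
  · exact h.sum_false hF (t := 23) hc hr (by omega) (key _ (by omega))
      (by rw [hn]; exact lpCap_sum_thirteen)

theorem deg_le_three_of_card_nine (h : SameMiss S 20 q z) (hn : Fintype.card V = 9)
    (hF : IsFamily S 20 e (fun _ => z) F) {t k : ℕ} (hk : k ≤ 8) (ht : t + (k + 1) < 20) {x : V}
    (hx : x ∈ reach S {q} k) : deg (F t) x ≤ 3 := by
  have h1 := h.deg_reach hF ht hx
  rw [hn] at h1
  exact h1.trans (lpCap_nine_le k (Finset.mem_range.2 (by omega)))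

theorem mem_reach_card (hsc : StronglyConnected S) (x : V) :
    x ∈ reach S {q} (Fintype.card V - 1) := by
  have hpos : 0 < Fintype.card V := Fintype.card_pos_iff.2 ⟨q⟩
  obtain ⟨B, -, hB, hr, -⟩ := exists_greedy hsc (A := {q}) (d := fun _ => 0)
    (m := Fintype.card V - 1) (c := fun _ => 0) ⟨q, Finset.mem_singleton_self q⟩
    (by rw [Finset.card_singleton]; omega) fun _ _ _ _ _ => le_rfl
  have hBu : B = Finset.univ := (Finset.card_eq_iff_eq_univ B).1 (by
    rw [hB, Finset.card_singleton]; omega)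
  exact hr x (hBu ▸ Finset.mem_univ x)

/-- For nine states, it suffices to bound the degrees on a small set, as all degrees are at most
three. -/
theorem SameMiss.false_of_card_nine (h : SameMiss S 20 q z) (hn : Fintype.card V = 9)
    (hF : IsFamily S 20 e (fun _ => z) F) {A : Finset V} {s : ℕ}
    (hs : ∑ x ∈ A, deg (F 10) x ≤ s) (hnum : s + 3 * (9 - A.card) < 2 * (10 + e)) : False := by
  have h1 : ∑ x ∈ Aᶜ, deg (F 10) x ≤ 3 * (9 - A.card) := by
    have := Finset.sum_le_card_nsmul Aᶜ (fun x => deg (F 10) x) 3 fun x _ =>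
      deg_le_three_of_card_nine h hn hF (k := 8) le_rfl (by norm_num)
        (by have := mem_reach_card (q := q) h.stronglyConnected x; rwa [hn] at this)
    rw [Finset.card_compl, hn, smul_eq_mul] at this
    omega
  have h2 := Finset.sum_add_sum_compl A (fun x => deg (F 10) x)
  rw [sum_deg] at h2
  have := hF.growth (t := 10) (by norm_num)
  omega

/-- The only possible neighbour of `q` is `z`, and that of `π q` is `π z`. It is independent of the
time and of the family, so it can be used at different times and after adding a dead edge. -/
theorem MovesDup.adj_pair (h : MovesDup S T q z π) {x : V} (hx : x ∈ ({π q, q} : Finset V)) :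
    ∃ c, ∀ {e : ℕ} {F : ℕ → SimpleGraph V}, IsFamily S T e (fun _ => z) F →
      ∀ t, t + 2 < T → ∀ w, (F t).Adj x w → w = c := by
  rcases Finset.mem_insert.1 hx with rfl | hx
  · refine ⟨π z, fun hF t ht w hw => ?_⟩
    obtain ⟨u, rfl, hu⟩ := hF.adj_perm h.mem h.bij hw
    rw [h.adj_q hF (by omega) hu]
  · rw [Finset.mem_singleton.1 hx]
    exact ⟨z, fun hF t ht w hw => h.adj_q hF (by omega) hw⟩

theorem MovesDup.adj_triple (h : MovesDup S T q z π) {ρ : V → V} (hρ : ρ ∈ S)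
    (hρb : Function.Bijective ρ) {x : V} (hx : x ∈ ({π q, q} : Finset V)) {y : V}
    (hy : y ∈ (insert (ρ x) {π q, q} : Finset V)) :
    ∃ c, ∀ {e : ℕ} {F : ℕ → SimpleGraph V}, IsFamily S T e (fun _ => z) F →
      ∀ t, t + 3 < T → ∀ w, (F t).Adj y w → w = c := by
  rcases Finset.mem_insert.1 hy with rfl | hy
  · obtain ⟨c, hc⟩ := h.adj_pair hx
    refine ⟨ρ c, fun hF t ht w hw => ?_⟩
    obtain ⟨u, rfl, hu⟩ := hF.adj_perm hρ hρb hw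
    rw [hc hF (t + 1) (by omega) u hu]
  · obtain ⟨c, hc⟩ := h.adj_pair hy
    exact ⟨c, fun hF t ht w hw => hc hF t (by omega) w hw⟩

theorem MovesDup.sum_triple (h : MovesDup S T q z π) {ρ : V → V} (hρ : ρ ∈ S)
    (hρb : Function.Bijective ρ) {x : V} (hx : x ∈ ({π q, q} : Finset V))
    (hρx : ρ x ∉ ({π q, q} : Finset V)) (hF : IsFamily S T e (fun _ => z) F) {t : ℕ}
    (ht : t + 3 < T) : ∑ y ∈ (insert (ρ x) {π q, q} : Finset V), deg (F t) y ≤ 3 := by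
  have := Finset.sum_le_card_nsmul (insert (ρ x) {π q, q}) (fun y => deg (F t) y) 1 fun y hy => by
    obtain ⟨c, hc⟩ := h.adj_triple hρ hρb hx hy
    exact deg_le_one_of (hc hF t ht)
  rwa [Finset.card_insert_of_notMem hρx, h.card_pair] at this

theorem apply_notMem_of_closed {σ : V → V} (hσ : Function.Injective σ) {A : Finset V}
    (hA : ∀ u ∈ A, σ u ∈ A) {v : V} (hv : v ∉ A) : σ v ∉ A := fun hmem => by
  have h1 : A.image σ = A := Finset.eq_of_subset_of_card_le
    (fun y hy => by obtain ⟨u, hu, rfl⟩ := Finset.mem_image.1 hy; exact hA u hu)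
    (by rw [Finset.card_image_of_injective A hσ])
  rw [← h1] at hmem
  obtain ⟨u, hu, huv⟩ := Finset.mem_image.1 hmem
  exact hv (hσ huv ▸ hu)

/-- At time 10 all degrees are at most three and their sum is at least 20. The three orbit states in
`A` have degree at most one, which leaves a sum of at most 21. A fourth state of degree one, or two
states of degree two, would give a contradiction. Otherwise the state `L y` reached from `A` is
fixed by the bijective letters and has exactly the neighbours `z` and `L c`. These letters then
preserve the pair `{z, L c}`, which is dead, and adding it raises the required sum to 22. -/
theorem MovesDup.false_of_three_of_card_nine (h : MovesDup S 20 q z π) {ρ : V → V} (hρ : ρ ∈ S)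
    (hρb : Function.Bijective ρ) {x : V} (hx : x ∈ ({π q, q} : Finset V))
    (hρx : ρ x ∉ ({π q, q} : Finset V)) (hn : Fintype.card V = 9) : False := by
  have hF := h.isFamily
  have hc : (insert (ρ x) {π q, q} : Finset V).card = 3 := by
    rw [Finset.card_insert_of_notMem hρx, h.card_pair]
  have hsum := h.sum_triple hρ hρb hx hρx hF (t := 10) (by norm_num)
  have hsum' := fun {e : ℕ} {F : ℕ → SimpleGraph V} (hF : IsFamily S 20 e (fun _ => z) F) =>
    h.sum_triple hρ hρb hx hρx hF (t := 10) (by norm_num)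
  have hadj := fun {y : V} => h.adj_triple hρ hρb hx (y := y)
  generalize (insert (ρ x) {π q, q} : Finset V) = A at *
  by_cases hcl : ∃ σ ∈ S, Function.Bijective σ ∧ ∃ u ∈ A, σ u ∉ A
  · obtain ⟨σ, hσ, hσb, u, hu, hσu⟩ := hcl
    obtain ⟨c, hcu⟩ := hadj hu
    have h1 := (hF.deg_perm (t := 10) hσ hσb u).trans
      (deg_le_one_of (hcu hF 11 (by norm_num)))
    refine h.false_of_card_nine hn hF (A := insert (σ u) A) (s := 4) ?_ ?_
    · rw [Finset.sum_insert hσu]; omega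
    · rw [Finset.card_insert_of_notMem hσu, hc]; norm_num
  push Not at hcl
  obtain ⟨y, hy, L, hL, hLy⟩ := exists_exit h.stronglyConnected (B := A)
    (Finset.card_pos.1 (by omega)) (by omega)
  have hLb : ¬ Function.Bijective L := fun hb => hLy (hcl L hL hb y hy)
  obtain ⟨c, hcy⟩ := hadj hy
  have hN : ∀ t, t + 4 < 20 → ∀ w, (mergeGraph S t).Adj (L y) w → w = z ∨ w = L c := by
    intro t ht w hw
    rcases hF.nonperm hL hLb hw with h1 | ⟨u, rfl, hu⟩
    · exact Or.inl h1
    · rw [hcy hF (t + 1) (by omega) u hu]; exact Or.inr rfl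
  have hd2 : ∀ t, t + 4 < 20 → deg (mergeGraph S t) (L y) ≤ 2 := fun t ht =>
    (deg_le_card (A := {z, L c}) fun w hw => by simpa using hN t ht w hw).trans Finset.card_le_two
  by_cases hfix : ∃ σ ∈ S, Function.Bijective σ ∧ σ (L y) ≠ L y
  · obtain ⟨σ, hσ, hσb, hne⟩ := hfix
    have h1 : σ (L y) ∉ A := apply_notMem_of_closed hσb.1 (hcl σ hσ hσb) hLy
    have h2 : σ (L y) ∉ insert (L y) A := by simp [hne, h1]
    have h3 := hF.deg_perm (t := 10) hσ hσb (L y)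
    have h4 := hd2 11 (by norm_num)
    have h5 := hd2 10 (by norm_num)
    refine h.false_of_card_nine hn hF (A := insert (σ (L y)) (insert (L y) A)) (s := 7) ?_ ?_
    · rw [Finset.sum_insert h2, Finset.sum_insert hLy]; simp only [Nat.reduceAdd] at h3; omega
    · rw [Finset.card_insert_of_notMem h2, Finset.card_insert_of_notMem hLy, hc]; norm_num
  push Not at hfix
  by_cases hd1 : deg (mergeGraph S 10) (L y) ≤ 1
  · refine h.false_of_card_nine hn hF (A := insert (L y) A) (s := 4) ?_ ?_
    · rw [Finset.sum_insert hLy]; omega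
    · rw [Finset.card_insert_of_notMem hLy, hc]; norm_num
  have hz : (mergeGraph S 10).Adj (L y) z := by
    by_contra hno
    exact hd1 (deg_le_one_of (c := L c) fun w hw =>
      (hN 10 (by norm_num) w hw).resolve_left fun e => hno (e ▸ hw))
  have hLc : (mergeGraph S 10).Adj (L y) (L c) := by
    by_contra hno
    exact hd1 (deg_le_one_of (c := z) fun w hw =>
      (hN 10 (by norm_num) w hw).resolve_right fun e => hno (e ▸ hw))
  have hne : z ≠ L c := ((h.missing L hL hLb _).1 ⟨c, rfl⟩).symm
  -- Since `σ` fixes `L y`, its two neighbours at time 10 lift to neighbours at time 11, for which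
  -- `hN` allows the same two candidates.
  have hpair : ∀ σ ∈ S, Function.Bijective σ → s(σ z, σ (L c)) = s(z, L c) := by
    intro σ hσ hσb
    have hfx := hfix σ hσ hσb
    rw [← hfx] at hz hLc
    obtain ⟨u, hu, hu'⟩ := hF.adj_perm hσ hσb hz
    obtain ⟨v, hv, hv'⟩ := hF.adj_perm hσ hσb (x := L y) (y := L c) (by rwa [hfx] at hLc ⊢)
    rcases hN 11 (by norm_num) u hu' with rfl | rfl <;>
      rcases hN 11 (by norm_num) v hv' with rfl | rfl
    · exact absurd (hu.symm.trans hv) hne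
    · rw [hu, hv]
    · rw [hu, hv, Sym2.eq_swap]
    · exact absurd (hu.symm.trans hv) hne
  have hq : q ≠ L c := by
    intro hq
    rw [← hq] at hLc
    exact (h.missing L hL hLb _).1 ⟨y, rfl⟩ (h.adj_q hF (by norm_num) hLc.symm)
  have hF' := h.isFamily_sup hne hq hpair
  have hnum : 3 + 3 * (9 - A.card) < 2 * (10 + 1) := by rw [hc]; norm_num
  have h1 := hsum' hF'
  have h2 := h.false_of_card_nine hn hF' (A := A) (s := 3)
  exact h2 h1 hnum

/-- Three states in the orbit of `q` under the bijective letters. -/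
theorem MovesDup.false_of_three (h : MovesDup S T q z π) {ρ : V → V} (hρ : ρ ∈ S)
    (hρb : Function.Bijective ρ) {x : V} (hx : x ∈ ({π q, q} : Finset V))
    (hρx : ρ x ∉ ({π q, q} : Finset V))
    (hnT : Fintype.card V = 6 ∧ T = 11 ∨ Fintype.card V = 7 ∧ T = 14 ∨
      Fintype.card V = 8 ∧ T = 17 ∨ Fintype.card V = 9 ∧ T = 20 ∨ Fintype.card V = 10 ∧ T = 24 ∨
      Fintype.card V = 11 ∧ T = 28) : False := by
  have hF := h.isFamily
  have hc : (insert (ρ x) {π q, q} : Finset V).card = 3 := by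
    rw [Finset.card_insert_of_notMem hρx, h.card_pair]
  have hr := letter_reach h.reach_pair hx hρ
  have hsum := fun {t : ℕ} (ht : t + 3 < T) => h.sum_triple hρ hρb hx hρx hF ht
  obtain ⟨y, hy, L, hL, hLy, hc', hr'⟩ := exists_insert h.stronglyConnected hc (by omega) hr
  have hsum' : ∀ t, t + 4 < T →
      ∑ u ∈ insert (L y) (insert (ρ x) {π q, q} : Finset V), deg (mergeGraph S t) u ≤ 5 := by
    intro t ht
    rw [Finset.sum_insert hLy]
    obtain ⟨c, hcy⟩ := h.adj_triple hρ hρb hx hy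
    have h1 := hsum (t := t) (by omega)
    have h2 := hF.deg_letter (t := t) hL y
    have h3 := deg_le_one_of (hcy hF (t + 1) (by omega))
    omega
  rcases hnT with ⟨hn, rfl⟩ | ⟨hn, rfl⟩ | ⟨hn, rfl⟩ | ⟨hn, rfl⟩ | ⟨hn, rfl⟩ | ⟨hn, rfl⟩
  · exact h.edge_false hF (t := 7) hc (by omega) (hsum (by omega)) (by rw [hn]; decide)
  · exact h.edge_false hF (t := 10) hc (by omega) (hsum (by omega)) (by rw [hn]; decide)
  · exact h.edge_false hF (t := 12) hc' (by omega) (hsum' _ (by omega)) (by rw [hn]; decide)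
  · exact h.false_of_three_of_card_nine hρ hρb hx hρx hn
  · exact h.sum_false hF (t := 13) hc' hr' (by omega) (hsum' _ (by omega))
      (by rw [hn]; exact lpCap_sum_ten)
  · exact h.sum_false hF (t := 16) hc' hr' (by omega) (hsum' _ (by omega))
      (by rw [hn]; exact lpCap_sum_eleven)

end SameMiss

/-! ### Orbits of `q` with two states -/

theorem isoCap_sum : ∀ n ∈ Finset.Icc 9 11,
    1 + ∑ i ∈ Finset.range (n - (2 + 1)), isoCap n (floorTable n - 4) (2 + 2 + i) <
      2 * (floorTable n - n + 0) := by
  decide +kernel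

theorem lpCap_sum_dead_ten :
    4 + ∑ i ∈ Finset.range (10 - (2 + 1)), lpCap 10 24 1 (2 + 2 + i) < 2 * (13 + 1) := by
  decide +kernel

theorem lpCap_sum_dead_eleven :
    4 + ∑ i ∈ Finset.range (11 - (2 + 1)), lpCap 11 28 1 (2 + 2 + i) < 2 * (16 + 1) := by
  decide +kernel

theorem lpCap_eight_four : lpCap 8 17 1 4 = 2 := by decide +kernel

section OrbitTwo

variable {V : Type*} [Fintype V] [DecidableEq V]

/-- The orbit of `q` under the bijective letters is `{π q, q}`. -/
structure OrbitTwo (S : Set (V → V)) (T : ℕ) (q z : V) (π : V → V) : Prop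
    extends MovesDup S T q z π where
  closed : ∀ ρ ∈ S, Function.Bijective ρ → ∀ x ∈ ({π q, q} : Finset V), ρ x ∈ ({π q, q} : Finset V)

variable {S : Set (V → V)} {T e : ℕ} {q z : V} {π : V → V} {F : ℕ → SimpleGraph V}

theorem OrbitTwo.image_image (h : OrbitTwo S T q z π) : π (π q) = q := by
  have h1 := h.closed π h.mem h.bij (π q) (by simp)
  rcases Finset.mem_insert.1 h1 with h2 | h2
  · exact absurd (h.bij.1 h2) h.moves
  · exact Finset.mem_singleton.1 h2

theorem OrbitTwo.cases (h : OrbitTwo S T q z π) {ρ : V → V} (hρ : ρ ∈ S)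
    (hb : Function.Bijective ρ) : ρ q = q ∧ ρ (π q) = π q ∨ ρ q = π q ∧ ρ (π q) = q := by
  have h1 := h.closed ρ hρ hb q (by simp)
  have h2 := h.closed ρ hρ hb (π q) (by simp)
  simp only [Finset.mem_insert, Finset.mem_singleton] at h1 h2
  have hne : ρ q ≠ ρ (π q) := fun e => h.moves (hb.1 e).symm
  rcases h1 with h1 | h1 <;> rcases h2 with h2 | h2
  · exact absurd (h1.trans h2.symm) hne
  · exact Or.inr ⟨h1, h2⟩
  · exact Or.inl ⟨h1, h2⟩
  · exact absurd (h1.trans h2.symm) hne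

/-- If `q` can only be adjacent to its image under `π`, all degrees are at most one. -/
theorem OrbitTwo.deg_word_le_one (h : OrbitTwo S T q z π) (hz : z = π q) {l : ℕ} {f : V → V}
    (hf : IsWord S l f) : ∀ k x, 1 ≤ k → (∀ t, t + k < T → deg (mergeGraph S t) x ≤ 1) →
      ∀ t, t + (k + l) < T → deg (mergeGraph S t) (f x) ≤ 1 := by
  have hF := h.isFamily
  induction hf with
  | nil => intro k x _ hx t ht; exact hx t ht
  | @cons l L g hL _ ih =>
    intro k x hk hx t ht
    refine ih (k + 1) (L x) (by omega) (fun t ht => ?_) t (by omega)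
    by_cases hLx : L x ∈ ({π q, q} : Finset V)
    · exact h.deg_pair hF (by omega) hLx
    by_cases hb : Function.Bijective L
    · exact (hF.deg_perm hL hb x).trans (hx _ (by omega))
    have hsub : (mergeGraph S t).neighborSet (L x) ⊆
        L '' (mergeGraph S (t + 1)).neighborSet x := fun y hy => by
      rcases hF.nonperm hL hb hy with rfl | ⟨u, rfl, hu⟩
      · exfalso
        have hy' : (mergeGraph S t).Adj (π q) (L x) := hz ▸ hy.symm
        obtain ⟨u, hu, hu'⟩ := hF.adj_perm h.mem h.bij hy'
        have := h.adj_q hF (by omega) hu'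
        rw [this, hz, h.image_image] at hu
        exact hLx (by simp [← hu])
      · exact ⟨u, hu, rfl⟩
    exact (Set.ncard_le_ncard hsub (Set.toFinite _)).trans
      ((Set.ncard_image_le (Set.toFinite _)).trans (hx _ (by omega)))

/-- With all degrees at most one, there are at most `card V / 2` edges. -/
theorem OrbitTwo.false_of_eq (h : OrbitTwo S T q z π) (hz : z = π q)
    (hT : Fintype.card V < 2 * (T - 1 - Fintype.card V)) : False := by
  have hF := h.isFamily
  have hdeg : ∀ x, deg (mergeGraph S (T - 1 - Fintype.card V)) x ≤ 1 := by
    intro x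
    obtain ⟨s, hs, f, hf, y, hy, rfl⟩ := mem_reach_card (q := q) h.stronglyConnected x
    rw [Finset.mem_singleton.1 hy]
    have := Fintype.card_pos_iff.2 ⟨q⟩
    exact h.deg_word_le_one hz hf 1 q le_rfl (fun t ht => h.deg_q hF ht) _ (by omega)
  have h1 := Finset.sum_le_card_nsmul Finset.univ _ 1 fun x _ => hdeg x
  rw [sum_deg, Finset.card_univ] at h1
  have h2 := hF.growth (t := T - 1 - Fintype.card V) (by omega)
  simp at h1
  omega

/-- If the bijective letters do not act consistently on the neighbours of `q` and `π q`, these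
states are isolated. -/
theorem OrbitTwo.isolated (h : OrbitTwo S T q z π) {ρ : V → V} (hρ : ρ ∈ S)
    (hb : Function.Bijective ρ) (hne : s(ρ z, ρ (π z)) ≠ s(z, π z)) (hT : 5 ≤ T) :
    ∀ t, t + 5 ≤ T → ∀ x ∈ ({π q, q} : Finset V), deg (mergeGraph S t) x = 0 := by
  have hF := h.isFamily
  have nq : ∀ t, t + 1 < T → ∀ y, (mergeGraph S t).Adj q y → y = z :=
    fun t ht y hy => h.adj_q hF ht hy
  have np : ∀ t, t + 2 < T → ∀ y, (mergeGraph S t).Adj (π q) y → y = π z := by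
    intro t ht y hy
    obtain ⟨u, rfl, hu⟩ := hF.adj_perm h.mem h.bij hy
    rw [nq _ (by omega) u hu]
  -- one of the two states is isolated early
  have back : ∀ t, (∀ y, ¬ (mergeGraph S (t + 1)).Adj (π q) y) →
      ∀ y, ¬ (mergeGraph S t).Adj q y := by
    intro t ht y hy
    rw [← h.image_image] at hy
    obtain ⟨u, -, hu⟩ := hF.adj_perm h.mem h.bij hy
    exact ht u hu
  have forth : ∀ t, (∀ y, ¬ (mergeGraph S (t + 1)).Adj q y) →
      ∀ y, ¬ (mergeGraph S t).Adj (π q) y := by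
    intro t ht y hy
    obtain ⟨u, -, hu⟩ := hF.adj_perm h.mem h.bij hy
    exact ht u hu
  have mono : ∀ {s t : ℕ} {x : V}, s ≤ t → (∀ y, ¬ (mergeGraph S t).Adj x y) →
      ∀ y, ¬ (mergeGraph S s).Adj x y := fun hst hx y hy => hx y (mergeGraph_mono hst hy)
  -- If both states had neighbours, these would be `z` and `π z`; as `ρ` fixes or swaps `q` and `π
  -- q`, lifting the two edges along `ρ` would show that `ρ` preserves the pair `{z, π z}`.
  -- Isolation of one of the states then passes to the other at the cost of one time step.
  have key : (∀ y, ¬ (mergeGraph S (T - 4)).Adj q y) ∨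
      (∀ y, ¬ (mergeGraph S (T - 4)).Adj (π q) y) := by
    by_contra! hcon
    obtain ⟨⟨y1, hy1⟩, ⟨y2, hy2⟩⟩ := hcon
    obtain rfl := nq _ (by omega) _ hy1
    obtain rfl := np _ (by omega) _ hy2
    apply hne
    rcases h.cases hρ hb with ⟨e1, e2⟩ | ⟨e1, e2⟩
    · have hy1' : (mergeGraph S (T - 4)).Adj (ρ q) y1 := by rwa [e1]
      have hy2' : (mergeGraph S (T - 4)).Adj (ρ (π q)) (π y1) := by rwa [e2]
      obtain ⟨u, hu, hu'⟩ := hF.adj_perm hρ hb hy1'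
      obtain ⟨v, hv, hv'⟩ := hF.adj_perm hρ hb hy2'
      rw [nq _ (by omega) u hu'] at hu
      rw [np _ (by omega) v hv'] at hv
      rw [hu, hv]
    · have hy1' : (mergeGraph S (T - 4)).Adj (ρ (π q)) y1 := by rwa [e2]
      have hy2' : (mergeGraph S (T - 4)).Adj (ρ q) (π y1) := by rwa [e1]
      obtain ⟨u, hu, hu'⟩ := hF.adj_perm hρ hb hy1'
      obtain ⟨v, hv, hv'⟩ := hF.adj_perm hρ hb hy2'
      rw [np _ (by omega) u hu'] at hu
      rw [nq _ (by omega) v hv'] at hv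
      rw [hu, hv, Sym2.eq_swap]
  have e : T - 4 = T - 5 + 1 := by omega
  intro t ht x hx
  refine deg_eq_zero_of ?_
  rcases key with hk | hk
  · rcases Finset.mem_insert.1 hx with rfl | hx
    · exact mono (by omega) (forth (T - 5) (by rwa [e] at hk))
    · rw [Finset.mem_singleton.1 hx]; exact mono (by omega) hk
  · rcases Finset.mem_insert.1 hx with rfl | hx
    · exact mono (by omega) hk
    · rw [Finset.mem_singleton.1 hx]; exact mono (by omega) (back (T - 5) (by rwa [e] at hk))

/-- Both orbit states have degree zero by `OrbitTwo.isolated`, so the next state reached has degree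
at most one. -/
theorem OrbitTwo.false_of_inconsistent (h : OrbitTwo S T q z π) {ρ : V → V} (hρ : ρ ∈ S)
    (hb : Function.Bijective ρ) (hne : s(ρ z, ρ (π z)) ≠ s(z, π z))
    (hnT : Fintype.card V = 6 ∧ T = 11 ∨ Fintype.card V = 7 ∧ T = 14 ∨
      Fintype.card V = 8 ∧ T = 17 ∨ Fintype.card V ∈ Finset.Icc 9 11 ∧
        T = floorTable (Fintype.card V) + 1) : False := by
  have hF := h.isFamily
  have h5 : 5 ≤ T := by
    rcases hnT with hT | hT | hT | hT
    · omega
    · omega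
    · omega
    · have : ∀ n ∈ Finset.Icc 9 11, 5 ≤ floorTable n + 1 := by decide
      have := this _ hT.1
      omega
  have hzero := h.isolated hρ hb hne h5
  obtain ⟨x, hx, L, hL, hLx, hc, hr⟩ := exists_insert h.stronglyConnected h.card_pair (by
    rcases hnT with hT | hT | hT | hT
    · omega
    · omega
    · omega
    · have := (Finset.mem_Icc.1 hT.1).1; omega) h.reach_pair
  have hsum : ∀ t, t + 6 ≤ T → ∑ y ∈ insert (L x) {π q, q}, deg (mergeGraph S t) y ≤ 1 := by
    intro t ht
    rw [Finset.sum_insert hLx, Finset.sum_eq_zero (hzero t (by omega))]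
    have h1 := hF.deg_letter (t := t) hL x
    rw [hzero (t + 1) (by omega) x hx] at h1
    exact h1
  rcases hnT with ⟨hn, rfl⟩ | ⟨hn, rfl⟩ | ⟨hn, rfl⟩ | ⟨hn, hT⟩
  · exact h.edge_false hF (t := 5) hc (by omega) (hsum _ (by omega)) (by rw [hn]; decide)
  · exact h.edge_false hF (t := 8) hc (by omega) (hsum _ (by omega)) (by rw [hn]; decide)
  · obtain ⟨y, hy, L', hL', hLy, hc', hr'⟩ := exists_insert h.stronglyConnected hc
      (by omega) hr
    have h1 := hF.deg_letter (t := 10) hL' y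
    have h2 : deg (mergeGraph S (10 + 1)) y ≤ 1 :=
      (Finset.single_le_sum (f := fun y => deg (mergeGraph S 11) y)
        (fun _ _ => Nat.zero_le _) hy).trans (hsum 11 (by omega))
    have h3 : ∑ y ∈ insert (L' y) (insert (L x) {π q, q}), deg (mergeGraph S 10) y ≤ 3 := by
      rw [Finset.sum_insert hLy]
      have := hsum 10 (by omega)
      omega
    exact h.edge_false hF (t := 10) hc' (by omega) h3 (by rw [hn]; decide)
  · obtain ⟨a, ha, hab⟩ := h.exists_nonperm
    have hlt : ∀ n ∈ Finset.Icc 9 11, n < floorTable n - 4 := by decide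
    have hlt := hlt _ hn
    have hq : ∀ y, ¬ (mergeGraph S (floorTable (Fintype.card V) - 4)).Adj q y :=
      not_adj_of_deg_eq_zero (hzero _ (by omega) q (by simp))
    have hcap := defect_le_isoCap h.three_le h.tripleFree h.synchronizing h.defect_le
      (by omega) hq
    have h1 := hF.sum_count h.stronglyConnected ha (h.mem_dups a ha hab) hc hr hcap
      (t := floorTable (Fintype.card V) - Fintype.card V) (by omega)
    have h2 := isoCap_sum _ hn
    have h3 : 3 ≤ Fintype.card V := h.three_le
    have h4 := hsum (floorTable (Fintype.card V) - Fintype.card V) (by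
      have := (Finset.mem_Icc.1 hn).1; omega)
    simp only [Nat.reduceAdd] at h1 h2
    omega

theorem OrbitTwo.ne_image (h : OrbitTwo S T q z π)
    (hcon : ∀ ρ ∈ S, Function.Bijective ρ → s(ρ z, ρ (π z)) = s(z, π z)) : z ≠ π z := by
  intro e
  obtain ⟨σ, hσ, hσb, hne⟩ := h.exists_moves
  have := hcon σ hσ hσb
  rw [← e] at this
  rcases Sym2.eq_iff.1 this with h1 | h1
  · exact hne h1.1
  · exact hne h1.1

theorem adj_mem_of_deg_le {G : SimpleGraph V} {x : V} {B : Finset V} (hB : ∀ y ∈ B, G.Adj x y)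
    (hd : deg G x ≤ B.card) {y : V} (hy : G.Adj x y) : y ∈ B := by
  have h1 : (B : Set V) = G.neighborSet x :=
    Set.eq_of_subset_of_ncard_le (fun y hy => hB y hy) (by rwa [Set.ncard_coe_finset])
      (Set.toFinite _)
  have : y ∈ (B : Set V) := by rw [h1]; exact hy
  exact this

theorem deg_le_two_of {G : SimpleGraph V} {x c d : V} (h : ∀ y, G.Adj x y → y = c ∨ y = d) :
    deg G x ≤ 2 :=
  (deg_le_card (A := {c, d}) fun y hy => by simpa using h y hy).trans Finset.card_le_two

/-- With the dead edge the degree sum at time 10 is at least 22. The bounds one for `q` and `π q`,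
two for the next state `v` and three for the other six states add up to exactly 22, so all of them
are attained. This determines the neighbourhoods: `v` is adjacent to `z` and `π z`, while `z` has
neighbours `q`, `v`, `π z` and `π z` has neighbours `π q`, `v`, `z`. A letter leaving these five
states would lead to another state of degree at most two. -/
theorem OrbitTwo.false_of_consistent_of_card_nine (h : OrbitTwo S 20 q z π) (hz : z ≠ π q)
    (hcon : ∀ ρ ∈ S, Function.Bijective ρ → s(ρ z, ρ (π z)) = s(z, π z))
    (hn : Fintype.card V = 9) (hF : IsFamily S 20 1 (fun _ => z) F)
    (hzw : ∀ t, (F t).Adj z (π z)) : False := by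
  have hππ : π (π z) = z := by
    rcases Sym2.eq_iff.1 (hcon π h.mem h.bij) with h1 | h1
    · exact absurd h1.1.symm (h.ne_image hcon)
    · exact h1.2
  obtain ⟨x, hx, L, hL, hLx⟩ := exists_exit h.stronglyConnected (B := {π q, q})
    ⟨q, by simp⟩ (by rw [h.card_pair]; omega)
  have hLb : ¬ Function.Bijective L := fun hb => hLx (h.closed L hL hb x hx)
  have hvz : L x ≠ z := (h.missing L hL hLb _).1 ⟨x, rfl⟩
  have hreach : L x ∈ reach S {q} 2 := reach_succ (h.reach_pair x hx) hL
  have hN : ∃ c, ∀ t, t + 3 < 20 → ∀ y, (F t).Adj (L x) y → y = z ∨ y = c := by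
    obtain ⟨c, hc⟩ := h.adj_pair hx
    refine ⟨L c, fun t ht y hy => ?_⟩
    rcases hF.nonperm hL hLb hy with h1 | ⟨u, rfl, hu⟩
    · exact Or.inl h1
    · rw [hc hF (t + 1) (by omega) u hu]; exact Or.inr rfl
  clear hLb hL hx
  generalize L x = v at *
  clear L x
  obtain ⟨c, hN⟩ := hN
  have hcard : (insert v {π q, q} : Finset V).card = 3 := by
    rw [Finset.card_insert_of_notMem hLx, h.card_pair]
  have hd2 : ∀ t, t + 3 < 20 → deg (F t) v ≤ 2 := fun t ht => deg_le_two_of (hN t ht)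
  have hpair := fun {x : V} => h.deg_pair hF (t := 10) (by norm_num) (x := x)
  -- the degrees at time 10 have to be as large as possible
  have key : ∀ u, u ∉ (insert v {π q, q} : Finset V) → deg (F 10) u ≤ 2 → False := by
    intro u hu hdu
    have h1 : ∑ y ∈ insert u (insert v {π q, q} : Finset V), deg (F 10) y ≤ 6 := by
      rw [Finset.sum_insert hu, Finset.sum_insert hLx]
      have := h.sum_pair hF (t := 10) (by norm_num)
      have := hd2 10 (by norm_num)
      omega
    exact h.false_of_card_nine hn hF h1 (by
      rw [Finset.card_insert_of_notMem hu, hcard]; norm_num)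
  have full : 3 < ∑ y ∈ (insert v {π q, q} : Finset V), deg (F 10) y := by
    by_contra! hle
    exact h.false_of_card_nine hn hF hle (by rw [hcard]; norm_num)
  rw [Finset.sum_insert hLx, Finset.sum_pair h.moves] at full
  have f1 := hpair (x := q) (by simp)
  have f2 := hpair (x := π q) (by simp)
  have f3 := hd2 10 (by norm_num)
  have aq : (F 10).Adj q z := by
    by_contra hno
    have : deg (F 10) q = 0 := deg_eq_zero_of fun y hy =>
      hno (h.adj_q hF (t := 10) (by norm_num) hy ▸ hy)
    omega
  have Np : ∀ t, t + 2 < 20 → ∀ y, (F t).Adj (π q) y → y = π z := by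
    intro t ht y hy
    obtain ⟨u, rfl, hu⟩ := hF.adj_perm h.mem h.bij hy
    rw [h.adj_q hF (by omega) hu]
  have ap : (F 10).Adj (π q) (π z) := by
    by_contra hno
    have : deg (F 10) (π q) = 0 := deg_eq_zero_of fun y hy =>
      hno (Np 10 (by norm_num) y hy ▸ hy)
    omega
  have az : (F 10).Adj v z := by
    by_contra hno
    have : deg (F 10) v ≤ 1 := deg_le_one_of (c := c) fun y hy =>
      (hN 10 (by norm_num) y hy).resolve_left fun e => hno (e ▸ hy)
    omega
  have ac : (F 10).Adj v c := by
    by_contra hno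
    have : deg (F 10) v ≤ 1 := deg_le_one_of (c := z) fun y hy =>
      (hN 10 (by norm_num) y hy).resolve_right fun e => hno (e ▸ hy)
    omega
  have fix : ∀ σ ∈ S, Function.Bijective σ → σ v = v := by
    intro σ hσ hσb
    by_contra hne
    have h1 := apply_notMem_of_closed hσb.1 (h.closed σ hσ hσb) hLx
    exact key (σ v) (by simp only [Finset.mem_insert] at h1 ⊢; tauto)
      ((hF.deg_perm hσ hσb v).trans (hd2 11 (by norm_num)))
  -- As `π` fixes `v`, the edge `v z` lifts along `π` to an edge from `v` to the preimage of `z`.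
  -- This preimage is not `z`, so it is `c`.
  have hcw : c = π z := by
    have az' : (F 10).Adj (π v) z := by rwa [fix π h.mem h.bij]
    obtain ⟨u, hu, hu'⟩ := hF.adj_perm h.mem h.bij az'
    rcases hN 11 (by norm_num) u hu' with rfl | rfl
    · exact absurd hu.symm (h.ne_image hcon)
    · exact h.bij.1 (hu.trans hππ.symm)
  subst hcw
  have hvw : v ≠ π z := fun e => hvz (h.bij.1 (by rw [fix π h.mem h.bij]; exact e))
  have hqw : q ≠ π z := fun e => hz (h.bij.1 (by rw [h.image_image]; exact e.symm))
  have hqv : q ≠ v := fun e => hLx (by simp [e])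
  have hpv : π q ≠ v := fun e => hLx (by simp [e])
  have mono : ∀ {t x y}, 10 ≤ t → (F 10).Adj x y → (F t).Adj x y := fun ht hxy =>
    hF.mono_le ht hxy
  have Nz : ∀ t, 10 ≤ t → deg (F t) z ≤ 3 → ∀ y, (F t).Adj z y → y = q ∨ y = v ∨ y = π z := by
    intro t ht hd y hy
    have := adj_mem_of_deg_le (B := {q, v, π z}) (by
      intro y hy
      simp only [Finset.mem_insert, Finset.mem_singleton] at hy
      rcases hy with rfl | rfl | rfl
      · exact mono ht aq.symm
      · exact mono ht az.symm
      · exact hzw t) (by rw [Finset.card_eq_three.2 ⟨q, v, π z, hqv, hqw, hvw, rfl⟩]; exact hd) hy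
    simpa using this
  have Nw : ∀ t, 10 ≤ t → deg (F t) (π z) ≤ 3 → ∀ y, (F t).Adj (π z) y →
      y = π q ∨ y = v ∨ y = z := by
    intro t ht hd y hy
    have := adj_mem_of_deg_le (B := {π q, v, z}) (by
      intro y hy
      simp only [Finset.mem_insert, Finset.mem_singleton] at hy
      rcases hy with rfl | rfl | rfl
      · exact mono ht ap.symm
      · exact mono ht ac.symm
      · exact (hzw t).symm) (by
        rw [Finset.card_eq_three.2 ⟨π q, v, z, hpv, hz.symm, hvz, rfl⟩]; exact hd) hy
    simpa using this
  have d10 : ∀ x, deg (F 10) x ≤ 3 := fun x =>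
    deg_le_three_of_card_nine h.toSameMiss hn hF (k := 8) le_rfl (by norm_num)
      (by have := mem_reach_card (q := q) h.stronglyConnected x; rwa [hn] at this)
  have Nz10 := Nz 10 le_rfl (d10 z)
  have Nw10 := Nw 10 le_rfl (d10 (π z))
  -- the image of `v` under a letter that is not bijective
  have imv : ∀ L ∈ S, ¬ Function.Bijective L → L v ∉ (insert v {π q, q} : Finset V) →
      L v = π z := by
    intro L hL hLb hLv
    by_contra hne
    refine key (L v) hLv (deg_le_two_of (c := L z) (d := L (π z)) fun y hy => ?_)
    rcases hF.nonperm hL hLb hy with rfl | ⟨u, rfl, hu⟩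
    · rcases Nz10 _ hy.symm with h1 | h1 | h1
      · exact absurd (by simp [h1]) hLv
      · exact absurd (by simp [h1]) hLv
      · exact absurd h1 hne
    · rcases hN 11 (by norm_num) u hu with rfl | rfl <;> simp
  have impair : ∀ L ∈ S, ∀ x ∈ ({π q, q} : Finset V), L x ∈ (insert v {π q, q} : Finset V) := by
    intro L hL x hx
    by_contra hno
    have h1 := hF.deg_letter (t := 10) hL x
    have h2 := h.deg_pair hF (t := 10 + 1) (by norm_num) hx
    exact key _ hno (by omega)
  -- At time 11 the degree bound three is only available for states reached by at most seven
  -- letters, so `z` and `π z` have to be reached early.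
  have hwr : π z ∈ reach S {q} 3 := by
    obtain ⟨x, hx, L, hL, hLx'⟩ := exists_exit h.stronglyConnected (B := insert v {π q, q})
      ⟨v, by simp⟩ (by rw [hcard]; omega)
    rcases Finset.mem_insert.1 hx with rfl | hx
    · have hLb : ¬ Function.Bijective L := fun hb => by
        rw [fix L hL hb] at hLx'
        exact hLx' (by simp)
      rw [← imv L hL hLb hLx']
      exact reach_succ hreach hL
    · exact absurd (impair L hL x hx) hLx'
  have hzr : z ∈ reach S {q} 4 := by
    have := reach_succ hwr h.mem
    rwa [hππ] at this
  have Nz11 := Nz 11 (by norm_num)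
    (deg_le_three_of_card_nine h.toSameMiss hn hF (k := 4) (by norm_num) (by norm_num) hzr)
  have Nw11 := Nw 11 (by norm_num)
    (deg_le_three_of_card_nine h.toSameMiss hn hF (k := 3) (by norm_num) (by norm_num) hwr)
  have hC : (insert z (insert (π z) (insert v {π q, q})) : Finset V).card < Fintype.card V := by
    have h1 := Finset.card_insert_le z (insert (π z) (insert v {π q, q}))
    have h2 := Finset.card_insert_le (π z) (insert v {π q, q})
    omega
  obtain ⟨x, hx, L, hL, hLx'⟩ := exists_exit h.stronglyConnected ⟨z, Finset.mem_insert_self _ _⟩ hC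
  simp only [Finset.mem_insert, not_or] at hLx'
  obtain ⟨n1, n2, n3, n4⟩ := hLx'
  have hLx3 : L x ∉ (insert v {π q, q} : Finset V) := by simp only [Finset.mem_insert]; tauto
  have hlast : ∀ a, a ∈ ({π q, q} : Finset V) → ¬ (F 10).Adj (L x) (L a) := by
    intro a ha hadj
    rcases Finset.mem_insert.1 (impair L hL a ha) with h1 | h1
    · rw [h1] at hadj
      rcases hN 10 (by norm_num) _ hadj.symm with h2 | h2
      · exact n1 h2
      · exact n2 h2
    · rcases Finset.mem_insert.1 h1 with h1 | h1
      · rw [h1] at hadj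
        exact n2 (Np 10 (by norm_num) _ hadj.symm)
      · rw [Finset.mem_singleton.1 h1] at hadj
        exact n1 (h.adj_q hF (by norm_num) hadj.symm)
  have hzadj : ¬ (F 10).Adj (L x) z := by
    intro hadj
    rcases Nz10 _ hadj.symm with h1 | h1 | h1
    · exact hLx3 (by simp [h1])
    · exact hLx3 (by simp [h1])
    · exact n2 h1
  rcases Finset.mem_insert.1 hx with rfl | hx
  · have hLb : ¬ Function.Bijective L := fun hb => by
      rcases Sym2.eq_iff.1 (hcon L hL hb) with h1 | h1
      · exact n1 h1.1
      · exact n2 h1.1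
    refine key _ hLx3 (deg_le_two_of (c := L v) (d := L (π x)) fun y hy => ?_)
    rcases hF.nonperm hL hLb hy with rfl | ⟨u, rfl, hu⟩
    · exact absurd hy hzadj
    · rcases Nz11 u hu with rfl | rfl | rfl
      · exact absurd hy (hlast _ (by simp))
      · exact Or.inl rfl
      · exact Or.inr rfl
  rcases Finset.mem_insert.1 hx with rfl | hx
  · have hLb : ¬ Function.Bijective L := fun hb => by
      rcases Sym2.eq_iff.1 (hcon L hL hb) with h1 | h1
      · exact n2 h1.2
      · exact n1 h1.2
    refine key _ hLx3 (deg_le_two_of (c := L v) (d := L z) fun y hy => ?_)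
    rcases hF.nonperm hL hLb hy with rfl | ⟨u, rfl, hu⟩
    · exact absurd hy hzadj
    · rcases Nw11 u hu with rfl | rfl | rfl
      · exact absurd hy (hlast _ (by simp))
      · exact Or.inl rfl
      · exact Or.inr rfl
  rcases Finset.mem_insert.1 hx with rfl | hx
  · have hLb : ¬ Function.Bijective L := fun hb => by
      rw [fix L hL hb] at hLx3
      exact hLx3 (by simp)
    exact n2 (imv L hL hLb hLx3)
  · exact hLx3 (impair L hL x hx)

/-- The bijective letters preserve `{z, π z}`, so this pair is dead and joins the edge count with
surplus one. -/
theorem OrbitTwo.false_of_consistent (h : OrbitTwo S T q z π) (hz : z ≠ π q)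
    (hcon : ∀ ρ ∈ S, Function.Bijective ρ → s(ρ z, ρ (π z)) = s(z, π z))
    (hnT : Fintype.card V = 6 ∧ T = 11 ∨ Fintype.card V = 7 ∧ T = 14 ∨
      Fintype.card V = 8 ∧ T = 17 ∨ Fintype.card V = 9 ∧ T = 20 ∨ Fintype.card V = 10 ∧ T = 24 ∨
      Fintype.card V = 11 ∧ T = 28) : False := by
  have hzw := h.ne_image hcon
  have hqw : q ≠ π z := fun e => hz (h.bij.1 (by rw [h.image_image]; exact e.symm))
  have hF := h.isFamily_sup hzw hqw hcon
  have hadj : ∀ t, (mergeGraph S t ⊔ singleEdge z (π z)).Adj z (π z) :=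
    fun t => Or.inr (singleEdge_adj.2 ⟨rfl, hzw⟩)
  have hFadj : ∀ t, ((fun t => mergeGraph S t ⊔ singleEdge z (π z)) t).Adj z (π z) := hadj
  clear hadj
  generalize (fun t => mergeGraph S t ⊔ singleEdge z (π z)) = F at hF hFadj
  obtain ⟨x, hx, L, hL, hLx, hc, hr⟩ := exists_insert h.stronglyConnected h.card_pair (by omega)
    h.reach_pair
  have hsum : ∀ t, t + 3 < T → ∑ y ∈ insert (L x) {π q, q}, deg (F t) y ≤ 4 := by
    intro t ht
    rw [Finset.sum_insert hLx]
    have h1 := h.sum_pair hF (t := t) (by omega)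
    have h2 := hF.deg_letter (t := t) hL x
    have h3 := h.deg_pair hF (t := t + 1) (by omega) hx
    omega
  rcases hnT with ⟨hn, rfl⟩ | ⟨hn, rfl⟩ | ⟨hn, rfl⟩ | ⟨hn, rfl⟩ | ⟨hn, rfl⟩ | ⟨hn, rfl⟩
  · exact h.edge_false hF (t := 8) h.card_pair (by omega) (h.sum_pair hF (by omega))
      (by rw [hn]; decide)
  · exact h.edge_false hF (t := 10) hc (by omega) (hsum _ (by omega)) (by rw [hn]; decide)
  · obtain ⟨y, hy, L', hL', hLy, hc', hr'⟩ := exists_insert h.stronglyConnected hc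
      (by omega) hr
    have h1 := h.deg_reach hF (t := 12) (k := 3) (by omega) (hr' _ (Finset.mem_insert_self _ _))
    rw [hn, lpCap_eight_four] at h1
    have h3 : ∑ y ∈ insert (L' y) (insert (L x) {π q, q}), deg (F 12) y ≤ 6 := by
      rw [Finset.sum_insert hLy]
      have := hsum 12 (by omega)
      omega
    exact h.edge_false hF (t := 12) hc' (by omega) h3 (by rw [hn]; decide)
  · exact h.false_of_consistent_of_card_nine hz hcon hn hF hFadj
  · exact h.sum_false hF (t := 13) hc hr (by omega) (hsum _ (by omega))
      (by rw [hn]; exact lpCap_sum_dead_ten)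
  · exact h.sum_false hF (t := 16) hc hr (by omega) (hsum _ (by omega))
      (by rw [hn]; exact lpCap_sum_dead_eleven)

end OrbitTwo

/-! ### Six to thirteen states: bijective letters fixing `q`, and the case distinction -/

section SixOrMore

variable {V : Type*} [Fintype V] [DecidableEq V] {S : Set (V → V)} {T : ℕ} {q z : V} {π : V → V}

/-- Lifting the edge `q z` along a bijective letter that fixes `q` but moves `z` would give `q` a
second neighbour one step later. -/
theorem SameMiss.isolated_of_fixed (h : SameMiss S T q z)
    (hfix : ∀ σ ∈ S, Function.Bijective σ → σ q = q) {t : ℕ} (ht : t + 2 < T) (y : V) :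
    ¬ (mergeGraph S t).Adj q y := by
  intro hy
  have hF := h.isFamily
  obtain ⟨σ, hσ, hσb, hne⟩ := h.exists_moves
  have h1 := h.adj_q hF (by omega) hy
  rw [← hfix σ hσ hσb] at hy
  obtain ⟨u, hu, hu'⟩ := hF.adj_perm hσ hσb hy
  rw [h.adj_q hF (by omega) hu'] at hu
  exact hne (hu.trans h1)

/-- The first exit from `{q}`, if the bijective letters fix `q`. -/
theorem SameMiss.exists_exit_of_fixed (h : SameMiss S T q z)
    (hfix : ∀ σ ∈ S, Function.Bijective σ → σ q = q) :
    ∃ L ∈ S, ¬ Function.Bijective L ∧ L q ≠ q := by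
  obtain ⟨x, hx, L, hL, hLx⟩ := exists_exit h.stronglyConnected (B := {q})
    ⟨q, Finset.mem_singleton_self q⟩ (by have := h.three_le; simp; omega)
  rw [Finset.mem_singleton.1 hx, Finset.mem_singleton] at hLx
  exact ⟨L, hL, fun hb => hLx (hfix L hL hb), hLx⟩

theorem SameMiss.adj_exit_of_fixed (h : SameMiss S T q z)
    (hfix : ∀ σ ∈ S, Function.Bijective σ → σ q = q) {L : V → V} (hL : L ∈ S)
    (hLb : ¬ Function.Bijective L) {t : ℕ} (ht : t + 3 < T) {y : V}
    (hy : (mergeGraph S t).Adj (L q) y) : y = z := by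
  rcases h.isFamily.nonperm hL hLb hy with h1 | ⟨u, -, hu⟩
  · exact h1
  · exact absurd hu (h.isolated_of_fixed hfix (by omega) u)

/-- Three states with degree sum at most two allow only five edges at time 6. They are `q`, its
image `L q` and a third one: if a bijective letter moves `L q`, its image; otherwise `L q` is
isolated like `q`, and any next state works. -/
theorem SameMiss.false_of_fixed_of_card_six (h : SameMiss S 11 q z) (hn : Fintype.card V = 6)
    (hfix : ∀ σ ∈ S, Function.Bijective σ → σ q = q) : False := by
  have hF := h.isFamily
  obtain ⟨L, hL, hLb, hLq⟩ := h.exists_exit_of_fixed hfix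
  have hd0 : ∀ t, t + 2 < 11 → deg (mergeGraph S t) q = 0 := fun t ht =>
    deg_eq_zero_of (h.isolated_of_fixed hfix ht)
  have hd1 : ∀ t, t + 3 < 11 → deg (mergeGraph S t) (L q) ≤ 1 := fun t ht =>
    deg_le_one_of fun y hy => h.adj_exit_of_fixed hfix hL hLb ht hy
  have hLq' : L q ∉ ({q} : Finset V) := by simpa using hLq
  have hc : ({L q, q} : Finset V).card = 2 := Finset.card_pair hLq
  by_cases hm : ∃ σ ∈ S, Function.Bijective σ ∧ σ (L q) ≠ L q
  · obtain ⟨σ, hσ, hσb, hne⟩ := hm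
    have h1 : σ (L q) ∉ ({L q, q} : Finset V) := by
      simp only [Finset.mem_insert, Finset.mem_singleton, not_or]
      refine ⟨hne, fun e => hLq (hσb.1 ?_)⟩
      rw [e, hfix σ hσ hσb]
    have h2 : ∑ y ∈ insert (σ (L q)) {L q, q}, deg (mergeGraph S 6) y ≤ 2 := by
      rw [Finset.sum_insert h1, Finset.sum_pair hLq, hd0 6 (by norm_num)]
      have h3 := hd1 6 (by norm_num)
      have h4 := (hF.deg_perm (t := 6) hσ hσb (L q)).trans (hd1 7 (by norm_num))
      omega
    exact h.edge_false hF (t := 6) (m := 3) (by rw [Finset.card_insert_of_notMem h1, hc])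
      (by norm_num) h2 (by rw [hn]; decide)
  · push Not at hm
    have hd2 : deg (mergeGraph S 6) (L q) = 0 := deg_eq_zero_of fun y hy => by
      obtain ⟨σ, hσ, hσb, hne⟩ := h.exists_moves
      have h1 := h.adj_exit_of_fixed hfix hL hLb (by norm_num) hy
      rw [← hm σ hσ hσb] at hy
      obtain ⟨u, hu, hu'⟩ := hF.adj_perm hσ hσb hy
      rw [h.adj_exit_of_fixed hfix hL hLb (by norm_num) hu'] at hu
      exact hne (hu.trans h1)
    obtain ⟨x, hx, L', hL', hLx⟩ := exists_exit h.stronglyConnected (B := {L q, q})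
      ⟨q, by simp⟩ (by omega)
    have h2 : ∑ y ∈ insert (L' x) {L q, q}, deg (mergeGraph S 6) y ≤ 2 := by
      rw [Finset.sum_insert hLx, Finset.sum_pair hLq, hd0 6 (by norm_num), hd2]
      have h3 := hF.deg_letter (t := 6) hL' x
      have h4 : deg (mergeGraph S (6 + 1)) x ≤ 1 := by
        rcases Finset.mem_insert.1 hx with rfl | hx
        · exact hd1 7 (by norm_num)
        · rw [Finset.mem_singleton.1 hx, hd0 7 (by norm_num)]; exact Nat.zero_le 1
      omega
    exact h.edge_false hF (t := 6) (m := 3) (by rw [Finset.card_insert_of_notMem hLx, hc])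
      (by norm_num) h2 (by rw [hn]; decide)

theorem MovesDup.false_of_six_le (h : MovesDup S T q z π) (h6 : 6 ≤ Fintype.card V)
    (h14 : Fintype.card V < 14) (hT : T = floorTable (Fintype.card V) + 1) : False := by
  have hnT : (Fintype.card V = 12 ∧ T = 33 ∨ Fintype.card V = 13 ∧ T = 37) ∨
      (Fintype.card V = 6 ∧ T = 11 ∨ Fintype.card V = 7 ∧ T = 14 ∨
      Fintype.card V = 8 ∧ T = 17 ∨ Fintype.card V = 9 ∧ T = 20 ∨ Fintype.card V = 10 ∧ T = 24 ∨
      Fintype.card V = 11 ∧ T = 28) := by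
    subst hT
    generalize Fintype.card V = n at *
    interval_cases n <;> decide
  rcases hnT with hnT | hnT
  · exact h.false_of_large hnT
  by_cases hcl : ∃ ρ ∈ S, Function.Bijective ρ ∧ ∃ x ∈ ({π q, q} : Finset V),
      ρ x ∉ ({π q, q} : Finset V)
  · obtain ⟨ρ, hρ, hb, x, hx, hρx⟩ := hcl
    exact h.false_of_three hρ hb hx hρx hnT
  push Not at hcl
  have h2 : OrbitTwo S T q z π := ⟨h, hcl⟩
  by_cases hz : z = π q
  · exact h2.false_of_eq hz (by omega)
  by_cases hcon : ∀ ρ ∈ S, Function.Bijective ρ → s(ρ z, ρ (π z)) = s(z, π z)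
  · exact h2.false_of_consistent hz hcon hnT
  · push Not at hcon
    obtain ⟨ρ, hρ, hb, hne⟩ := hcon
    refine h2.false_of_inconsistent hρ hb hne ?_
    rcases hnT with hn | hn | hn | hn | hn | hn
    · exact Or.inl hn
    · exact Or.inr (Or.inl hn)
    · exact Or.inr (Or.inr (Or.inl hn))
    all_goals
      refine Or.inr (Or.inr (Or.inr ⟨?_, hT⟩))
      rw [hn.1]
      decide

theorem SameMiss.false_of_six_le (h : SameMiss S T q z) (h6 : 6 ≤ Fintype.card V)
    (h14 : Fintype.card V < 14) (hT : T = floorTable (Fintype.card V) + 1) : False := by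
  by_cases hfix : ∀ σ ∈ S, Function.Bijective σ → σ q = q
  · by_cases hn : Fintype.card V = 6
    · have : T = 11 := by rw [hT, hn]; decide
      subst this
      exact h.false_of_fixed_of_card_six hn hfix
    · subst hT
      refine isolated_false h.toSameDup h6 h14 h.tripleFree h.stronglyConnected
        h.synchronizing fun x => ?_
      rw [if_neg hn]
      refine h.isolated_of_fixed hfix ?_ x
      have : ∀ n ∈ Finset.Ico 6 14, 2 ≤ floorTable n := by decide
      have := this _ (Finset.mem_Ico.2 ⟨h6, h14⟩)
      omega
  · push Not at hfix
    obtain ⟨π, hπ, hb, hne⟩ := hfix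
    exact MovesDup.false_of_six_le (π := π) ⟨h, hπ, hb, hne⟩ h6 h14 hT

end SixOrMore

/-! ### Four and five states with `q` fixed by the bijective letters -/

section FourFive

variable {V : Type*} [Fintype V] [DecidableEq V] {S : Set (V → V)} {T : ℕ} {q z : V} {π : V → V}

open scoped Classical in
-- Once the possible edges are listed, the growth in each step turns into arithmetic with
-- indicators.
theorem numEdges_eq_sum {G : SimpleGraph V} {E : Finset (Sym2 V)}
    (h : ∀ x y, G.Adj x y → s(x, y) ∈ E) :
    numEdges G = ∑ e ∈ E, if e ∈ G.edgeSet then 1 else 0 := by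
  have h1 : G.edgeSet = (E.filter fun e => e ∈ G.edgeSet : Finset (Sym2 V)) := by
    ext e
    induction e with
    | h x y => simpa using fun hxy => h x y hxy
  have h2 : numEdges G = (E.filter fun e => e ∈ G.edgeSet).card := by
    rw [← Set.ncard_coe_finset, ← h1, numEdges]
  rw [h2, Finset.card_filter]

theorem numEdges_le_card {G : SimpleGraph V} {E : Finset (Sym2 V)}
    (h : ∀ x y, G.Adj x y → s(x, y) ∈ E) : numEdges G ≤ E.card := by
  rw [numEdges_eq_sum h, Finset.card_eq_sum_ones]
  exact Finset.sum_le_sum fun _ _ => by split_ifs <;> simp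

theorem exists_rest_one {A : Finset V} (h : Fintype.card V = A.card + 1) :
    ∃ b, b ∉ A ∧ ∀ x, x ∈ A ∨ x = b := by
  have : Aᶜ.card = 1 := by rw [Finset.card_compl]; omega
  obtain ⟨b, hb⟩ := Finset.card_eq_one.1 this
  refine ⟨b, Finset.mem_compl.1 (by simp [hb]), fun x => ?_⟩
  by_cases hx : x ∈ A
  · exact Or.inl hx
  · rw [← Finset.mem_compl, hb, Finset.mem_singleton] at hx
    exact Or.inr hx

theorem exists_rest_two {A : Finset V} (h : Fintype.card V = A.card + 2) :
    ∃ b c, b ∉ A ∧ c ∉ A ∧ b ≠ c ∧ ∀ x, x ∈ A ∨ x = b ∨ x = c := by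
  have : Aᶜ.card = 2 := by rw [Finset.card_compl]; omega
  obtain ⟨b, c, hbc, hb⟩ := Finset.card_eq_two.1 this
  refine ⟨b, c, Finset.mem_compl.1 (by simp [hb]), Finset.mem_compl.1 (by simp [hb]), hbc,
    fun x => ?_⟩
  by_cases hx : x ∈ A
  · exact Or.inl hx
  · rw [← Finset.mem_compl, hb, Finset.mem_insert, Finset.mem_singleton] at hx
    exact Or.inr hx

/-- The structure of a letter that is not bijective. -/
theorem SameMiss.nonperm_structure (h : SameMiss S T q z) {L : V → V} (hL : L ∈ S)
    (hb : ¬ Function.Bijective L) (hT : 2 ≤ T) : ∃ u u', u ≠ u' ∧ L u = q ∧ L u' = q ∧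
      (mergeGraph S 1).Adj u u' ∧ (∀ x, L x = q → x = u ∨ x = u') ∧
      ∀ x y, L x = L y → x = y ∨ L x = q := by
  obtain ⟨u, u', hne, hu, hu'⟩ := mem_dups.1 (h.mem_dups L hL hb)
  have h3 := h.tripleFree 1 (by omega) L (IsWord.letter hL)
  refine ⟨u, u', hne, hu, hu', mergeGraph_adj_of_eq (t := 0) hL hne (hu.trans hu'.symm), ?_, ?_⟩
  · intro x hx
    rcases h3 x u u' (by rw [hx, hu]) (by rw [hu, hu']) with h1 | h1 | h1
    · exact Or.inl h1
    · exact absurd h1 hne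
    · exact Or.inr h1
  · intro x y hxy
    by_contra! hcon
    have h4 : (dups L).card = 1 := by rw [card_dups h3, h.defect_eq hL hb]
    obtain ⟨p, hp⟩ := Finset.card_eq_one.1 h4
    have h5 : q ∈ dups L := h.mem_dups L hL hb
    have h6 : L x ∈ dups L := mem_dups.2 ⟨x, y, hcon.1, rfl, hxy.symm⟩
    rw [hp, Finset.mem_singleton] at h5 h6
    exact hcon.2 (h6.trans h5.symm)

theorem SameMiss.numEdges_add_le (h : SameMiss S T q z) {s t : ℕ} (hst : s ≤ t) (ht : t < T) :
    numEdges (mergeGraph S s) + (t - s) ≤ numEdges (mergeGraph S t) := by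
  obtain ⟨a, ha, hb⟩ := h.exists_nonperm
  have := live_numEdges_add_le h.three_le h.tripleFree h.synchronizing ha (h.mem_dups a ha hb)
    (isDead_bot S) (fun _ h => h) s (t - s) (by omega)
  rwa [sdiff_bot, sdiff_bot, Nat.add_sub_of_le hst] at this

/-- At time 3 the edge count forces `a q` to be adjacent to both `z` and `a z`. The pair collapsed
by `a` avoids `q` and `z`, so among four states it contains `a q`; but at time 2 the only possible
neighbour of `a q` is `z`. -/
theorem SameMiss.false_of_fixed_of_card_four (h : SameMiss S 6 q z) (hn : Fintype.card V = 4)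
    (hfix : ∀ σ ∈ S, Function.Bijective σ → σ q = q) : False := by
  have hF := h.isFamily
  obtain ⟨a, ha, hb, haq⟩ := h.exists_exit_of_fixed hfix
  have h0 := deg_eq_zero_of (h.isolated_of_fixed hfix (t := 3) (by norm_num))
  have h1 := hF.edge_count (t := 3) (by norm_num) {a q, q}
  rw [Finset.sum_pair haq, Finset.card_pair haq, h0, hn] at h1
  have h2 : 2 ≤ deg (mergeGraph S 3) (a q) := by
    have : Nat.choose (4 - 2) 2 = 1 := rfl
    omega
  have haz : (mergeGraph S 3).Adj (a q) (a z) := by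
    by_contra hno
    have : deg (mergeGraph S 3) (a q) ≤ 1 := deg_le_one_of (c := z) fun y hy => by
      rcases hF.nonperm ha hb hy with h3 | ⟨u, rfl, hu⟩
      · exact h3
      · rw [h.adj_q hF (by norm_num) hu] at hy
        exact absurd hy hno
    omega
  have hazq : a z ≠ q := fun e =>
    h.isolated_of_fixed hfix (t := 3) (by norm_num) (a q) (by rw [e] at haz; exact haz.symm)
  obtain ⟨u, u', hne, hu, hu', hadj, -, -⟩ := h.nonperm_structure ha hb (by norm_num)
  have hqz := h.ne
  have hx : a q ≠ z := (h.missing a ha hb _).1 ⟨q, rfl⟩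
  have huq : u ≠ q := fun e => haq (e ▸ hu)
  have huq' : u' ≠ q := fun e => haq (e ▸ hu')
  have huz : u ≠ z := fun e => hazq (by rw [← e, hu])
  have huz' : u' ≠ z := fun e => hazq (by rw [← e, hu'])
  have hcase : a q = u ∨ a q = u' := by
    by_contra! hcon
    have : ({a q, u, u', q, z} : Finset V).card ≤ 4 := by rw [← hn]; exact Finset.card_le_univ _
    rw [Finset.card_insert_of_notMem (by simp [haq, hx, hcon]),
      Finset.card_insert_of_notMem (by simp [hne, huq, huz]),
      Finset.card_insert_of_notMem (by simp [huq', huz']), Finset.card_pair hqz] at this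
    omega
  have hadj2 := mergeGraph_mono (S := S) (show 1 ≤ 2 by norm_num) hadj
  rcases hcase with e | e
  · exact huz' (h.adj_exit_of_fixed hfix ha hb (t := 2) (by norm_num) (by rw [e]; exact hadj2))
  · exact huz (h.adj_exit_of_fixed hfix ha hb (t := 2) (by norm_num) (by rw [e]; exact hadj2.symm))

/-- With `x = a q`, only `xz`, `zb`, `zc`, `bc` can be edges up to time 4, so exactly `t` of them
are present at time `t ≤ 4`. If `xz` is the first edge, no letter explains the edge `qz` at time 6.
If `bc` is the first, `xz` is the second, and no letter explains the third. -/
theorem SameMiss.false_of_fixed_of_card_five (h : SameMiss S 8 q z) (hn : Fintype.card V = 5)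
    (hqz : (mergeGraph S 6).Adj q z)
    (hfix : ∀ σ ∈ S, Function.Bijective σ → σ q = q) : False := by
  have hF := h.isFamily
  obtain ⟨a, ha, hab, haq⟩ := h.exists_exit_of_fixed hfix
  have iso := fun {t : ℕ} (ht : t + 2 < 8) => h.isolated_of_fixed hfix (t := t) ht
  have haz : a q ≠ z := (h.missing a ha hab _).1 ⟨q, rfl⟩
  have hx : ∀ {t : ℕ}, t + 3 < 8 → ∀ y, (mergeGraph S t).Adj (a q) y → y = z := fun ht y hy =>
    h.adj_exit_of_fixed hfix ha hab ht hy
  have hne := h.ne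
  obtain ⟨b, c, hb, hc, hbc, hall⟩ := exists_rest_two (A := {a q, q, z}) (by
    rw [Finset.card_eq_three.2 ⟨_, _, _, haq, haz, hne, rfl⟩, hn])
  simp only [Finset.mem_insert, Finset.mem_singleton, not_or] at hb hc hall
  obtain ⟨hbx, hbq, hbz⟩ := hb
  obtain ⟨hcx, hcq, hcz⟩ := hc
  generalize hx1 : a q = x at *
  have hE : ∀ {t : ℕ}, t ≤ 4 → ∀ u v, (mergeGraph S t).Adj u v →
      s(u, v) ∈ ({s(x, z), s(z, b), s(z, c), s(b, c)} : Finset (Sym2 V)) := by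
    intro t ht u v huv
    have h1 := huv.ne
    have h2 : u ≠ q := fun e => iso (t := t) (by omega) v (e ▸ huv)
    have h3 : v ≠ q := fun e => iso (t := t) (by omega) u (e ▸ huv.symm)
    have h4 : u = x → v = z := fun e => hx (t := t) (by omega) v (e ▸ huv)
    have h5 : v = x → u = z := fun e => hx (t := t) (by omega) u (e ▸ huv.symm)
    have hu := hall u
    have hv := hall v
    simp only [Finset.mem_insert, Finset.mem_singleton, Sym2.eq_iff]
    grind
  classical
  have hcount : ∀ t ≤ 4, ((if (mergeGraph S t).Adj x z then 1 else 0) +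
      ((if (mergeGraph S t).Adj z b then 1 else 0) +
      ((if (mergeGraph S t).Adj z c then 1 else 0) +
      (if (mergeGraph S t).Adj b c then 1 else 0)))) = t := by
    intro t ht
    have h1 := numEdges_le_card (hE le_rfl)
    have h2 := Finset.card_le_four (a := s(x, z)) (b := s(z, b)) (c := s(z, c)) (d := s(b, c))
    have h3 := h.numEdges_add_le ht (by norm_num)
    have h4 := hF.growth (t := t) (by omega)
    have h5 := numEdges_eq_sum (hE ht)
    rw [Finset.sum_insert (by simp; grind), Finset.sum_insert (by simp; grind),
      Finset.sum_insert (by simp; grind), Finset.sum_singleton] at h5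
    simp only [SimpleGraph.mem_edgeSet] at h5
    omega
  have hxz4 : (mergeGraph S 4).Adj x z := by
    have := hcount 4 le_rfl
    split_ifs at this <;> first | assumption | omega
  have hzb4 : (mergeGraph S 4).Adj z b := by
    have := hcount 4 le_rfl
    split_ifs at this <;> first | assumption | omega
  have hzc4 : (mergeGraph S 4).Adj z c := by
    have := hcount 4 le_rfl
    split_ifs at this <;> first | assumption | omega
  have hbc4 : (mergeGraph S 4).Adj b c := by
    have := hcount 4 le_rfl
    split_ifs at this <;> first | assumption | omega
  -- the letters that are not bijective map `q` to `x`
  have himq : ∀ L ∈ S, ¬ Function.Bijective L → L q = x := by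
    intro L hL hLb
    obtain ⟨u, u', huu, hu, hu', hadj, hcoll, -⟩ := h.nonperm_structure hL hLb (by norm_num)
    have h1 := h.missing L hL hLb (L q)
    have h2 : L q ≠ z := h1.1 ⟨q, rfl⟩
    have h3 : L q ≠ q := fun e => by
      rcases hcoll q e with rfl | rfl
      · exact iso (t := 1) (by norm_num) _ hadj
      · exact iso (t := 1) (by norm_num) _ hadj.symm
    have h4 := fun y => h.adj_exit_of_fixed hfix hL hLb (t := 4) (by norm_num) (y := y)
    rcases hall (L q) with (h5 | h5 | h5) | h5 | h5
    · exact h5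
    · exact absurd h5 h3
    · exact absurd h5 h2
    · exact absurd (h4 c (h5 ▸ hbc4)) hcz
    · exact absurd (h4 b (h5 ▸ hbc4.symm)) hbz
  -- Otherwise `z` has three neighbours at time 3. A bijective letter carrying another state to `z`
  -- lifts them to three neighbours of that state at time 4, but only `z` can have so many.
  have hbc3 : (mergeGraph S 3).Adj b c := by
    by_contra hno
    have hc3 := hcount 3 (by norm_num)
    rw [if_neg hno] at hc3
    have e1 : (mergeGraph S 3).Adj z x := by
      split_ifs at hc3 with h1 <;> first | exact h1.symm | omega
    have e2 : (mergeGraph S 3).Adj z b := by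
      split_ifs at hc3 <;> first | assumption | omega
    have e3 : (mergeGraph S 3).Adj z c := by
      split_ifs at hc3 <;> first | assumption | omega
    obtain ⟨σ, hσ, hσb, hσz⟩ := h.exists_moves
    obtain ⟨u, hu⟩ := hσb.2 z
    rw [← hu] at e1 e2 e3
    obtain ⟨x', hx', ex⟩ := hF.adj_perm hσ hσb e1
    obtain ⟨b', hb', eb⟩ := hF.adj_perm hσ hσb e2
    obtain ⟨c', hc', ec⟩ := hF.adj_perm hσ hσb e3
    have k1 := hE (t := 4) le_rfl _ _ ex
    have k2 := hE (t := 4) le_rfl _ _ eb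
    have k3 := hE (t := 4) le_rfl _ _ ec
    simp only [Finset.mem_insert, Finset.mem_singleton, Sym2.eq_iff] at k1 k2 k3
    grind
  -- the collisions
  have hcol : ∀ L ∈ S, ¬ Function.Bijective L →
      (L x = q ∧ L z = q ∧ (mergeGraph S 1).Adj x z) ∨
      (L b = q ∧ L c = q ∧ (mergeGraph S 1).Adj b c ∧
        (L x = b ∧ L z = c ∨ L x = c ∧ L z = b)) := by
    intro L hL hLb
    obtain ⟨u, u', huu, hu, hu', hadj, -, -⟩ := h.nonperm_structure hL hLb (by norm_num)
    obtain ⟨r, hr⟩ := (h.missing L hL hLb b).2 hbz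
    obtain ⟨s, hs⟩ := (h.missing L hL hLb c).2 hcz
    have hrs : (mergeGraph S 4).Adj r s := mergeGraph_adj_of_letter hL (by rwa [hr, hs])
    have k0 := himq L hL hLb
    have k1 := hE (t := 1) (by norm_num) _ _ hadj
    have k2 := hE (t := 4) le_rfl _ _ hrs
    simp only [Finset.mem_insert, Finset.mem_singleton, Sym2.eq_iff] at k1 k2
    have k3 := hadj.symm
    clear hE hcount hfix hx iso himq hF h hall
    grind (splits := 30)
  have hc1 := hcount 1 (by norm_num)
  obtain ⟨L₀, hL₀, hL₀b⟩ := h.exists_nonperm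
  by_cases hxz1 : (mergeGraph S 1).Adj x z
  · rw [if_pos hxz1] at hc1
    have hnbc : ¬ (mergeGraph S 1).Adj b c := fun e => by rw [if_pos e] at hc1; omega
    obtain ⟨-, L, hL, e | e⟩ := mergeGraph_succ_adj.1 hqz
    · exact iso (t := 1) (by norm_num) z (mergeGraph_adj_of_eq (t := 0) hL hne e)
    · by_cases hLb : Function.Bijective L
      · rw [hfix L hL hLb] at e
        exact iso (t := 5) (by norm_num) _ e
      · rcases hcol L hL hLb with ⟨-, hz, -⟩ | ⟨-, -, h1, -⟩
        · rw [hz] at e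
          exact iso (t := 5) (by norm_num) _ e.symm
        · exact hnbc h1
  have hcol' := fun L hL hLb => (hcol L hL hLb).resolve_left fun e => hxz1 e.2.2
  obtain ⟨-, -, hbc1, him⟩ := hcol' L₀ hL₀ hL₀b
  have hxz2 : (mergeGraph S 2).Adj x z := by
    refine mergeGraph_adj_of_letter hL₀ ?_
    rcases him with ⟨e1, e2⟩ | ⟨e1, e2⟩ <;> rw [e1, e2]
    · exact hbc1
    · exact hbc1.symm
  have hc2 := hcount 2 (by norm_num)
  rw [if_pos hxz2, if_pos (mergeGraph_mono (show 1 ≤ 2 by norm_num) hbc1)] at hc2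
  have hzb2 : ¬ (mergeGraph S 2).Adj z b := fun e => by rw [if_pos e] at hc2; omega
  have hzc2 : ¬ (mergeGraph S 2).Adj z c := fun e => by rw [if_pos e] at hc2; omega
  have third : ∀ y, y = b ∨ y = c → ¬ (mergeGraph S 3).Adj z y := by
    intro y hy e
    have hy2 : ¬ (mergeGraph S 2).Adj z y := by rcases hy with rfl | rfl <;> assumption
    obtain ⟨hzy, L, hL, e | e⟩ := mergeGraph_succ_adj.1 e
    · exact hy2 (mergeGraph_mono (show 1 ≤ 2 by norm_num) (mergeGraph_adj_of_eq (t := 0) hL hzy e))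
    by_cases hLb : Function.Bijective L
    · have k := hE (t := 2) (by norm_num) _ _ e
      have l1 := hfix L hL hLb
      have l2 := hall (L x)
      have l3 := hall (L b)
      have l4 := hall (L c)
      have inj := fun {u v : V} (h : L u = L v) => hLb.1 h
      have m1 : ∀ u v, u ≠ v → L u = b → L v = c → (mergeGraph S 2).Adj u v := fun u v _ h1 h2 =>
        mergeGraph_adj_of_letter hL (by rw [h1, h2]; exact hbc1)
      have m2 := hx (t := 2) (by norm_num)
      have m3 : ∀ {u v}, (mergeGraph S 2).Adj u v → (mergeGraph S 2).Adj v u := fun h => h.symm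
      simp only [Finset.mem_insert, Finset.mem_singleton, Sym2.eq_iff] at k
      grind
    · have := hcol' L hL hLb
      rcases hy with rfl | rfl
      · rw [this.1] at e
        exact iso (t := 2) (by norm_num) _ e.symm
      · rw [this.2.1] at e
        exact iso (t := 2) (by norm_num) _ e.symm
  have hc3 := hcount 3 (by norm_num)
  rw [if_neg (third b (Or.inl rfl)), if_neg (third c (Or.inr rfl))] at hc3
  split_ifs at hc3 <;> omega

end FourFive

/-! ### Four states with `q` moved by a bijective letter -/

section MovedFour

variable {V : Type*} [Fintype V] [DecidableEq V] {S : Set (V → V)} {T : ℕ} {q z : V} {π : V → V}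

theorem MovesDup.adj_image (h : MovesDup S T q z π) {t : ℕ} (ht : t + 2 < T) {y : V}
    (hy : (mergeGraph S t).Adj (π q) y) : y = π z := by
  obtain ⟨u, rfl, hu⟩ := h.isFamily.adj_perm h.mem h.bij hy
  rw [h.adj_q h.isFamily (by omega) hu]

/-- An edge that appears after the first step is explained by a letter. -/
theorem exists_letter_of_adj {t : ℕ} (ht : 1 ≤ t) {x y : V}
    (h : (mergeGraph S (t + 1)).Adj x y) (h' : ¬ (mergeGraph S t).Adj x y) :
    ∃ L ∈ S, (mergeGraph S t).Adj (L x) (L y) := by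
  obtain ⟨hne, L, hL, e | e⟩ := mergeGraph_succ_adj.1 h
  · exact absurd (mergeGraph_mono ht (mergeGraph_adj_of_eq (t := 0) hL hne e)) h'
  · exact ⟨L, hL, e⟩

/-- Up to time 3 only `qz`, `pw` and `bc` can be edges, so one appears in each step. The last one
turns out to be `zw`. It cannot be created from an earlier edge, so it is the first; then neither of
the other two can appear in the second step. -/
theorem MovesDup.false_of_card_four (h : MovesDup S 6 q z π) (hn : Fintype.card V = 4) :
    False := by
  have hF := h.isFamily
  have hq : ∀ {t}, t ≤ 4 → ∀ {y}, (mergeGraph S t).Adj q y → y = z :=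
    fun ht _ hy => h.adj_q hF (by omega) hy
  have hp : ∀ {t}, t ≤ 3 → ∀ {y}, (mergeGraph S t).Adj (π q) y → y = π z :=
    fun ht _ hy => h.adj_image (by omega) hy
  have hmv := h.moves
  have hpz : π q ≠ π z := fun e => h.ne (h.bij.1 e)
  have hne := h.ne
  obtain ⟨b, c, hb, hc, hbc, hall⟩ := exists_rest_two (A := {π q, q}) (by rw [h.card_pair, hn])
  simp only [Finset.mem_insert, Finset.mem_singleton, not_or] at hb hc hall
  generalize hp1 : π q = p at *
  generalize hw1 : π z = w at *
  have hE : ∀ {t : ℕ}, t ≤ 3 → ∀ x y, (mergeGraph S t).Adj x y →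
      s(x, y) ∈ ({s(q, z), s(p, w), s(b, c)} : Finset (Sym2 V)) := by
    intro t ht x y hxy
    have h1 := hxy.ne
    have h2 : x = q → y = z := fun e => hq (t := t) (by omega) (e ▸ hxy)
    have h3 : y = q → x = z := fun e => hq (t := t) (by omega) (e ▸ hxy.symm)
    have h4 : x = p → y = w := fun e => hp (t := t) (by omega) (e ▸ hxy)
    have h5 : y = p → x = w := fun e => hp (t := t) (by omega) (e ▸ hxy.symm)
    have hx := hall x
    have hy := hall y
    simp only [Finset.mem_insert, Finset.mem_singleton, Sym2.eq_iff]
    clear hall hF hq hp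
    grind
  have hcard := (hF.growth (t := 3) (by norm_num)).trans (numEdges_le_card (hE le_rfl))
  have hd1 : s(q, z) ≠ s(p, w) := fun e => by
    have h2 := Finset.card_le_two (a := s(p, w)) (b := s(b, c))
    rw [e, Finset.insert_eq_of_mem (Finset.mem_insert_self _ _)] at hcard
    omega
  have hd2 : s(q, z) ≠ s(b, c) := fun e => by
    rcases Sym2.eq_iff.1 e with ⟨h1, -⟩ | ⟨h1, -⟩
    · exact hb.2 h1.symm
    · exact hc.2 h1.symm
  have hd3 : s(p, w) ≠ s(b, c) := fun e => by
    rcases Sym2.eq_iff.1 e with ⟨h1, -⟩ | ⟨h1, -⟩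
    · exact hb.1 h1.symm
    · exact hc.1 h1.symm
  classical
  have hcount : ∀ t ≤ 3, ((if s(q, z) ∈ (mergeGraph S t).edgeSet then 1 else 0) +
      ((if s(p, w) ∈ (mergeGraph S t).edgeSet then 1 else 0) +
      (if s(b, c) ∈ (mergeGraph S t).edgeSet then 1 else 0))) = t := by
    intro t ht
    have h1 := numEdges_le_card (hE le_rfl)
    have h2 := Finset.card_le_three (a := s(q, z)) (b := s(p, w)) (c := s(b, c))
    have h3 := h.numEdges_add_le ht (by norm_num)
    have h4 := hF.growth (t := t) (by omega)
    have h5 := numEdges_eq_sum (hE ht)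
    rw [Finset.sum_insert (by simp [hd1, hd2]),
      Finset.sum_insert (by simp [hd3]), Finset.sum_singleton] at h5
    omega
  have hc3 := hcount 3 le_rfl
  have hqz3 : (mergeGraph S 3).Adj q z := by
    split_ifs at hc3 <;> first | assumption | omega
  have hpw3 : (mergeGraph S 3).Adj p w := by
    split_ifs at hc3 <;> first | assumption | omega
  have hbc3 : (mergeGraph S 3).Adj b c := by
    split_ifs at hc3 <;> first | assumption | omega
  have hzp : z ≠ p := by
    rintro rfl
    exact hd1 (by rw [← hp le_rfl hqz3.symm, Sym2.eq_swap])
  have hwq : w ≠ q := by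
    rintro rfl
    exact hzp (hq (by norm_num) hpw3.symm).symm
  obtain ⟨d, hzd, hdq, hdp, hdz, hall'⟩ : ∃ d, s(b, c) = s(z, d) ∧ d ≠ q ∧ d ≠ p ∧ d ≠ z ∧
      ∀ x, x = q ∨ x = p ∨ x = z ∨ x = d := by
    rcases hall z with (h1 | h1) | h1 | h1
    · exact absurd h1 hzp
    · exact absurd h1 hne.symm
    · exact ⟨c, by rw [h1], hc.2, hc.1, h1 ▸ hbc.symm, fun x => by have := hall x; grind⟩
    · exact ⟨b, by rw [h1, Sym2.eq_swap], hb.2, hb.1, h1 ▸ hbc, fun x => by have := hall x; grind⟩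
  rw [← SimpleGraph.mem_edgeSet, hzd, SimpleGraph.mem_edgeSet] at hbc3
  simp only [hzd, SimpleGraph.mem_edgeSet] at hcount
  simp only [hzd, Finset.mem_insert, Finset.mem_singleton, Sym2.eq_iff] at hE
  clear hall hzd hbc hb hc hcard hd1 hd2 hd3 hc3
  have himg : ∀ σ ∈ S, Function.Bijective σ → ∀ y, (mergeGraph S 3).Adj (σ q) y → y = σ z := by
    intro σ hσ hσb y hy
    obtain ⟨u, rfl, hu⟩ := hF.adj_perm hσ hσb hy
    rw [hq le_rfl hu]
  rcases hall' w with rfl | rfl | rfl | rfl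
  · exact hwq rfl
  · exact hpz rfl
  · obtain ⟨σ, hσ, hσb, hσz⟩ := h.exists_moves
    have h1 := himg σ hσ hσb
    rcases hall' (σ q) with e | e | e | e <;> rw [e] at h1
    · exact hσz (h1 _ hqz3).symm
    · exact hσz (h1 _ hpw3).symm
    · exact hmv ((h1 _ hpw3.symm).trans (h1 _ hqz3.symm).symm)
    · exact hσz (h1 _ hbc3.symm).symm
  have hperm : ∀ σ ∈ S, Function.Bijective σ → σ q = q ∧ σ z = z ∨ σ q = p ∧ σ z = w := by
    intro σ hσ hσb
    have h1 := himg σ hσ hσb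
    rcases hall' (σ q) with e | e | e | e <;> rw [e] at h1
    · exact Or.inl ⟨e, (h1 _ hqz3).symm⟩
    · exact Or.inr ⟨e, (h1 _ hpw3).symm⟩
    · exact absurd ((h1 _ hqz3.symm).trans (h1 _ hbc3).symm) hwq.symm
    · exact absurd ((h1 _ hpw3.symm).trans (h1 _ hbc3.symm).symm) hzp.symm
  have hne1 : ∀ {t}, t ≤ 3 → ¬ (mergeGraph S t).Adj q p := fun ht e => hzp (hq (by omega) e).symm
  have hzw1 : (mergeGraph S 1).Adj z w := by
    have step : ∀ t, 1 ≤ t → t ≤ 2 → (mergeGraph S (t + 1)).Adj z w → (mergeGraph S t).Adj z w := by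
      intro t ht ht2 hadj
      by_contra hno
      obtain ⟨L, hL, e⟩ := exists_letter_of_adj ht hadj hno
      have k := hE (t := t) (by omega) _ _ e
      by_cases hLb : Function.Bijective L
      · have k1 := hperm L hL hLb
        have k2 := @hLb.1 z w
        have k3 := @hLb.1 q w
        have k4 := e.symm
        clear hE hcount
        grind
      · obtain ⟨u, u', huu, hu, hu', hadj, -, -⟩ := h.nonperm_structure hL hLb (by norm_num)
        have k1 := (h.missing L hL hLb _).1 ⟨z, rfl⟩
        have k2 := (h.missing L hL hLb _).1 ⟨w, rfl⟩
        have k3 := hE (t := 1) (by norm_num) _ _ hadj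
        clear hE hcount
        grind
    exact step 1 le_rfl (by norm_num) (step 2 (by norm_num) le_rfl hbc3)
  have hc1 := hcount 1 (by norm_num)
  rw [if_pos hzw1] at hc1
  have hc2 := hcount 2 (by norm_num)
  rw [if_pos (mergeGraph_mono (show 1 ≤ 2 by norm_num) hzw1)] at hc2
  have hqz1 : ¬ (mergeGraph S 1).Adj q z := fun e => by rw [if_pos e] at hc1; omega
  have hpw1 : ¬ (mergeGraph S 1).Adj p w := fun e => by rw [if_pos e] at hc1; omega
  have hcol : ∀ L ∈ S, ¬ Function.Bijective L → L z = q ∧ L w = q := by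
    intro L hL hLb
    obtain ⟨u, u', huu, hu, hu', hadj, -, -⟩ := h.nonperm_structure hL hLb (by norm_num)
    have k3 := hE (t := 1) (by norm_num) _ _ hadj
    have k4 := hadj.symm
    clear hE hcount
    grind
  have hqz2 : ¬ (mergeGraph S 2).Adj q z := fun e => by
    obtain ⟨L, hL, e⟩ := exists_letter_of_adj le_rfl e hqz1
    have k := hE (t := 1) (by norm_num) _ _ e
    by_cases hLb : Function.Bijective L
    · have k1 := hperm L hL hLb
      clear hE hcount
      grind
    · rw [(hcol L hL hLb).1] at e
      have := hq (by norm_num) e.symm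
      exact (h.missing L hL hLb _).1 ⟨_, rfl⟩ this
  have hpw2 : ¬ (mergeGraph S 2).Adj p w := fun e => by
    obtain ⟨L, hL, e⟩ := exists_letter_of_adj le_rfl e hpw1
    have k := hE (t := 1) (by norm_num) _ _ e
    by_cases hLb : Function.Bijective L
    · have k1 := hperm L hL hLb
      have k2 := @hLb.1 z w
      have k3 := @hLb.1 z p
      have k4 := e.symm
      clear hE hcount
      grind
    · rw [(hcol L hL hLb).2] at e
      have := hq (by norm_num) e.symm
      exact (h.missing L hL hLb _).1 ⟨_, rfl⟩ this
  rw [if_neg hqz2, if_neg hpw2] at hc2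
  omega

end MovedFour

/-! ### Five states with `q` moved by a bijective letter -/

section MovedFive

variable {V : Type*} [Fintype V] [DecidableEq V] {S : Set (V → V)} {T : ℕ} {q z : V} {π : V → V}

/-- Five edges are needed at time 5 and at most three avoid `q` and `π q`, so both of these states
have degree one. If `z = π q`, or if a bijective letter took `q` to a third state, at most four
edges would be possible. -/
theorem MovesDup.image_of_card_five (h : MovesDup S 8 q z π) (hn : Fintype.card V = 5) :
    π z ≠ z ∧ π z ≠ q ∧ z ≠ π q ∧ ∀ σ ∈ S, Function.Bijective σ →
      σ q = q ∧ σ z = z ∨ σ q = π q ∧ σ z = π z := by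
  have hF := h.isFamily
  have hq : ∀ {t}, t ≤ 6 → ∀ {y}, (mergeGraph S t).Adj q y → y = z :=
    fun ht _ hy => h.adj_q hF (by omega) hy
  have hp : ∀ {t}, t ≤ 5 → ∀ {y}, (mergeGraph S t).Adj (π q) y → y = π z :=
    fun ht _ hy => h.adj_image (by omega) hy
  have hmv := h.moves
  have hpz : π q ≠ π z := fun e => h.ne (h.bij.1 e)
  have hdq : deg (mergeGraph S 5) q ≤ 1 := deg_le_one_of fun y hy => hq (by norm_num) hy
  have hdp : deg (mergeGraph S 5) (π q) ≤ 1 := deg_le_one_of fun y hy => hp (by norm_num) hy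
  have h1 := hF.edge_count (t := 5) (by norm_num) {π q, q}
  rw [Finset.sum_pair hmv, h.card_pair, hn, show Nat.choose (5 - 2) 2 = 3 from rfl] at h1
  have hqz : (mergeGraph S 5).Adj q z := by
    by_contra hno
    have := deg_eq_zero_of (G := mergeGraph S 5) (x := q) fun y hy => hno (hq (by norm_num) hy ▸ hy)
    omega
  have hpw : (mergeGraph S 5).Adj (π q) (π z) := by
    by_contra hno
    have := deg_eq_zero_of (G := mergeGraph S 5) (x := π q)
      fun y hy => hno (hp (by norm_num) hy ▸ hy)
    omega
  have hzp : z ≠ π q := by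
    intro e
    have hw : q = π z := hp le_rfl (e ▸ hqz.symm)
    obtain ⟨a, b, c, hab, hac, hbc, hc⟩ := Finset.card_eq_three.1
      (show ({π q, q} : Finset V)ᶜ.card = 3 by rw [Finset.card_compl, h.card_pair, hn])
    have hE : ∀ x y, (mergeGraph S 5).Adj x y →
        s(x, y) ∈ ({s(q, z), s(a, b), s(a, c), s(b, c)} : Finset (Sym2 V)) := by
      intro x y hxy
      have h1 := hxy.ne
      have h2 : x = q → y = z := fun e => hq (t := 5) (by omega) (e ▸ hxy)
      have h3 : y = q → x = z := fun e => hq (t := 5) (by omega) (e ▸ hxy.symm)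
      have h4 : x = z → y = q := fun e' => by
        rw [hw]; exact hp (t := 5) (by omega) (e ▸ e' ▸ hxy)
      have h5 : y = z → x = q := fun e' => by
        rw [hw]; exact hp (t := 5) (by omega) (e ▸ e' ▸ hxy.symm)
      have hx := Finset.ext_iff.1 hc x
      have hy := Finset.ext_iff.1 hc y
      simp only [Finset.mem_compl, Finset.mem_insert, Finset.mem_singleton, ← e] at hx hy
      simp only [Finset.mem_insert, Finset.mem_singleton, Sym2.eq_iff]
      clear hF hq hp h
      grind
    have h2 := Finset.card_le_four (a := s(q, z)) (b := s(a, b)) (c := s(a, c)) (d := s(b, c))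
    have h3 := numEdges_le_card hE
    have h4 := hF.growth (t := 5) (by norm_num)
    omega
  have hwq : π z ≠ q := fun e => hzp (hq (by norm_num) (e ▸ hpw.symm)).symm
  have hperm : ∀ σ ∈ S, Function.Bijective σ →
      σ q = q ∧ σ z = z ∨ σ q = π q ∧ σ z = π z := by
    intro σ hσ hσb
    have himg : ∀ y, (mergeGraph S 5).Adj (σ q) y → y = σ z := fun y hy => by
      obtain ⟨u, rfl, hu⟩ := hF.adj_perm hσ hσb hy
      rw [hq le_rfl hu]
    by_cases h2 : σ q = q
    · exact Or.inl ⟨h2, (himg z (by rwa [h2])).symm⟩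
    by_cases h3 : σ q = π q
    · exact Or.inr ⟨h3, (himg (π z) (by rwa [h3])).symm⟩
    exfalso
    have h4 := hF.edge_count (t := 5) (by norm_num) {σ q, π q, q}
    rw [Finset.sum_insert (by simp [h2, h3]), Finset.sum_pair hmv,
      Finset.card_insert_of_notMem (by simp [h2, h3]), h.card_pair, hn,
      show Nat.choose (5 - (2 + 1)) 2 = 1 from rfl] at h4
    have := deg_le_one_of himg
    omega
  refine ⟨fun e => ?_, hwq, hzp, hperm⟩
  obtain ⟨σ, hσ, hσb, hσz⟩ := h.exists_moves
  rcases hperm σ hσ hσb with h2 | h2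
  · exact hσz h2.2
  · exact hσz (h2.2.trans e)

/-- The structure of the merge graphs for five states. -/
structure FiveChain (S : Set (V → V)) (A : ℕ → V → V → Prop) (q p z w v : V) : Prop where
  nodup : [q, p, z, w, v].Nodup
  all : ∀ x, x = q ∨ x = p ∨ x = z ∨ x = w ∨ x = v
  symm : ∀ {t x y}, A t x y → A t y x
  mono : ∀ {s t x y}, s ≤ t → A s x y → A t x y
  edges : ∀ {t x y}, t ≤ 5 → A t x y →
    s(x, y) = s(q, z) ∨ s(x, y) = s(p, w) ∨ s(x, y) = s(z, w) ∨ s(x, y) = s(z, v) ∨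
      s(x, y) = s(w, v)
  pull : ∀ {t x y}, ∀ L ∈ S, A t (L x) (L y) → A (t + 1) x y
  explain : ∀ {t x y}, 1 ≤ t → A (t + 1) x y → ¬ A t x y → ∃ L ∈ S, A t (L x) (L y)
  perm : ∀ σ ∈ S, Function.Bijective σ → σ q = q ∧ σ z = z ∨ σ q = p ∧ σ z = w
  moves : ∃ σ ∈ S, Function.Bijective σ ∧ σ q = p
  nonperm : ∀ L ∈ S, ¬ Function.Bijective L → (∀ x, L x ≠ z) ∧
    ∃ u u', u ≠ u' ∧ A 1 u u' ∧ L u = q ∧ L u' = q ∧ ∀ x y, L x = L y → x = y ∨ L x = q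

-- Exactly five pairs can be edges up to time 5, so each step up to then adds exactly one.
open scoped Classical in
theorem MovesDup.exists_fiveChain (h : MovesDup S 8 q z π) (hn : Fintype.card V = 5) :
    ∃ p w v, FiveChain S (fun t => (mergeGraph S t).Adj) q p z w v ∧
      ∀ t ≤ 5, ((if (mergeGraph S t).Adj q z then 1 else 0) +
        ((if (mergeGraph S t).Adj p w then 1 else 0) +
        ((if (mergeGraph S t).Adj z w then 1 else 0) +
        ((if (mergeGraph S t).Adj z v then 1 else 0) +
        (if (mergeGraph S t).Adj w v then 1 else 0))))) = t := by
  have hF := h.isFamily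
  obtain ⟨hwz, hwq, hzp, hperm⟩ := h.image_of_card_five hn
  have hq : ∀ {t}, t ≤ 6 → ∀ {y}, (mergeGraph S t).Adj q y → y = z :=
    fun ht _ hy => h.adj_q hF (by omega) hy
  have hp : ∀ {t}, t ≤ 5 → ∀ {y}, (mergeGraph S t).Adj (π q) y → y = π z :=
    fun ht _ hy => h.adj_image (by omega) hy
  have hmv := h.moves
  have hne := h.ne
  have hpw : π q ≠ π z := fun e => h.ne (h.bij.1 e)
  have hmem := h.mem
  have hbij := h.bij
  generalize hp1 : π q = p at *
  generalize π z = w at *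
  obtain ⟨v, hv, hall⟩ := exists_rest_one (A := {q, p, z, w}) (by
    rw [Finset.card_insert_of_notMem (by simp [hmv.symm, hne, hwq.symm]),
      Finset.card_insert_of_notMem (by simp [hzp.symm, hpw]), Finset.card_pair hwz.symm, hn])
  simp only [Finset.mem_insert, Finset.mem_singleton, not_or] at hv hall
  have hE : ∀ {t : ℕ}, t ≤ 5 → ∀ x y, (mergeGraph S t).Adj x y →
      s(x, y) ∈ ({s(q, z), s(p, w), s(z, w), s(z, v), s(w, v)} : Finset (Sym2 V)) := by
    intro t ht x y hxy
    have h1 := hxy.ne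
    have h2 : x = q → y = z := fun e => hq (t := t) (by omega) (e ▸ hxy)
    have h3 : y = q → x = z := fun e => hq (t := t) (by omega) (e ▸ hxy.symm)
    have h4 : x = p → y = w := fun e => hp (t := t) (by omega) (e ▸ hxy)
    have h5 : y = p → x = w := fun e => hp (t := t) (by omega) (e ▸ hxy.symm)
    have hx := hall x
    have hy := hall y
    simp only [Finset.mem_insert, Finset.mem_singleton, Sym2.eq_iff]
    clear hF hq hp h hall hperm
    grind
  have hnodup : [q, p, z, w, v].Nodup := by
    simp only [List.nodup_cons, List.mem_cons, List.not_mem_nil, or_false, not_or,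
      not_false_eq_true, List.nodup_nil, and_true]
    exact ⟨⟨hmv.symm, hne, hwq.symm, Ne.symm hv.1⟩, ⟨hzp.symm, hpw, Ne.symm hv.2.1⟩,
      ⟨hwz.symm, Ne.symm hv.2.2.1⟩, Ne.symm hv.2.2.2⟩
  refine ⟨p, w, v, ⟨hnodup, fun x => ?_, fun h => h.symm, fun h h' => mergeGraph_mono h h',
    fun ht hxy => ?_, fun L hL => mergeGraph_adj_of_letter hL,
    fun ht hxy h' => exists_letter_of_adj ht hxy h', hperm,
    ⟨π, hmem, hbij, hp1⟩, fun L hL hLb => ?_⟩, fun t ht => ?_⟩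
  · have := hall x
    tauto
  · simpa only [Finset.mem_insert, Finset.mem_singleton] using hE ht _ _ hxy
  · obtain ⟨u, u', h1, h2, h3, h4, -, h5⟩ := h.nonperm_structure hL hLb (by norm_num)
    exact ⟨fun x => (h.missing L hL hLb _).1 ⟨x, rfl⟩, u, u', h1, h4, h2, h3, h5⟩
  · have h1 := numEdges_le_card (hE le_rfl)
    have h2 := Finset.card_le_five (a := s(q, z)) (b := s(p, w)) (c := s(z, w)) (d := s(z, v))
      (e := s(w, v))
    have h3 := h.numEdges_add_le ht (by norm_num)
    have h4 := hF.growth (t := t) (by omega)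
    have h5 := numEdges_eq_sum (hE ht)
    clear hE hF hperm hp hq h
    simp only [List.nodup_cons, List.mem_cons, List.not_mem_nil, or_false, not_or] at hnodup
    rw [Finset.sum_insert (by simp; grind), Finset.sum_insert (by simp; grind),
      Finset.sum_insert (by simp; grind), Finset.sum_insert (by simp; grind),
      Finset.sum_singleton] at h5
    simp only [SimpleGraph.mem_edgeSet] at h5
    omega

namespace FiveChain

variable {A : ℕ → V → V → Prop} {p w v : V}

theorem not_adj (h : FiveChain S A q p z w v) {t : ℕ} (ht : t ≤ 5) :
    ¬ A t q p ∧ ¬ A t q w ∧ ¬ A t q v ∧ ¬ A t p z ∧ ¬ A t p v := by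
  have hn := h.nodup
  simp only [List.nodup_cons, List.mem_cons, List.not_mem_nil, or_false, not_or] at hn
  have := fun x y => h.edges (t := t) (x := x) (y := y) ht
  simp only [Sym2.eq_iff] at this
  refine ⟨fun e => ?_, fun e => ?_, fun e => ?_, fun e => ?_, fun e => ?_⟩ <;>
  · have := this _ _ e
    grind

/-- The bijective letters, if at most one edge is missing at time four. -/
theorem perm_cases (h : FiveChain S A q p z w v)
    (hm : (A 4 p w ∧ A 4 z w ∧ A 4 z v ∧ A 4 w v) ∨ (A 4 q z ∧ A 4 z w ∧ A 4 z v ∧ A 4 w v) ∨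
      (A 4 q z ∧ A 4 p w ∧ A 4 z v ∧ A 4 w v) ∨ (A 4 q z ∧ A 4 p w ∧ A 4 z w ∧ A 4 w v) ∨
      (A 4 q z ∧ A 4 p w ∧ A 4 z w ∧ A 4 z v))
    {σ : V → V} (hσ : σ ∈ S) (hσb : Function.Bijective σ) :
    (σ q = q ∧ σ p = p ∧ σ z = z ∧ σ w = w ∧ σ v = v) ∨
    (σ q = p ∧ σ p = q ∧ σ z = w ∧ σ w = z ∧ σ v = v) ∨
    (σ q = p ∧ σ p = v ∧ σ z = w ∧ σ w = z ∧ σ v = q ∧ ¬ A 4 w v) ∨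
    (σ q = p ∧ σ p = q ∧ σ z = w ∧ σ w = v ∧ σ v = z ∧ ¬ A 4 q z) ∨
    (σ q = q ∧ σ p = p ∧ σ z = z ∧ σ w = v ∧ σ v = w ∧ ¬ A 4 p w) ∨
    (σ q = q ∧ σ p = v ∧ σ z = z ∧ σ w = w ∧ σ v = p ∧ ¬ A 4 z v) := by
  have hn := h.nodup
  simp only [List.nodup_cons, List.mem_cons, List.not_mem_nil, or_false, not_or] at hn
  obtain ⟨⟨a1, a2, a3, a4⟩, ⟨a5, a6, a7⟩, ⟨a8, a9⟩, a10, -⟩ := hn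
  have inj : ∀ {x y : V}, x ≠ y → σ x ≠ σ y := fun hxy e => hxy (hσb.1 e)
  have b1 := inj a1
  have b2 := inj a3
  have b3 := inj a4
  have b4 := inj a5
  have b5 := inj a6
  have b6 := inj a7
  have b7 := inj a8
  have b8 := inj a9
  have b9 := inj a10
  obtain ⟨n1, n2, n3, n4, n5⟩ := h.not_adj (t := 5) le_rfl
  -- The permanent non-edges at time 5 are mapped by `σ` to non-edges at time 4. Those are again the
  -- permanent ones and at most one missing edge, which leaves few choices for `σ`.
  have c1 := fun e => n1 (h.pull σ hσ e)
  have c2 := fun e => n2 (h.pull σ hσ e)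
  have c3 := fun e => n3 (h.pull σ hσ e)
  have c4 := fun e => n4 (h.pull σ hσ e)
  have c5 := fun e => n5 (h.pull σ hσ e)
  have sy : ∀ x y, A 4 x y → A 4 y x := fun _ _ h' => h.symm h'
  have hp := h.all (σ p)
  have hw := h.all (σ w)
  have hv := h.all (σ v)
  have s1 := sy w v
  have s2 := sy z v
  have s3 := sy p w
  have s4 := sy q z
  have s5 := sy z w
  rcases h.perm σ hσ hσb with ⟨hq, hz⟩ | ⟨hq, hz⟩ <;> rw [hq] at b1 b2 b3 c1 c2 c3 <;>
    rw [hz] at b4 b7 b8 c4 <;>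
    rcases hp with hp | hp | hp | hp | hp <;> rw [hp] at b1 b4 b5 b6 c1 c4 c5 <;>
    first
    | exact absurd rfl b1
    | exact absurd rfl b4
    | skip
  all_goals
    rcases hw with hw | hw | hw | hw | hw <;> rw [hw] at b2 b5 b7 b9 c2 <;>
    first
    | exact absurd rfl b2
    | exact absurd rfl b5
    | exact absurd rfl b7
    | skip
  all_goals
    rcases hv with hv | hv | hv | hv | hv <;> rw [hv] at b3 b6 b8 b9 c3 c5 <;>
    first
    | exact absurd rfl b3
    | exact absurd rfl b6
    | exact absurd rfl b8
    | exact absurd rfl b9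
    | skip
  all_goals
    rw [hq, hz, hp, hw, hv]
    clear inj sy hσb h hσ hq hz hp hw hv
    grind

-- All bijective letters preserve the pair `{z, w}`, and no other letter creates this edge late, so
-- it is the only edge at time one. The second step then adds nothing: bijective letters only return
-- this edge, and the other letters miss `z`.
open scoped Classical in
theorem false_of_id_or_swap (h : FiveChain S A q p z w v)
    (hc : ∀ t ≤ 5, ((if A t q z then 1 else 0) + ((if A t p w then 1 else 0) +
      ((if A t z w then 1 else 0) + ((if A t z v then 1 else 0) +
      (if A t w v then 1 else 0))))) = t)
    (ho : ∀ σ ∈ S, Function.Bijective σ →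
      (σ q = q ∧ σ p = p ∧ σ z = z ∧ σ w = w ∧ σ v = v) ∨
      (σ q = p ∧ σ p = q ∧ σ z = w ∧ σ w = z ∧ σ v = v)) : False := by
  have hn := h.nodup
  simp only [List.nodup_cons, List.mem_cons, List.not_mem_nil, or_false, not_or] at hn
  have hall := h.all
  have hE := fun (t x y) (ht : t ≤ 5) => h.edges (t := t) (x := x) (y := y) ht
  simp only [Sym2.eq_iff] at hE
  have step : ∀ t, 1 ≤ t → t ≤ 4 → A (t + 1) z w → A t z w := by
    intro t ht ht4 hadj
    by_contra hno
    obtain ⟨L, hL, e⟩ := h.explain ht hadj hno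
    by_cases hLb : Function.Bijective L
    · rcases ho L hL hLb with ⟨-, -, e1, e2, -⟩ | ⟨-, -, e1, e2, -⟩ <;> rw [e1, e2] at e
      · exact hno e
      · exact hno (h.symm e)
    · obtain ⟨hLz, u, u', huu, hadj, hu, hu', -⟩ := h.nonperm L hL hLb
      have k := hE t _ _ (by omega) e
      have k1 := hLz z
      have k2 := hLz w
      have k3 := hE 1 _ _ (by norm_num) hadj
      clear hE hc ho h hLb hadj e
      grind
  have h5 : A 5 z w := by
    have := hc 5 le_rfl
    split_ifs at this <;> first | assumption | omega
  have h1 : A 1 z w := step 1 le_rfl (by norm_num) (step 2 (by norm_num) (by norm_num)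
    (step 3 (by norm_num) (by norm_num) (step 4 (by norm_num) le_rfl h5)))
  have hc1 := hc 1 (by norm_num)
  rw [if_pos h1] at hc1
  have h2 : ∀ x y, A 2 x y → A 1 x y := by
    intro x y hxy
    by_contra hno
    obtain ⟨L, hL, e⟩ := h.explain le_rfl hxy hno
    have k := hE 1 _ _ (by norm_num) e
    have e1 : ¬ A 1 q z := fun e => by rw [if_pos e] at hc1; omega
    have e2 : ¬ A 1 p w := fun e => by rw [if_pos e] at hc1; omega
    have e3 : ¬ A 1 z v := fun e => by rw [if_pos e] at hc1; omega
    have e4 : ¬ A 1 w v := fun e => by rw [if_pos e] at hc1; omega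
    have es := h.symm e
    have k' : L x = z ∧ L y = w ∨ L x = w ∧ L y = z := by
      clear hE hc ho h hall hno hxy
      grind
    by_cases hLb : Function.Bijective L
    · have m1 : ∀ {y}, L y = L z → y = z := fun e => hLb.1 e
      have m2 : ∀ {y}, L y = L w → y = w := fun e => hLb.1 e
      have k3 := ho L hL hLb
      have h1' := h.symm h1
      clear hE hc h hall hxy k hc1 step ho
      grind
    · have k3 := (h.nonperm L hL hLb).1
      have k4 := k3 x
      have k5 := k3 y
      tauto
  have h3 : ∀ x y, A 2 x y ↔ A 1 x y := fun x y => ⟨h2 x y, h.mono (by norm_num)⟩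
  have hc2 := hc 2 (by norm_num)
  simp only [h3, if_pos h1] at hc2
  omega

-- A bijective letter other than the identity and the swap identifies the edge missing at time 4.
-- Pulling back along bijective letters shows that further edges appear late, until an edge has to
-- appear at time 2 or 4 that no letter explains.
open scoped Classical in
theorem false (h : FiveChain S A q p z w v)
    (hc : ∀ t ≤ 5, ((if A t q z then 1 else 0) + ((if A t p w then 1 else 0) +
      ((if A t z w then 1 else 0) + ((if A t z v then 1 else 0) +
      (if A t w v then 1 else 0))))) = t) : False := by
  by_cases ho : ∀ σ ∈ S, Function.Bijective σ →
      (σ q = q ∧ σ p = p ∧ σ z = z ∧ σ w = w ∧ σ v = v) ∨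
      (σ q = p ∧ σ p = q ∧ σ z = w ∧ σ w = z ∧ σ v = v)
  · exact h.false_of_id_or_swap hc ho
  have hn := h.nodup
  simp only [List.nodup_cons, List.mem_cons, List.not_mem_nil, or_false, not_or] at hn
  have hall := h.all
  have hE := fun (t x y) (ht : t ≤ 5) => h.edges (t := t) (x := x) (y := y) ht
  simp only [Sym2.eq_iff] at hE
  have hc4 := hc 4 (by norm_num)
  have hc3 := hc 3 (by norm_num)
  have hc2 := hc 2 (by norm_num)
  have hpc := fun {σ : V → V} => h.perm_cases (σ := σ) (by
    split_ifs at hc4 with h1 h2 h3 h4 h5 <;> first | omega | simp [*])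
  have mono := fun {s t x y} => h.mono (s := s) (t := t) (x := x) (y := y)
  have sy := fun {t x y} => h.symm (t := t) (x := x) (y := y)
  have hnp := fun {L : V → V} (hL : L ∈ S) (hLb : ¬ Function.Bijective L) =>
    (h.nonperm L hL hLb).1
  push Not at ho
  obtain ⟨σ, hσ, hσb, ho⟩ := ho
  obtain ⟨π, hπ, hπb, hπq⟩ := h.moves
  rcases hpc hσ hσb with e | e | ⟨e1, e2, e3, e4, e5, hm⟩ | ⟨e1, e2, e3, e4, e5, hm⟩ |
    ⟨e1, e2, e3, e4, e5, hm⟩ | ⟨e1, e2, e3, e4, e5, hm⟩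
  · tauto
  · tauto
  · -- `w v` is missing
    have x1 : ¬ A 3 q z := fun e => hm (sy (h.pull σ hσ (by rw [e5, e4]; exact e)))
    have x2 : ¬ A 2 p w := fun e => x1 (h.pull σ hσ (by rw [e1, e3]; exact e))
    have x3 : ¬ A 1 z v := fun e => x2 (h.pull σ hσ (by rw [e2, e4]; exact sy e))
    have y1 : ¬ A 2 q z := fun e => x1 (mono (by norm_num) e)
    have y2 : ¬ A 2 w v := fun e => hm (mono (by norm_num) e)
    have z1 : ¬ A 1 q z := fun e => y1 (mono (by norm_num) e)
    have z2 : ¬ A 1 w v := fun e => y2 (mono (by norm_num) e)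
    have z3 : ¬ A 1 p w := fun e => x2 (mono (by norm_num) e)
    rw [if_neg y1, if_neg x2, if_neg y2] at hc2
    have hzv : A 2 z v := by split_ifs at hc2 <;> first | assumption | omega
    have w1 : A 4 q z ∧ A 4 p w ∧ A 4 z v := by
      rw [if_neg hm] at hc4
      split_ifs at hc4 <;> first | (exfalso; omega) | simp [*]
    obtain ⟨L, hL, e⟩ := h.explain le_rfl hzv x3
    have k := hE 1 _ _ (by norm_num) e
    have k1 := sy e
    by_cases hLb : Function.Bijective L
    · have k2 := hpc hL hLb
      clear hE hc h hall hpc hnp sy mono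
      grind
    · have k2 := hnp hL hLb z
      have k3 := hnp hL hLb v
      clear hE hc h hall hpc hnp sy mono
      grind
  · -- `q z` is missing
    have x1 : ¬ A 3 p w := fun e => hm (h.pull σ hσ (by rw [e1, e3]; exact e))
    have y1 : ¬ A 3 q z := fun e => hm (mono (by norm_num) e)
    have z1 : ¬ A 1 q z := fun e => y1 (mono (by norm_num) e)
    have w1 : A 4 p w ∧ A 4 z v ∧ A 4 w v := by
      rw [if_neg hm] at hc4
      split_ifs at hc4 <;> first | (exfalso; omega) | simp [*]
    obtain ⟨L, hL, e⟩ := h.explain (by norm_num) w1.1 x1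
    have k := hE 3 _ _ (by norm_num) e
    have k1 := sy e
    by_cases hLb : Function.Bijective L
    · have k2 := hpc hL hLb
      clear hE hc h hall hpc hnp sy mono hc2 hc3 hc4 ho
      grind
    · have k2 := hnp hL hLb p
      have k3 := hnp hL hLb w
      obtain ⟨-, u, u', huu, hadj, hu, hu', -⟩ := h.nonperm L hL hLb
      have k4 := hE 1 _ _ (by norm_num) hadj
      have k5 := sy hadj
      have k6 : (L p = w ∧ L w = v ∨ L p = v ∧ L w = w) ∧ A 1 z v := by
        clear hE hc h hall hpc hnp sy mono hc2 hc3 hc4 ho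
        grind (splits := 25)
      have k7 : A 2 w v := h.pull σ hσ (by rw [e4, e5]; exact sy k6.2)
      refine x1 (h.pull L hL ?_)
      rcases k6.1 with ⟨k8, k9⟩ | ⟨k8, k9⟩ <;> rw [k8, k9]
      · exact k7
      · exact sy k7
  · -- `p w` is missing
    have w1 : A 4 q z ∧ A 4 z v ∧ A 4 w v := by
      rw [if_neg hm] at hc4
      split_ifs at hc4 <;> first | (exfalso; omega) | simp [*]
    have hπ' : π p = q ∧ π w = z := by
      have := hpc hπ hπb
      clear hE hc h hall hpc hnp sy mono hc2 hc3 hc4 ho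
      grind
    have x1 : ¬ A 3 q z := fun e => hm (h.pull π hπ (by rw [hπ'.1, hπ'.2]; exact e))
    have y1 : ¬ A 3 p w := fun e => hm (mono (by norm_num) e)
    have z1 : ¬ A 1 p w := fun e => y1 (mono (by norm_num) e)
    obtain ⟨L, hL, e⟩ := h.explain (by norm_num) w1.1 x1
    have k := hE 3 _ _ (by norm_num) e
    have k1 := sy e
    by_cases hLb : Function.Bijective L
    · have k2 := hpc hL hLb
      clear hE hc h hall hpc hnp sy mono hc2 hc3 hc4 ho
      grind
    · have k2 := hnp hL hLb q
      have k3 := hnp hL hLb z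
      obtain ⟨-, u, u', huu, hadj, hu, hu', -⟩ := h.nonperm L hL hLb
      have k4 := hE 1 _ _ (by norm_num) hadj
      have k5 := sy hadj
      have k6 : (L q = w ∧ L z = v ∨ L q = v ∧ L z = w) ∧ A 1 w v := by
        clear hE hc h hall hpc hnp sy mono hc2 hc3 hc4 ho
        grind (splits := 25)
      refine x1 (mono (show 2 ≤ 3 by norm_num) (h.pull L hL ?_))
      rcases k6.1 with ⟨k8, k9⟩ | ⟨k8, k9⟩ <;> rw [k8, k9]
      · exact k6.2
      · exact sy k6.2
  · -- `z v` is missing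
    have w1 : A 4 q z ∧ A 4 p w ∧ A 4 w v := by
      rw [if_neg hm] at hc4
      split_ifs at hc4 <;> first | (exfalso; omega) | simp [*]
    have hπ' : π p = q ∧ π w = z ∧ π z = w ∧ π v = v := by
      have := hpc hπ hπb
      clear hE hc h hall hpc hnp sy mono hc2 hc3 hc4 ho
      grind
    obtain ⟨p1, p2, p3, p4⟩ := hπ'
    have x1 : ¬ A 3 w v := fun e => hm (h.pull π hπ (by rw [p3, p4]; exact e))
    have x2 : ¬ A 2 p w := fun e => x1 (sy (h.pull σ hσ (by rw [e4, e5]; exact e)))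
    have x3 : ¬ A 1 q z := fun e => x2 (h.pull π hπ (by rw [p1, p2]; exact e))
    have y1 : ¬ A 2 w v := fun e => x1 (mono (by norm_num) e)
    have y2 : ¬ A 2 z v := fun e => hm (mono (by norm_num) e)
    have z1 : ¬ A 1 p w := fun e => x2 (mono (by norm_num) e)
    have z2 : ¬ A 1 w v := fun e => y1 (mono (by norm_num) e)
    have z3 : ¬ A 1 z v := fun e => y2 (mono (by norm_num) e)
    rw [if_neg x2, if_neg y1, if_neg y2] at hc2
    have hqz : A 2 q z := by split_ifs at hc2 <;> first | assumption | omega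
    obtain ⟨L, hL, e⟩ := h.explain le_rfl hqz x3
    have k := hE 1 _ _ (by norm_num) e
    have k1 := sy e
    by_cases hLb : Function.Bijective L
    · have k2 := h.perm L hL hLb
      clear hE hc h hall hpc hnp sy mono hc2 hc3 hc4 ho
      grind
    · have k2 := hnp hL hLb q
      have k3 := hnp hL hLb z
      clear hE hc h hall hpc hnp sy mono hc2 hc3 hc4 ho
      grind

end FiveChain

theorem MovesDup.false_of_card_five (h : MovesDup S 8 q z π) (hn : Fintype.card V = 5) : False := by
  obtain ⟨p, w, v, h1, h2⟩ := h.exists_fiveChain hn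
  exact h1.false h2

end MovedFive

/-! ### The bound for triple-free automata -/

section Bound

variable {V : Type*} [Fintype V] [DecidableEq V] {S : Set (V → V)} {T : ℕ} {q z : V}

theorem SameMiss.false (h : SameMiss S T q z) (h4 : 4 ≤ Fintype.card V)
    (h14 : Fintype.card V < 14) (hT : T = floorTable (Fintype.card V) + 1)
    (hqz : (mergeGraph S (T - 2)).Adj q z) : False := by
  by_cases h6 : 6 ≤ Fintype.card V
  · exact h.false_of_six_le h6 h14 hT
  have hn : Fintype.card V = 4 ∧ T = 6 ∨ Fintype.card V = 5 ∧ T = 8 := by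
    subst hT
    generalize Fintype.card V = n at *
    interval_cases n <;> decide
  by_cases hfix : ∀ σ ∈ S, Function.Bijective σ → σ q = q
  · rcases hn with ⟨hn, rfl⟩ | ⟨hn, rfl⟩
    · exact h.false_of_fixed_of_card_four hn hfix
    · exact h.false_of_fixed_of_card_five hn hqz hfix
  · push Not at hfix
    obtain ⟨π, hπ, hb, hne⟩ := hfix
    have hM : MovesDup S T q z π := ⟨h, hπ, hb, hne⟩
    rcases hn with ⟨hn, rfl⟩ | ⟨hn, rfl⟩
    · exact hM.false_of_card_four hn
    · exact hM.false_of_card_five hn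

theorem SameDup.false (h : SameDup S q) (h4 : 4 ≤ Fintype.card V)
    (h14 : Fintype.card V < 14) (hT : TripleFree S (floorTable (Fintype.card V) + 1))
    (hsc : StronglyConnected S) (hsync : Synchronizing S) : False := by
  have h5 : ∀ n ∈ Finset.Ico 4 14, 5 ≤ floorTable n := by decide
  have h5 := h5 _ (Finset.mem_Ico.2 ⟨h4, h14⟩)
  rcases h.isolated_or hT (by omega) with hiso | ⟨z, hz, hmiss⟩
  · have hiso' : ∀ t, t ≤ floorTable (Fintype.card V) - 1 → ∀ x, ¬ (mergeGraph S t).Adj q x :=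
      fun t ht x hx => hiso x (mergeGraph_mono (by omega) hx)
    by_cases h6 : 6 ≤ Fintype.card V
    · exact isolated_false h h6 h14 hT hsc hsync (hiso' _ (by split_ifs <;> omega))
    · exact isolated_false_small h (by omega) hT hsc hsync (hiso' _ le_rfl)
  · exact SameMiss.false ⟨h, by omega, hT, hsc, hsync, hmiss, hz.ne⟩ h4 h14 rfl hz

theorem exists_max_defect (hn : 3 ≤ Fintype.card V) (hsync : Synchronizing S) :
    ∃ a ∈ S, 0 < defect a ∧ ∀ L ∈ S, defect L ≤ defect a := by
  have hpos : ∃ L ∈ S, 0 < defect L := by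
    by_contra! hcon
    obtain ⟨x, t, f, hf, hx⟩ := hsync
    have h1 := defect_word_le hcon hf
    have h2 := defect_eq_zero_iff.1 (show defect f = 0 by omega)
    obtain ⟨y, z, hyz⟩ := Fintype.exists_pair_of_one_lt_card (α := V) (by omega)
    exact hyz (h2.1 ((hx y).trans (hx z).symm))
  obtain ⟨L₀, hL₀, h0⟩ := hpos
  obtain ⟨a, ha, hmax⟩ := Set.exists_max_image S defect (Set.toFinite _) ⟨L₀, hL₀⟩
  exact ⟨a, ha, h0.trans_le (hmax _ hL₀), hmax⟩

theorem two_mul_defect_le (hT : TripleFree S T) (h : 1 < T) {a : V → V} (ha : a ∈ S) :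
    2 * defect a ≤ Fintype.card V := by
  have := two_mul_defect_add_deficiency hT (IsWord.letter ha) h
  omega

/-- For fewer than 28 states, the triple rendezvous time is at most the tabulated value. -/
theorem not_tripleFree_floorTable (h4 : 4 ≤ Fintype.card V) (h28 : Fintype.card V < 28)
    (hsc : StronglyConnected S) (hsync : Synchronizing S) :
    ¬ TripleFree S (floorTable (Fintype.card V) + 1) := by
  intro hT
  obtain ⟨a, ha, hpos, hmax⟩ := exists_max_defect (by omega) hsync
  by_cases hcount : 2 ≤ defect a ∨ 14 ≤ Fintype.card V
  · have h5 : ∀ n ∈ Finset.Ico 4 28, 5 ≤ floorTable n := by decide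
    have h5 := h5 _ (Finset.mem_Ico.2 ⟨h4, h28⟩)
    have h2 := two_mul_defect_le hT (by omega) ha
    obtain ⟨h6, h7⟩ := lpCap_small _ (Finset.mem_Ico.2 ⟨h4, h28⟩) (defect a)
      (Finset.mem_Icc.2 ⟨by split_ifs <;> omega, by omega⟩)
    have := lpCap_count (by omega) hT hsc hsync ha hmax hpos
      (t := floorTable (Fintype.card V) - (Fintype.card V - defect a + 1)) (by omega) (by omega)
    omega
  · push Not at hcount
    have hr : ∀ L ∈ S, defect L ≤ 1 := fun L hL => (hmax L hL).trans (by omega)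
    have hb : ¬ Function.Bijective a := fun e => by
      rw [← defect_eq_zero_iff] at e
      omega
    obtain ⟨u, u', hne, hu⟩ := exists_dup hb
    have hq : a u ∈ dups a := mem_dups.2 ⟨u, u', hne, rfl, hu.symm⟩
    refine SameDup.false (q := a u) ⟨hr, fun L hL hLb => ?_, a, ha, hb⟩ h4 hcount.2 hT hsc hsync
    obtain ⟨v, v', hne', hv⟩ := exists_dup hLb
    have hp : L v ∈ dups L := mem_dups.2 ⟨v, v', hne', rfl, hv.symm⟩
    by_contra hmem
    have hpq : L v ≠ a u := fun e => hmem (e ▸ hp)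
    exact two_dups_false h4 hcount.2 hT hsc hsync hr hL ha hp hq hpq

/-- The comparison of `floorTable n` with `tripleBound n`, squared after isolating the root. -/
theorem floorTable_le : ∀ n ∈ Finset.Ico 4 28,
    (8 * (floorTable n : ℤ) + n ^ 2 - 6 * n) ^ 2 ≤ n ^ 2 * (5 * n ^ 2 + 4 * n - 12) := by
  decide +kernel

theorem floorTable_le_tripleBound {n : ℕ} (h4 : 4 ≤ n) (h28 : n < 28) :
    (floorTable n : ℝ) ≤ tripleBound n := by
  have h1 : (8 * (floorTable n : ℝ) + n ^ 2 - 6 * n) ^ 2 ≤ n ^ 2 * (5 * n ^ 2 + 4 * n - 12) := by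
    exact_mod_cast floorTable_le n (Finset.mem_Ico.2 ⟨h4, h28⟩)
  have h2 := (le_abs_self _).trans (Real.abs_le_sqrt h1)
  rw [Real.sqrt_mul (sq_nonneg _), Real.sqrt_sq (Nat.cast_nonneg n)] at h2
  unfold tripleBound
  linarith

theorem TripleFree.le_tripleBound (hT : TripleFree S T) (h4 : 4 ≤ Fintype.card V)
    (hsc : StronglyConnected S) (hsync : Synchronizing S) :
    (T : ℝ) ≤ tripleBound (Fintype.card V) := by
  by_cases h28 : Fintype.card V < 28
  · refine le_trans ?_ (floorTable_le_tripleBound h4 h28)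
    by_contra! hlt
    have hlt : floorTable (Fintype.card V) < T := by exact_mod_cast hlt
    exact not_tripleFree_floorTable h4 h28 hsc hsync (hT.mono hlt)
  push Not at h28
  by_contra! hlt
  obtain ⟨a, ha, hpos, hmax⟩ := exists_max_defect (by omega) hsync
  have hn : (28 : ℝ) ≤ Fintype.card V := by exact_mod_cast h28
  generalize hnn : Fintype.card V = n at *
  have hs : 0 ≤ 5 * (n : ℝ) ^ 2 + 4 * n - 12 := by nlinarith
  have hsq := Real.sq_sqrt hs
  have hs2 : 2 * (n : ℝ) ≤ √(5 * (n : ℝ) ^ 2 + 4 * n - 12) :=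
    Real.le_sqrt_of_sq_le (by nlinarith)
  unfold tripleBound at hlt
  generalize √(5 * (n : ℝ) ^ 2 + 4 * n - 12) = s at *
  have hT3 : n + 3 < T := by
    have : (n : ℝ) + 3 < T := by nlinarith
    exact_mod_cast this
  have h2 := two_mul_defect_le hT (by omega) ha
  -- This `u` is the positive root of `u ^ 2 + u * n = n ^ 2 + n - 3`, and `tripleBound n` equals `n
  -- * (u + 3) / 4`.
  have h3 := lpCap_large (n := n) (r := defect a) (t := T - (n - defect a + 2)) (T := T) h28 hpos
    (by omega) (u := (s - n) / 2) (by linarith) (by nlinarith) (by linarith) (by omega)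
  have h4 := lpCap_count (by omega) hT hsc hsync ha hmax hpos
    (t := T - (n - defect a + 2)) (by omega) (by omega)
  rw [hnn] at h4
  omega

end Bound

/-! ### From matrices to maps -/

section Translation

variable {n : ℕ} {S : Set (Matrix (Fin n) (Fin n) ℕ)}

/-- The matrix of a map of states. -/
def mapMatrix (f : Fin n → Fin n) : Matrix (Fin n) (Fin n) ℕ :=
  fun i j => if f i = j then 1 else 0

theorem mapMatrix_mul (f g : Fin n → Fin n) : mapMatrix f * mapMatrix g = mapMatrix (g ∘ f) := by
  ext i j
  rw [Matrix.mul_apply, Finset.sum_eq_single (f i)]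
  · simp [mapMatrix]
  · intro k _ hk
    simp [mapMatrix, Ne.symm hk]
  · simp

theorem mapMatrix_id : mapMatrix (id : Fin n → Fin n) = 1 := by
  ext i j
  simp [mapMatrix, Matrix.one_apply]

theorem mapMatrix_apply_ne_zero {f : Fin n → Fin n} {i j : Fin n} :
    mapMatrix f i j ≠ 0 ↔ f i = j := by
  simp [mapMatrix]

/-- The maps of the letters of an automaton. -/
def letterMaps (S : Set (Matrix (Fin n) (Fin n) ℕ)) : Set (Fin n → Fin n) :=
  {f | mapMatrix f ∈ S}

theorem IsAutomaton.exists_map (hS : IsAutomaton S) {L : Matrix (Fin n) (Fin n) ℕ} (hL : L ∈ S) :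
    ∃ f, L = mapMatrix f := by
  obtain ⟨h01, hsum⟩ := hS L hL
  have hrow : ∀ i, ∃ j, ∀ k, L i k = if j = k then 1 else 0 := by
    intro i
    have h1 : ∑ j, L i j = 1 := by simpa [Matrix.mulVec, dotProduct] using congrFun hsum i
    obtain ⟨j, -, hj⟩ := Finset.exists_ne_zero_of_sum_ne_zero (by rw [h1]; exact one_ne_zero)
    have hj1 : L i j = 1 := (h01 i j).resolve_left hj
    refine ⟨j, fun k => ?_⟩
    by_cases hk : j = k
    · rw [if_pos hk, ← hk, hj1]
    · rw [if_neg hk]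
      have h2 : L i j + L i k ≤ ∑ j, L i j := by
        rw [← Finset.sum_pair hk]
        exact Finset.sum_le_sum_of_subset (Finset.subset_univ _)
      omega
  choose f hf using hrow
  exact ⟨f, by ext i j; exact hf i j⟩

theorem IsAutomaton.mem_wordsOfLength (hS : IsAutomaton S) {t : ℕ}
    {W : Matrix (Fin n) (Fin n) ℕ} :
    W ∈ wordsOfLength S t ↔ ∃ f, IsWord (letterMaps S) t f ∧ W = mapMatrix f := by
  constructor
  · rintro ⟨l, rfl, hl, rfl⟩
    induction l with
    | nil => exact ⟨id, IsWord.nil, mapMatrix_id.symm⟩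
    | cons L l ih =>
      obtain ⟨g, hg, e⟩ := ih fun L' hL' => hl L' (List.mem_cons_of_mem _ hL')
      have hL := hl L List.mem_cons_self
      obtain ⟨f, rfl⟩ := hS.exists_map hL
      exact ⟨g ∘ f, IsWord.cons hL hg, by rw [List.prod_cons, e, mapMatrix_mul]⟩
  · rintro ⟨f, hf, rfl⟩
    induction hf with
    | nil => exact ⟨[], rfl, by simp, by rw [List.prod_nil, mapMatrix_id]⟩
    | @cons t f g hf _ ih =>
      obtain ⟨l, hl, hl', e⟩ := ih
      refine ⟨mapMatrix f :: l, by rw [List.length_cons, hl], ?_,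
        by rw [List.prod_cons, e, mapMatrix_mul]⟩
      intro L hL
      rcases List.mem_cons.1 hL with rfl | hL
      · exact hf
      · exact hl' L hL

theorem IsAutomaton.stronglyConnected (hS : IsAutomaton S) (h : IsStronglyConnected S) :
    StronglyConnected (letterMaps S) := by
  intro i j
  obtain ⟨t, W, hW, hij⟩ := h i j
  obtain ⟨f, hf, rfl⟩ := hS.mem_wordsOfLength.1 hW
  exact ⟨t, f, hf, mapMatrix_apply_ne_zero.1 (by rw [hij]; exact one_ne_zero)⟩

theorem IsAutomaton.synchronizing (hS : IsAutomaton S) (h : IsSynchronizing S) :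
    Synchronizing (letterMaps S) := by
  obtain ⟨i, t, hW⟩ := h
  obtain ⟨f, hf, e⟩ := hS.mem_wordsOfLength.1 hW
  refine ⟨i, t, f, hf, fun y => mapMatrix_apply_ne_zero.1 ?_⟩
  rw [← e]
  simp [Matrix.vecMulVec_apply]

theorem IsAutomaton.mem_tripleTimes (hS : IsAutomaton S) {t : ℕ} :
    t ∈ tripleTimes S ↔
      ∃ s ≤ t, ∃ f, IsWord (letterMaps S) s f ∧ ∃ j, 3 ≤ {i | f i = j}.ncard := by
  constructor
  · rintro ⟨v, ⟨W, ⟨s, hs, hW⟩, j, rfl⟩, hv⟩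
    obtain ⟨f, hf, rfl⟩ := hS.mem_wordsOfLength.1 hW
    exact ⟨s, hs, f, hf, j, by simpa only [weight, mapMatrix_apply_ne_zero] using hv⟩
  · rintro ⟨s, hs, f, hf, j, hj⟩
    refine ⟨_, ⟨mapMatrix f, ⟨s, hs, hS.mem_wordsOfLength.2 ⟨f, hf, rfl⟩⟩, j, rfl⟩, ?_⟩
    simpa only [weight, mapMatrix_apply_ne_zero] using hj

theorem IsAutomaton.tripleTimes_nonempty (hS : IsAutomaton S) (hn : 3 ≤ n)
    (h : IsSynchronizing S) : (tripleTimes S).Nonempty := by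
  obtain ⟨x, t, f, hf, hx⟩ := hS.synchronizing h
  refine ⟨t, hS.mem_tripleTimes.2 ⟨t, le_rfl, f, hf, x, ?_⟩⟩
  simpa [hx, Set.ncard_univ] using hn

theorem IsAutomaton.tripleFree (hS : IsAutomaton S) :
    TripleFree (letterMaps S) (tripleRendezvousTime S) := by
  intro t ht f hf x y z hxy hyz
  by_contra! hne
  refine Nat.notMem_of_lt_sInf ht (hS.mem_tripleTimes.2 ⟨t, le_rfl, f, hf, f x, ?_⟩)
  rw [← Set.ncard_eq_three.2 ⟨x, y, z, hne.1, hne.2.2, hne.2.1, rfl⟩]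
  refine Set.ncard_le_ncard ?_ (Set.toFinite _)
  rintro w (rfl | rfl | rfl)
  · rfl
  · exact hxy.symm
  · exact (hxy.trans hyz).symm

theorem IsAutomaton.tripleRendezvousTime_le (hS : IsAutomaton S) (hn : 4 ≤ n)
    (hsc : IsStronglyConnected S) (hsync : IsSynchronizing S) :
    (tripleRendezvousTime S : ℝ) ≤ tripleBound n := by
  have := hS.tripleFree.le_tripleBound (by rwa [Fintype.card_fin]) (hS.stronglyConnected hsc)
    (hS.synchronizing hsync)
  rwa [Fintype.card_fin] at this

end Translation

/-! ### Asymptotics and the final statement -/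

theorem tendsto_tripleBound :
    Tendsto (fun n : ℕ => tripleBound n / (n : ℝ) ^ 2) atTop (𝓝 ((Real.sqrt 5 - 1) / 8)) := by
  have hinv : Tendsto (fun n : ℕ => ((n : ℝ))⁻¹) atTop (𝓝 0) := tendsto_inv_atTop_nhds_zero_nat
  -- The quotient as a function of `x = 1 / n`, evaluated at zero in the limit.
  have hcont : Continuous fun x : ℝ => (√(5 + 4 * x - 12 * x ^ 2) - 1 + 6 * x) / 8 := by fun_prop
  have h := (hcont.tendsto 0).comp hinv
  simp only [mul_zero, add_zero, ne_eq, OfNat.ofNat_ne_zero, not_false_eq_true, zero_pow,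
    sub_zero] at h
  refine h.congr' ?_
  filter_upwards [eventually_gt_atTop 0] with n hn
  have hn' : (0 : ℝ) < n := by exact_mod_cast hn
  have h1 : 5 * (n : ℝ) ^ 2 + 4 * n - 12 =
      n ^ 2 * (5 + 4 * (n : ℝ)⁻¹ - 12 * ((n : ℝ)⁻¹) ^ 2) := by
    field_simp
  simp only [Function.comp, tripleBound]
  rw [h1, Real.sqrt_mul (sq_nonneg _), Real.sqrt_sq hn'.le]
  field_simp

theorem limit_lt : (Real.sqrt 5 - 1) / 8 < 1 / 6.4 := by
  -- The constant is exactly `1 + 8 / 6.4`.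
  have : Real.sqrt 5 < 2.25 := (Real.sqrt_lt' (by norm_num)).2 (by norm_num)
  norm_num at this ⊢
  linarith

theorem mainTheorem1 :
    (∀ (n : ℕ), 4 ≤ n → ∀ (S : Set (Matrix (Fin n) (Fin n) ℕ)),
      IsAutomaton S → IsStronglyConnected S → IsSynchronizing S →
        (tripleTimes S).Nonempty ∧ (tripleRendezvousTime S : ℝ) ≤ tripleBound n) ∧
    Tendsto (fun n : ℕ => tripleBound n / (n : ℝ) ^ 2) atTop (𝓝 ((Real.sqrt 5 - 1) / 8)) ∧
    (∃ N : ℕ, ∀ (n : ℕ), N ≤ n → ∀ (S : Set (Matrix (Fin n) (Fin n) ℕ)),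
      IsAutomaton S → IsStronglyConnected S → IsSynchronizing S →
        (tripleRendezvousTime S : ℝ) < (n : ℝ) ^ 2 / 6.4) := by
  refine ⟨fun n hn S hS hsc hsync => ⟨hS.tripleTimes_nonempty (by omega) hsync,
    hS.tripleRendezvousTime_le hn hsc hsync⟩, tendsto_tripleBound, ?_⟩
  obtain ⟨N, hN⟩ := eventually_atTop.1
    ((tendsto_tripleBound.eventually_lt_const limit_lt).and (eventually_ge_atTop 4))
  refine ⟨N, fun n hn S hS hsc hsync => ?_⟩
  obtain ⟨h1, h2⟩ := hN n hn
  have hn' : (0 : ℝ) < (n : ℝ) ^ 2 := by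
    have : (4 : ℝ) ≤ n := by exact_mod_cast h2
    positivity
  refine (hS.tripleRendezvousTime_le h2 hsc hsync).trans_lt ?_
  rw [div_lt_iff₀ hn'] at h1
  rwa [div_eq_inv_mul, ← one_div]
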